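/- Let $\Omega\subseteq\mathbb R$ and $S\subseteq\mathbb R$ be nonempty open intervals, let $a,b,c\in C^\infty(\Omega)$ with $a>0$, and consider the equation $$u_t=a(x)u_{xx}+b(x)u_x+c(x)u,\qquad t\in S,\ x\in\Omega. \tag{E}$$ Its symmetry algebra $\mathfrak g$ (modulo the superposition symmetries $f(x,t)\partial_u$, $f$ a solution) is the set of smooth vector fields $\tau(t)\partial_t+\xi(x,t)\partial_x+\phi(x,t)u\,\partial_u$ on $S\times\Omega\times\mathbb R$ whose second prolongation annihilates $u_t-au_{xx}-bu_x-cu$ at every 2-jet at which this expression vanishes. It always contains $\partial_t$ and $M=u\,\partial_u$; it is called nontrivial if it is larger than $\langle\partial_t,M\rangle$. Let $I$ denote an antiderivative of $1/\sqrt a$ on $\Omega$ (determined up to an additive constant), and put $$J=\frac1{\sqrt a}\Bigl(\frac{a'}2-b\Bigr),\qquad K=\tfrac12\sqrt a\,J'-\tfrac14J^2+c .$$ Then $\mathfrak g$ is a Lie algebra under the bracket of vector fields, and the following hold. 1. If $\mathfrak g$ is nontrivial, then $\dim\mathfrak g\in\{4,6\}$. 2. $\dim\mathfrak g=4$ if and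 only if, for some choice of the antiderivative $I$ (nowhere zero on $\Omega$) and some constants $\mu\neq0,c_2,c_0$, $$K=\frac{\mu}{I^2}+c_2I^2+c_0 .$$ In this case $\mathfrak g\cong\mathfrak{sl}(2,\mathbb R)\oplus\langle M\rangle$, and $\mathfrak g$ has the basis $\partial_t,\ v_2,\ v_3,\ M$, where - if $c_2=0$: $v_2=t\partial_t+\frac12\sqrt a I\partial_x+(c_0t+\frac14IJ)u\partial_u$, $v_3=t^2\partial_t+t\sqrt aI\partial_x+\frac14[2(2c_0t-1)t-I^2+2tIJ]u\partial_u$; - if $c_2=-\kappa^2$, $\kappa>0$: $v_2=e^{4\kappa t}\{\partial_t+2\kappa\sqrt aI\partial_x-(-c_0+\kappa+2\kappa^2I^2-\kappa IJ)u\partial_u\}$, $v_3=e^{-4\kappa t}\{\partial_t-2\kappa\sqrt aI\partial_x+(c_0+\kappa-2\kappa^2I^2-\kappa IJ)u\partial_u\}$; - if $c_2=\kappa^2$, $\kappa>0$: $v_2=\cos4\kappa t\,\partial_t-2\kappa\sin4\kappa t\sqrt aI\partial_x+[c_0\cos4\kappa t+2\kappa^2\cos4\kappa t\,I^2+\kappa\sin4\kappa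 t(1-IJ)]u\partial_u$, $v_3=\sin4\kappa t\,\partial_t+2\kappa\cos4\kappa t\sqrt aI\partial_x+[c_0\sin4\kappa t+2\kappa^2\sin4\kappa t\,I^2-\kappa\cos4\kappa t(1-IJ)]u\partial_u$. 3. For any choice of $I$, $\dim\mathfrak g=6$ if and only if $$K=c_2I^2+c_1I+c_0$$ for some constants $c_2,c_1,c_0$. In this case $\mathfrak g$ is isomorphic to the heat (Schrödinger) algebra, that is, the semidirect sum of $\mathfrak{sl}(2,\mathbb R)$ with the Heisenberg ideal $\mathrm{nil}(3)=\{(p,q,z)\}$, $[(p,q,z),(p',q',z')]=(0,0,pq'-qp')$, on which $\mathfrak{sl}(2,\mathbb R)$ acts by its standard representation on $(p,q)$ and trivially on $z$; and $\mathfrak g$ has the basis $\partial_t,v_2,v_3,v_4,v_5,M$, where - if $c_2=0$: $v_2=t\partial_t+\frac12\sqrt a(I-3c_1t^2)\partial_x+\frac14[I(6c_1t+J)+t(4c_0-2c_1^2t^2-3c_1tJ)]u\partial_u$, $v_3=t^2\partial_t+t\sqrt a(I-c_1t^2)\partial_x-\frac14[I^2-2tI(3c_1t+J)+t(2-4c_0t+c_1^2t^3+2c_1t^2J)]u\partial_u$,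 $v_4=t\sqrt a\partial_x+\frac12[-I+t(c_1t+J)]u\partial_u$, $v_5=\sqrt a\partial_x+\frac12(2c_1t+J)u\partial_u$; - if $c_2=-\kappa^2$, $\kappa>0$: $v_2=e^{4\kappa t}\{\partial_t+\frac1\kappa\sqrt a(-c_1+2\kappa^2I)\partial_x-\frac1{4\kappa^2}[c_1^2-4c_0\kappa^2+4\kappa^3+8\kappa^4I^2+2c_1\kappa J-4\kappa^2I(2c_1+\kappa J)]u\partial_u\}$, $v_3=e^{-4\kappa t}\{\partial_t+\frac1\kappa\sqrt a(c_1-2\kappa^2I)\partial_x-\frac1{4\kappa^2}[c_1^2-4c_0\kappa^2-4\kappa^3+8\kappa^4I^2-2c_1\kappa J+4\kappa^2I(-2c_1+\kappa J)]u\partial_u\}$, $v_4=e^{2\kappa t}\{\sqrt a\partial_x+\frac1{2\kappa}[(c_1-2\kappa^2I)+\kappa J]u\partial_u\}$, $v_5=e^{-2\kappa t}\{\sqrt a\partial_x+\frac1{2\kappa}[-(c_1-2\kappa^2I)+\kappa J]u\partial_u\}$; - if $c_2=\kappa^2$, $\kappa>0$: with $A=c_1^2+4c_0\kappa^2+8\kappa^4I^2+8c_1\kappa^2I$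 and $B=4\kappa^3-2c_1\kappa J-4\kappa^3IJ$, $v_2=\cos4\kappa t\,\partial_t-\frac1\kappa\sin4\kappa t\sqrt a(c_1+2\kappa^2I)\partial_x+\frac1{4\kappa^2}[A\cos4\kappa t+B\sin4\kappa t]u\partial_u$, $v_3=\sin4\kappa t\,\partial_t+\frac1\kappa\cos4\kappa t\sqrt a(c_1+2\kappa^2I)\partial_x+\frac1{4\kappa^2}[A\sin4\kappa t-B\cos4\kappa t]u\partial_u$, $v_4=\cos2\kappa t\sqrt a\partial_x+\frac1{2\kappa}[\sin2\kappa t(c_1+2\kappa^2I)+\kappa\cos2\kappa t\,J]u\partial_u$, $v_5=\sin2\kappa t\sqrt a\partial_x+\frac1{2\kappa}[-\cos2\kappa t(c_1+2\kappa^2I)+\kappa\sin2\kappa t\,J]u\partial_u$. -/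

import Mathlib

open scoped ContDiff

noncomputable section

namespace ParabolicSymmetry

open TopologicalSpace

/-! ### The Lie algebra of smooth vector fields on an open set of `(t, x, u)`-space -/

/-- The space of the independent variables `t`, `x` and the dependent variable `u`. -/
abbrev TXU : Type := ℝ × ℝ × ℝ

/-- Smooth vector fields on the open set `U`. A vector field on `U` is represented by its unique
extension by zero to the whole space. The value `(τ, ξ, η)` stands for `τ ∂_t + ξ ∂_x + η ∂_u`. -/
def SmoothVF (U : Opens TXU) : Submodule ℝ (TXU → TXU) where
  carrier := {X | ContDiffOn ℝ ∞ X (U : Set TXU) ∧ ∀ p, p ∉ U → X p = 0}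
  add_mem' := by
    rintro X Y ⟨hX, hX0⟩ ⟨hY, hY0⟩
    exact ⟨hX.add hY, fun p hp => by simp [hX0 p hp, hY0 p hp]⟩
  zero_mem' := ⟨contDiffOn_const, fun _ _ => rfl⟩
  smul_mem' := by
    rintro r X ⟨hX, hX0⟩
    exact ⟨hX.const_smul r, fun p hp => by simp [hX0 p hp]⟩

namespace SmoothVF

variable {U : Opens TXU}

theorem contDiffAt (X : SmoothVF U) {p : TXU} (hp : p ∈ U) : ContDiffAt ℝ ∞ (X : TXU → TXU) p :=
  X.2.1.contDiffAt (U.isOpen.mem_nhds hp)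

theorem differentiableAt (X : SmoothVF U) {p : TXU} (hp : p ∈ U) :
    DifferentiableAt ℝ (X : TXU → TXU) p :=
  (contDiffAt X hp).differentiableAt (by simp)

theorem apply_eq_zero (X : SmoothVF U) {p : TXU} (hp : p ∉ U) : (X : TXU → TXU) p = 0 :=
  X.2.2 p hp

/-- The Lie bracket `[X, Y]` of vector fields. -/
instance : Bracket (SmoothVF U) (SmoothVF U) where
  bracket X Y := ⟨VectorField.lieBracket ℝ (X : TXU → TXU) (Y : TXU → TXU), by
    refine ⟨fun p hp => ?_, fun p hp => ?_⟩
    · exact ((contDiffAt X hp).lieBracket_vectorField (contDiffAt Y hp)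
        (m := ∞) (by simp)).contDiffWithinAt
    · exact VectorField.lieBracket_eq_zero_of_eq_zero (apply_eq_zero X hp) (apply_eq_zero Y hp)⟩

theorem coe_lie (X Y : SmoothVF U) :
    ((⁅X, Y⁆ : SmoothVF U) : TXU → TXU) = VectorField.lieBracket ℝ (X : TXU → TXU) Y := rfl

theorem ext_on {X Y : SmoothVF U} (h : ∀ p ∈ U, (X : TXU → TXU) p = (Y : TXU → TXU) p) :
    X = Y := by
  apply Subtype.ext
  funext p
  by_cases hp : p ∈ U
  · exact h p hp
  · rw [apply_eq_zero X hp, apply_eq_zero Y hp]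

instance : LieRing (SmoothVF U) where
  add_lie X Y Z := ext_on fun p hp => by
    simp only [coe_lie, Submodule.coe_add, Pi.add_apply]
    exact VectorField.lieBracket_add_left (differentiableAt X hp) (differentiableAt Y hp)
  lie_add X Y Z := ext_on fun p hp => by
    simp only [coe_lie, Submodule.coe_add, Pi.add_apply]
    exact VectorField.lieBracket_add_right (differentiableAt Y hp) (differentiableAt Z hp)
  lie_self X := ext_on fun p _ => by simp [coe_lie]
  leibniz_lie X Y Z := ext_on fun p hp => by
    simp only [coe_lie, Submodule.coe_add, Pi.add_apply]
    exact VectorField.leibniz_identity_lieBracket (n := ∞)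
      (by simpa using (WithTop.coe_le_coe.2 le_top : ((2 : ℕ∞) : WithTop ℕ∞) ≤ ∞))
      (contDiffAt X hp) (contDiffAt Y hp) (contDiffAt Z hp)

instance : LieAlgebra ℝ (SmoothVF U) where
  lie_smul r X Y := ext_on fun p hp => by
    simp only [coe_lie, Submodule.coe_smul, Pi.smul_apply]
    exact VectorField.lieBracket_const_smul_right (differentiableAt Y hp)

end SmoothVF

/-- The domain `{(t, x, u) : t ∈ S, x ∈ Ω, u ∈ ℝ}`. -/
def dom (S Ω : Opens ℝ) : Opens TXU :=
  ⟨(S : Set ℝ) ×ˢ (Ω : Set ℝ) ×ˢ Set.univ, S.isOpen.prod (Ω.isOpen.prod isOpen_univ)⟩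

/-! ### Second prolongation and Lie's symmetry condition -/

/-- Partial derivative in `t` of a function of `(t, x)`. -/
def Dt (g : ℝ → ℝ → ℝ) (t x : ℝ) : ℝ := deriv (fun s => g s x) t

/-- Partial derivative in `x` of a function of `(t, x)`. -/
def Dx (g : ℝ → ℝ → ℝ) (t x : ℝ) : ℝ := deriv (fun y => g t y) x

/-- The components `τ`, `ξ`, `η` of `X`, evaluated along the graph `u = w (t, x)`. -/
def tauAlong (X : TXU → TXU) (w : ℝ → ℝ → ℝ) (t x : ℝ) : ℝ := (X (t, x, w t x)).1
def xiAlong (X : TXU → TXU) (w : ℝ → ℝ → ℝ) (t x : ℝ) : ℝ := (X (t, x, w t x)).2.1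
def etaAlong (X : TXU → TXU) (w : ℝ → ℝ → ℝ) (t x : ℝ) : ℝ := (X (t, x, w t x)).2.2

/-- Prolongation coefficient `η^t = D_t η - u_t D_t τ - u_x D_t ξ` at the 1-jet of `w` at `(t, x)`.
By the chain rule, a total derivative evaluated on the jet of `w` is the ordinary partial derivative
of the function evaluated along `w`. -/
def prolT (X : TXU → TXU) (w : ℝ → ℝ → ℝ) (t x : ℝ) : ℝ :=
  Dt (etaAlong X w) t x - Dt w t x * Dt (tauAlong X w) t x - Dx w t x * Dt (xiAlong X w) t x

/-- Prolongation coefficient `η^x = D_x η - u_t D_x τ - u_x D_x ξ` at the 1-jet of `w`. -/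
def prolX (X : TXU → TXU) (w : ℝ → ℝ → ℝ) (t x : ℝ) : ℝ :=
  Dx (etaAlong X w) t x - Dt w t x * Dx (tauAlong X w) t x - Dx w t x * Dx (xiAlong X w) t x

/-- Prolongation coefficient `η^{xx} = D_x η^x - u_{tx} D_x τ - u_{xx} D_x ξ` at the 2-jet of `w`. -/
def prolXX (X : TXU → TXU) (w : ℝ → ℝ → ℝ) (t x : ℝ) : ℝ :=
  Dx (prolX X w) t x - Dx (Dt w) t x * Dx (tauAlong X w) t x
    - Dx (Dx w) t x * Dx (xiAlong X w) t x

/-- `Δ = u_t - a(x) u_xx - b(x) u_x - c(x) u` at the 2-jet of `w` at `(t, x)`. -/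
def eqnAt (a b c : ℝ → ℝ) (w : ℝ → ℝ → ℝ) (t x : ℝ) : ℝ :=
  Dt w t x - a x * Dx (Dx w) t x - b x * Dx w t x - c x * w t x

/-- `pr⁽²⁾ X (Δ)` at the 2-jet of `w` at `(t, x)`. -/
def prolEqnAt (a b c : ℝ → ℝ) (X : TXU → TXU) (w : ℝ → ℝ → ℝ) (t x : ℝ) : ℝ :=
  prolT X w t x - a x * prolXX X w t x - b x * prolX X w t x - c x * etaAlong X w t x
    - xiAlong X w t x *
      (deriv a x * Dx (Dx w) t x + deriv b x * Dx w t x + deriv c x * w t x)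

/-- Lie's condition: `pr⁽²⁾ X` annihilates `Δ` at every 2-jet over `S × Ω` on which `Δ = 0`
(every 2-jet at a point is the jet of a smooth function `w`). -/
def IsPointSymmetry (S Ω : Opens ℝ) (a b c : ℝ → ℝ) (X : TXU → TXU) : Prop :=
  ∀ w : ℝ → ℝ → ℝ, ContDiff ℝ ∞ (fun q : ℝ × ℝ => w q.1 q.2) →
    ∀ t ∈ S, ∀ x ∈ Ω, eqnAt a b c w t x = 0 → prolEqnAt a b c X w t x = 0

/-- The vector field `τ(t) ∂_t + ξ(t, x) ∂_x + φ(t, x) u ∂_u`. -/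
def field (τ : ℝ → ℝ) (ξ φ : ℝ → ℝ → ℝ) : TXU → TXU :=
  fun p => (τ p.1, ξ p.1 p.2.1, φ p.1 p.2.1 * p.2.2)

/-- `X` is of the form `τ(t) ∂_t + ξ(t, x) ∂_x + φ(t, x) u ∂_u` on its domain, i.e. the
superposition symmetries `f(t, x) ∂_u` are factored out. -/
def HasLinearForm (S Ω : Opens ℝ) (X : TXU → TXU) : Prop :=
  ∃ (τ : ℝ → ℝ) (ξ φ : ℝ → ℝ → ℝ), ∀ p ∈ dom S Ω, X p = field τ ξ φ p

/-- `X` belongs to the span of the trivial symmetries `∂_t` and `u ∂_u`. -/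
def IsTrivialField (S Ω : Opens ℝ) (X : TXU → TXU) : Prop :=
  ∃ α β : ℝ, ∀ p ∈ dom S Ω, X p = field (fun _ => α) (fun _ _ => 0) (fun _ _ => β) p

/-- `𝔤` consists exactly of the smooth vector fields
`τ(t) ∂_t + ξ(t, x) ∂_x + φ(t, x) u ∂_u` on `S × Ω × ℝ` that are point symmetries of
`u_t = a u_xx + b u_x + c u`. -/
def IsSymmetryAlgebra (S Ω : Opens ℝ) (a b c : ℝ → ℝ)
    (𝔤 : LieSubalgebra ℝ (SmoothVF (dom S Ω))) : Prop :=
  ∀ X : SmoothVF (dom S Ω), X ∈ 𝔤 ↔ HasLinearForm S Ω X ∧ IsPointSymmetry S Ω a b c X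

/-- The vector fields `v i` (restricted to the domain) form a basis of `𝔤`. -/
def HasBasis {S Ω : Opens ℝ} {n : ℕ} (𝔤 : LieSubalgebra ℝ (SmoothVF (dom S Ω)))
    (v : Fin n → TXU → TXU) : Prop :=
  ∃ B : Module.Basis (Fin n) ℝ 𝔤,
    ∀ i, ∀ p ∈ dom S Ω, ((B i : SmoothVF (dom S Ω)) : TXU → TXU) p = v i p

/-! ### The functions `I`, `J` and the semi-invariant `K` -/

/-- `I = ∫ dx / √a`, an antiderivative of `1 / √a` on `Ω`. -/
def IsI (Ω : Opens ℝ) (a I : ℝ → ℝ) : Prop :=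
  ∀ x ∈ Ω, HasDerivAt I (1 / √(a x)) x

/-- `J = (a'/2 - b) / √a`. -/
def J (a b : ℝ → ℝ) (x : ℝ) : ℝ := (deriv a x / 2 - b x) / √(a x)

/-- `K = ½ √a J' - ¼ J² + c`. -/
def K (a b c : ℝ → ℝ) (x : ℝ) : ℝ :=
  1 / 2 * √(a x) * deriv (J a b) x - 1 / 4 * J a b x ^ 2 + c x

/-- `K = μ / I² + c₂ I² + c₀` on `Ω`. -/
def KForm4 (Ω : Opens ℝ) (a b c I : ℝ → ℝ) (μ c₂ c₀ : ℝ) : Prop :=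
  ∀ x ∈ Ω, I x ≠ 0 ∧ K a b c x = μ / I x ^ 2 + c₂ * I x ^ 2 + c₀

/-- `K = c₂ I² + c₁ I + c₀` on `Ω`. -/
def KForm6 (Ω : Opens ℝ) (a b c I : ℝ → ℝ) (c₂ c₁ c₀ : ℝ) : Prop :=
  ∀ x ∈ Ω, K a b c x = c₂ * I x ^ 2 + c₁ * I x + c₀

/-! ### The explicit bases -/

/-- `∂_t`. -/
def vT : TXU → TXU := field (fun _ => 1) (fun _ _ => 0) (fun _ _ => 0)

/-- `M = u ∂_u`. -/
def vM : TXU → TXU := field (fun _ => 0) (fun _ _ => 0) (fun _ _ => 1)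

/-- Case `K = μ / I² + c₂ I² + c₀` with `c₂ = 0`. -/
def basis4Zero (a b I : ℝ → ℝ) (c₀ : ℝ) : Fin 4 → TXU → TXU :=
  ![vT,
    field (fun t => t)
      (fun _ x => 1 / 2 * √(a x) * I x)
      (fun t x => c₀ * t + 1 / 4 * I x * J a b x),
    field (fun t => t ^ 2)
      (fun t x => t * √(a x) * I x)
      (fun t x => 1 / 4 * (2 * (2 * c₀ * t - 1) * t - I x ^ 2 + 2 * t * I x * J a b x)),
    vM]

/-- Case `K = μ / I² + c₂ I² + c₀` with `c₂ = -κ²`. -/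
def basis4Neg (a b I : ℝ → ℝ) (c₀ κ : ℝ) : Fin 4 → TXU → TXU :=
  ![vT,
    field (fun t => Real.exp (4 * κ * t))
      (fun t x => 2 * κ * Real.exp (4 * κ * t) * √(a x) * I x)
      (fun t x => -Real.exp (4 * κ * t) *
        (-c₀ + κ + 2 * κ ^ 2 * I x ^ 2 - κ * I x * J a b x)),
    field (fun t => Real.exp (-(4 * κ * t)))
      (fun t x => -(2 * κ * Real.exp (-(4 * κ * t)) * √(a x) * I x))
      (fun t x => Real.exp (-(4 * κ * t)) *
        (c₀ + κ - 2 * κ ^ 2 * I x ^ 2 - κ * I x * J a b x)),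
    vM]

/-- Case `K = μ / I² + c₂ I² + c₀` with `c₂ = κ²`. -/
def basis4Pos (a b I : ℝ → ℝ) (c₀ κ : ℝ) : Fin 4 → TXU → TXU :=
  ![vT,
    field (fun t => Real.cos (4 * κ * t))
      (fun t x => -(2 * κ * Real.sin (4 * κ * t) * √(a x) * I x))
      (fun t x => c₀ * Real.cos (4 * κ * t) + 2 * κ ^ 2 * Real.cos (4 * κ * t) * I x ^ 2
        + κ * Real.sin (4 * κ * t) * (1 - I x * J a b x)),
    field (fun t => Real.sin (4 * κ * t))
      (fun t x => 2 * κ * Real.cos (4 * κ * t) * √(a x) * I x)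
      (fun t x => c₀ * Real.sin (4 * κ * t) + 2 * κ ^ 2 * Real.sin (4 * κ * t) * I x ^ 2
        - κ * Real.cos (4 * κ * t) * (1 - I x * J a b x)),
    vM]

/-- Case `K = c₂ I² + c₁ I + c₀` with `c₂ = 0`. -/
def basis6Zero (a b I : ℝ → ℝ) (c₁ c₀ : ℝ) : Fin 6 → TXU → TXU :=
  ![vT,
    field (fun t => t)
      (fun t x => 1 / 2 * √(a x) * (I x - 3 * c₁ * t ^ 2))
      (fun t x => 1 / 4 * (I x * (6 * c₁ * t + J a b x)
        + t * (4 * c₀ - 2 * c₁ ^ 2 * t ^ 2 - 3 * c₁ * t * J a b x))),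
    field (fun t => t ^ 2)
      (fun t x => t * √(a x) * (I x - c₁ * t ^ 2))
      (fun t x => -(1 / 4) * (I x ^ 2 - 2 * t * I x * (3 * c₁ * t + J a b x)
        + t * (2 - 4 * c₀ * t + c₁ ^ 2 * t ^ 3 + 2 * c₁ * t ^ 2 * J a b x))),
    field (fun _ => 0)
      (fun t x => t * √(a x))
      (fun t x => 1 / 2 * (-I x + t * (c₁ * t + J a b x))),
    field (fun _ => 0)
      (fun _ x => √(a x))
      (fun t x => 1 / 2 * (2 * c₁ * t + J a b x)),
    vM]

/-- Case `K = c₂ I² + c₁ I + c₀` with `c₂ = -κ²`. -/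
def basis6Neg (a b I : ℝ → ℝ) (c₁ c₀ κ : ℝ) : Fin 6 → TXU → TXU :=
  ![vT,
    field (fun t => Real.exp (4 * κ * t))
      (fun t x => 1 / κ * Real.exp (4 * κ * t) * √(a x) * (-c₁ + 2 * κ ^ 2 * I x))
      (fun t x => -(1 / (4 * κ ^ 2)) * Real.exp (4 * κ * t) *
        (c₁ ^ 2 - 4 * c₀ * κ ^ 2 + 4 * κ ^ 3 + 8 * κ ^ 4 * I x ^ 2 + 2 * c₁ * κ * J a b x
          - 4 * κ ^ 2 * I x * (2 * c₁ + κ * J a b x))),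
    field (fun t => Real.exp (-(4 * κ * t)))
      (fun t x => 1 / κ * Real.exp (-(4 * κ * t)) * √(a x) * (c₁ - 2 * κ ^ 2 * I x))
      (fun t x => -(1 / (4 * κ ^ 2)) * Real.exp (-(4 * κ * t)) *
        (c₁ ^ 2 - 4 * c₀ * κ ^ 2 - 4 * κ ^ 3 + 8 * κ ^ 4 * I x ^ 2 - 2 * c₁ * κ * J a b x
          + 4 * κ ^ 2 * I x * (-2 * c₁ + κ * J a b x))),
    field (fun _ => 0)
      (fun t x => Real.exp (2 * κ * t) * √(a x))
      (fun t x => 1 / (2 * κ) * Real.exp (2 * κ * t) *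
        ((c₁ - 2 * κ ^ 2 * I x) + κ * J a b x)),
    field (fun _ => 0)
      (fun t x => Real.exp (-(2 * κ * t)) * √(a x))
      (fun t x => 1 / (2 * κ) * Real.exp (-(2 * κ * t)) *
        (-(c₁ - 2 * κ ^ 2 * I x) + κ * J a b x)),
    vM]

/-- Case `K = c₂ I² + c₁ I + c₀` with `c₂ = κ²`. -/
def basis6Pos (a b I : ℝ → ℝ) (c₁ c₀ κ : ℝ) : Fin 6 → TXU → TXU :=
  ![vT,
    field (fun t => Real.cos (4 * κ * t))
      (fun t x => -(1 / κ * Real.sin (4 * κ * t) * √(a x) * (c₁ + 2 * κ ^ 2 * I x)))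
      (fun t x => 1 / (4 * κ ^ 2) *
        (Real.cos (4 * κ * t) *
            (c₁ ^ 2 + 4 * c₀ * κ ^ 2 + 8 * κ ^ 4 * I x ^ 2 + 8 * c₁ * κ ^ 2 * I x)
          + Real.sin (4 * κ * t) *
            (4 * κ ^ 3 - 2 * c₁ * κ * J a b x - 4 * κ ^ 3 * I x * J a b x))),
    field (fun t => Real.sin (4 * κ * t))
      (fun t x => 1 / κ * Real.cos (4 * κ * t) * √(a x) * (c₁ + 2 * κ ^ 2 * I x))
      (fun t x => 1 / (4 * κ ^ 2) *
        (Real.sin (4 * κ * t) *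
            (c₁ ^ 2 + 4 * c₀ * κ ^ 2 + 8 * κ ^ 4 * I x ^ 2 + 8 * c₁ * κ ^ 2 * I x)
          - Real.cos (4 * κ * t) *
            (4 * κ ^ 3 - 2 * c₁ * κ * J a b x - 4 * κ ^ 3 * I x * J a b x))),
    field (fun _ => 0)
      (fun t x => Real.cos (2 * κ * t) * √(a x))
      (fun t x => 1 / (2 * κ) *
        (Real.sin (2 * κ * t) * (c₁ + 2 * κ ^ 2 * I x) + κ * Real.cos (2 * κ * t) * J a b x)),
    field (fun _ => 0)
      (fun t x => Real.sin (2 * κ * t) * √(a x))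
      (fun t x => 1 / (2 * κ) *
        (-(Real.cos (2 * κ * t) * (c₁ + 2 * κ ^ 2 * I x)) + κ * Real.sin (2 * κ * t) * J a b x)),
    vM]

/-! ### The model algebras -/

/-- `sl(2, ℝ)`. -/
abbrev SL2 : Type := LieAlgebra.SpecialLinear.sl (Fin 2) ℝ

/-- The one-dimensional (abelian) Lie algebra `ℝ`. -/
instance : LieRing ℝ := LieRing.ofAssociativeRing
instance : LieAlgebra ℝ ℝ := LieAlgebra.ofAssociativeAlgebra

/-- The Heisenberg algebra `nil(3)`: triples `(p, q, z)` with
`[(p, q, z), (p', q', z')] = (0, 0, p q' - q p')`. -/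
@[ext] structure Nil3 : Type where
  p : ℝ
  q : ℝ
  z : ℝ

namespace Nil3

/-- The underlying triple. -/
def equivProd : Nil3 ≃ ℝ × ℝ × ℝ where
  toFun v := (v.p, v.q, v.z)
  invFun v := ⟨v.1, v.2.1, v.2.2⟩

instance : AddCommGroup Nil3 := equivProd.addCommGroup
instance : Module ℝ Nil3 := equivProd.module ℝ

instance : Bracket Nil3 Nil3 where
  bracket v w := ⟨0, 0, v.p * w.q - v.q * w.p⟩

theorem zero_def : (0 : Nil3) = ⟨0, 0, 0⟩ := rfl
theorem add_def (v w : Nil3) : v + w = ⟨v.p + w.p, v.q + w.q, v.z + w.z⟩ := rfl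
theorem sub_def (v w : Nil3) : v - w = ⟨v.p - w.p, v.q - w.q, v.z - w.z⟩ := rfl
theorem smul_def (r : ℝ) (v : Nil3) : r • v = ⟨r * v.p, r * v.q, r * v.z⟩ := rfl
theorem lie_def (v w : Nil3) : ⁅v, w⁆ = ⟨0, 0, v.p * w.q - v.q * w.p⟩ := rfl

instance : LieRing Nil3 where
  add_lie u v w := by ext <;> simp only [lie_def, add_def] <;> ring
  lie_add u v w := by ext <;> simp only [lie_def, add_def] <;> ring
  lie_self v := by ext <;> simp only [lie_def, zero_def] ; ring
  leibniz_lie u v w := by ext <;> simp only [lie_def, add_def] <;> ring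

instance : LieAlgebra ℝ Nil3 where
  lie_smul r v w := by ext <;> simp only [lie_def, smul_def] <;> ring

/-- A traceless matrix acts on `nil(3)` by its standard action on `(p, q)`, killing the center. -/
def act (A : SL2) : LieDerivation ℝ Nil3 Nil3 where
  toFun v := ⟨A.1 0 0 * v.p + A.1 0 1 * v.q, A.1 1 0 * v.p + A.1 1 1 * v.q, 0⟩
  map_add' v w := by ext <;> simp only [add_def] <;> ring
  map_smul' r v := by ext <;> simp only [smul_def, RingHom.id_apply] <;> ring
  leibniz' v w := by
    have hA : A.1 1 1 = -A.1 0 0 := by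
      have h : Matrix.trace A.1 = 0 := A.2
      rw [Matrix.trace_fin_two] at h
      linarith
    ext <;> simp only [LinearMap.coe_mk, AddHom.coe_mk, lie_def, sub_def, hA] <;> ring

theorem act_apply (A : SL2) (v : Nil3) :
    act A v = ⟨A.1 0 0 * v.p + A.1 0 1 * v.q, A.1 1 0 * v.p + A.1 1 1 * v.q, 0⟩ := rfl

/-- The action of `sl(2, ℝ)` on `nil(3)` by derivations. -/
def actHom : SL2 →ₗ⁅ℝ⁆ LieDerivation ℝ Nil3 Nil3 where
  toFun := act
  map_add' A B := LieDerivation.ext fun v => by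
    rw [LieDerivation.add_apply]
    ext <;> simp [act_apply, add_def] <;> ring
  map_smul' r A := LieDerivation.ext fun v => by
    rw [RingHom.id_apply, LieDerivation.smul_apply]
    ext <;> simp [act_apply, smul_def] <;> ring
  map_lie' {A B} := LieDerivation.ext fun v => by
    rw [LieDerivation.commutator_apply]
    ext <;> simp [act_apply, sub_def, LieSubalgebra.coe_bracket,
        Ring.lie_def, Matrix.mul_apply, Fin.sum_univ_two] <;> ring

end Nil3

/-- The heat (Schrödinger) algebra: the semidirect sum of `sl(2, ℝ)` with the ideal `nil(3)`. -/
abbrev HeatAlgebra : Type := LieAlgebra.SemiDirectSum Nil3 SL2 Nil3.actHom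

end ParabolicSymmetry

end

noncomputable section

namespace ParabolicSymmetry

open TopologicalSpace

/-! ### Smooth functions on open subsets of the line -/

/-! Put `z = I`, so that `√a ∂_x = d/dz`. Removing a positive factor `exp (½ ∫ J dz)` from `u` turns
the equation into `u_t = u_zz + K u`. Hence the symmetries are governed by `K` as a function of `I`,
and `J` only enters the coefficient of `u ∂_u`. The proof keeps the original coordinates, but its
formulas are those of this normal form.

Lie's condition is linear in the free part of the jet and splits into three equations
(`isPointSymmetry_iff`). Two of them integrate in `x` and express `ξ` and `φ` through three
functions of time: `τ` and the integration constants `ρ`, `χ` (`exists_rep`). The third becomes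
`residual = 0`, a relation between `τ`, `ρ`, `χ` and `I`, `K`, `dK/dI`
(`isPointSymmetry_symField_iff`).

Freezing a time in this relation determines `K`. If `τ' = 0` throughout and `ρ ≠ 0` somewhere, then
`dK/dI` is affine in `I`, so `K` is quadratic. If `τ' ≠ 0` at some time, shifting `I` to `z = I +
2ρ/τ'` gives `K + ½ z dK/dz` = a quadratic in `z`, that is, `z² K = μ +` a quartic without constant
and linear terms. For `μ = 0` this is again a quadratic `K`. For `μ ≠ 0` the function `z` has no
zero, and using the relation at all times kills the linear term of `K` (`linear_coeff_eq_zero`).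
This is `exists_KForm_of_nontrivial`.

Conversely, for either form of `K` the relation is polynomial in `I`, up to a factor `I³`, and is
equivalent to linear ordinary differential equations for `τ`, `ρ`, `χ`, with `ρ = 0` in the
inverse-square case. Their solutions are determined by the data `(τ, τ', τ'', ρ, ρ', χ)` at one
time, or by the four entries other than `ρ, ρ'`. The explicit solutions have independent data, so
they form bases and the dimensions are six and four (`hasBasis_of_KForm6`, `hasBasis_of_KForm4`).
Since `4 ≠ 6`, the two forms exclude each other, which gives the equivalences.

The parameters of a bracket are bilinear in those of its factors (`Rep.lie`), which yields closure
under the bracket. On initial data the bracket becomes the explicit product `lieJet`, and this is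
matched with the model algebras by `toHeat_lie` and `toSL2_lie`. -/

theorem hasDerivAt_of_contDiffOn {s : Opens ℝ} {f : ℝ → ℝ} (hf : ContDiffOn ℝ ∞ f s) {t : ℝ}
    (ht : t ∈ s) : HasDerivAt f (deriv f t) t :=
  ((hf.contDiffAt (s.isOpen.mem_nhds ht)).differentiableAt (by simp)).hasDerivAt

theorem contDiffOn_deriv {s : Opens ℝ} {f : ℝ → ℝ} (hf : ContDiffOn ℝ ∞ f s) :
    ContDiffOn ℝ ∞ (deriv f) s :=
  ((contDiffOn_infty_iff_deriv_of_isOpen s.isOpen).1 hf).2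

theorem deriv_eq_of_eqOn {s : Opens ℝ} {f g : ℝ → ℝ} (h : ∀ t ∈ s, f t = g t) {t : ℝ}
    (ht : t ∈ s) : deriv f t = deriv g t := by
  refine Filter.EventuallyEq.deriv_eq ?_
  filter_upwards [s.isOpen.mem_nhds ht] with y hy using h y hy

theorem hasDerivAt_congr_opens {s : Opens ℝ} {f g : ℝ → ℝ} (h : ∀ t ∈ s, f t = g t) {t d : ℝ}
    (ht : t ∈ s) (hg : HasDerivAt g d t) : HasDerivAt f d t := by
  refine hg.congr_of_eventuallyEq ?_
  filter_upwards [s.isOpen.mem_nhds ht] with y hy using h y hy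

theorem eq_of_hasDerivAt_zero {s : Opens ℝ} (hs : (s : Set ℝ).OrdConnected) {f : ℝ → ℝ}
    (hf : ∀ t ∈ s, HasDerivAt f 0 t) {x y : ℝ} (hx : x ∈ s) (hy : y ∈ s) : f x = f y :=
  s.isOpen.is_const_of_deriv_eq_zero hs.isPreconnected
    (fun t ht => (hf t ht).differentiableAt.differentiableWithinAt)
    (fun t ht => (hf t ht).deriv) hx hy

/-- A solution of `y'' = k y` with vanishing initial data vanishes. -/
theorem eq_zero_of_second_order {s : Opens ℝ} (hs : (s : Set ℝ).OrdConnected) {k : ℝ}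
    {f g : ℝ → ℝ} (hf : ∀ t ∈ s, HasDerivAt f (g t) t) (hg : ∀ t ∈ s, HasDerivAt g (k * f t) t)
    {t₀ : ℝ} (ht₀ : t₀ ∈ s) (hf₀ : f t₀ = 0) (hg₀ : g t₀ = 0) {t : ℝ} (ht : t ∈ s) :
    f t = 0 := by
  -- The uniqueness theorem needs both times inside an open interval contained in `s`. It is spanned
  -- by balls around the two times; points between the balls lie in `s` by order-connectedness.
  obtain ⟨l, r, hlr, hls⟩ : ∃ l r, (t ∈ Set.Ioo l r ∧ t₀ ∈ Set.Ioo l r) ∧ Set.Ioo l r ⊆ s := by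
    obtain ⟨ε, hε, h1⟩ := Metric.isOpen_iff.1 s.isOpen t ht
    obtain ⟨δ, hδ, h2⟩ := Metric.isOpen_iff.1 s.isOpen t₀ ht₀
    rw [Real.ball_eq_Ioo] at h1 h2
    refine ⟨min (t - ε) (t₀ - δ), max (t + ε) (t₀ + δ), ?_, ?_⟩
    · simp only [Set.mem_Ioo, min_lt_iff, lt_max_iff]
      refine ⟨⟨Or.inl (by linarith), Or.inl (by linarith)⟩,
        ⟨Or.inr (by linarith), Or.inr (by linarith)⟩⟩
    · intro y hy
      simp only [Set.mem_Ioo, min_lt_iff, lt_max_iff] at hy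
      by_cases hyt : y ∈ Set.Ioo (t - ε) (t + ε)
      · exact h1 hyt
      by_cases hyt₀ : y ∈ Set.Ioo (t₀ - δ) (t₀ + δ)
      · exact h2 hyt₀
      rcases le_total t t₀ with h | h
      · refine hs.out ht ht₀ ⟨?_, ?_⟩ <;> simp only [Set.mem_Ioo] at * <;> by_contra! <;> grind
      · refine hs.out ht₀ ht ⟨?_, ?_⟩ <;> simp only [Set.mem_Ioo] at * <;> by_contra! <;> grind
  -- First-order system for the pair `(y, y')`, to be compared with the zero solution.
  let v : ℝ → ℝ × ℝ → ℝ × ℝ := fun _ p => (p.2, k * p.1)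
  have hv : ∀ τ ∈ Set.Ioo l r, LipschitzOnWith (max 1 ‖k‖₊) (v τ) Set.univ := by
    intro τ _
    refine LipschitzWith.lipschitzOnWith ?_
    have h1 : LipschitzWith 1 (fun p : ℝ × ℝ => p.2) := LipschitzWith.prod_snd
    have h2 : LipschitzWith ‖k‖₊ (fun p : ℝ × ℝ => k * p.1) := by
      refine LipschitzWith.of_dist_le_mul fun p q => ?_
      rw [Real.dist_eq, ← mul_sub, abs_mul, coe_nnnorm, Real.norm_eq_abs, ← Real.dist_eq]
      exact mul_le_mul_of_nonneg_left (le_max_left _ _) (abs_nonneg k)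
    exact h1.prodMk h2
  have key := ODE_solution_unique_of_mem_Ioo (v := v) (f := fun t => (f t, g t))
    (g := fun _ => (0, 0)) hv hlr.2
    (fun y hy => ⟨(hf y (hls hy)).prodMk (hg y (hls hy)), trivial⟩)
    (fun y _ => ⟨by
      have h0 : v y (0, 0) = 0 := by simp [v]
      rw [h0]
      exact hasDerivAt_const y ((0 : ℝ), (0 : ℝ)), trivial⟩)
    (by simp [hf₀, hg₀])
  exact congrArg Prod.fst (key hlr.1)

/-! ### The determining equations -/

theorem mem_dom {S Ω : Opens ℝ} {p : TXU} : p ∈ dom S Ω ↔ p.1 ∈ S ∧ p.2.1 ∈ Ω := by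
  change p ∈ (S : Set ℝ) ×ˢ (Ω : Set ℝ) ×ˢ Set.univ ↔ _
  simp [Set.mem_prod]

theorem mk_mem_dom {S Ω : Opens ℝ} {t x : ℝ} (u : ℝ) (ht : t ∈ S) (hx : x ∈ Ω) :
    (t, x, u) ∈ dom S Ω := mem_dom.2 ⟨ht, hx⟩

section Prolongation

variable {S Ω : Opens ℝ} {a b c : ℝ → ℝ} {X : TXU → TXU} {τ : ℝ → ℝ} {ξ φ : ℝ → ℝ → ℝ}

/-- Since `τ` depends on `t` alone, all terms containing `D_x τ` drop out and the prolongation is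
linear in the jet of `w`. First `x`-derivatives are required on all of `Ω`, because `prolX` is
differentiated once more. -/
theorem prolEqnAt_eq (hX : ∀ p ∈ dom S Ω, X p = field τ ξ φ p)
    {τ₁ ξt φt ξ₂ φ₂ : ℝ} {ξ₁ φ₁ : ℝ → ℝ} {t x : ℝ} (ht : t ∈ S) (hx : x ∈ Ω)
    (hτ : HasDerivAt τ τ₁ t)
    (hξt : HasDerivAt (fun s => ξ s x) ξt t) (hφt : HasDerivAt (fun s => φ s x) φt t)
    (hξ₁ : ∀ y ∈ Ω, HasDerivAt (ξ t) (ξ₁ y) y) (hφ₁ : ∀ y ∈ Ω, HasDerivAt (φ t) (φ₁ y) y)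
    (hξ₂ : HasDerivAt ξ₁ ξ₂ x) (hφ₂ : HasDerivAt φ₁ φ₂ x)
    {w : ℝ → ℝ → ℝ} (hw : ContDiff ℝ ∞ (fun q : ℝ × ℝ => w q.1 q.2)) :
    prolEqnAt a b c X w t x =
      φt * w t x + φ t x * Dt w t x - Dt w t x * τ₁ - Dx w t x * ξt
      - a x * (φ₂ * w t x + 2 * φ₁ x * Dx w t x + φ t x * Dx (Dx w) t x
        - 2 * ξ₁ x * Dx (Dx w) t x - ξ₂ * Dx w t x)
      - b x * (φ₁ x * w t x + φ t x * Dx w t x - ξ₁ x * Dx w t x) - c x * (φ t x * w t x)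
      - ξ t x * (deriv a x * Dx (Dx w) t x + deriv b x * Dx w t x + deriv c x * w t x) := by
  have hwx : ContDiff ℝ ∞ (w t) := hw.comp (contDiff_const.prodMk contDiff_id)
  have hwt : ContDiff ℝ ∞ (fun s => w s x) := hw.comp (contDiff_id.prodMk contDiff_const)
  have hw1 : ∀ y, HasDerivAt (w t) (Dx w t y) y := fun y =>
    (hwx.differentiable (by simp) y).hasDerivAt
  have hw2 : HasDerivAt (Dx w t) (Dx (Dx w) t x) x := by
    have : ContDiff ℝ ∞ (deriv (w t)) := (contDiff_infty_iff_deriv.1 hwx).2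
    exact (this.differentiable (by simp) x).hasDerivAt
  have hw3 : HasDerivAt (fun s => w s x) (Dt w t x) t :=
    (hwt.differentiable (by simp) t).hasDerivAt
  have eτ : ∀ s ∈ S, ∀ y ∈ Ω, tauAlong X w s y = τ s := fun s hs y hy => by
    simp [tauAlong, hX _ (mk_mem_dom _ hs hy), field]
  have eξ : ∀ s ∈ S, ∀ y ∈ Ω, xiAlong X w s y = ξ s y := fun s hs y hy => by
    simp [xiAlong, hX _ (mk_mem_dom _ hs hy), field]
  have eφ : ∀ s ∈ S, ∀ y ∈ Ω, etaAlong X w s y = φ s y * w s y := fun s hs y hy => by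
    simp [etaAlong, hX _ (mk_mem_dom _ hs hy), field]
  have dτt : Dt (tauAlong X w) t x = τ₁ :=
    (hasDerivAt_congr_opens (fun s hs => eτ s hs x hx) ht hτ).deriv
  have dξt : Dt (xiAlong X w) t x = ξt :=
    (hasDerivAt_congr_opens (fun s hs => eξ s hs x hx) ht hξt).deriv
  have dφt : Dt (etaAlong X w) t x = φt * w t x + φ t x * Dt w t x :=
    (hasDerivAt_congr_opens (fun s hs => eφ s hs x hx) ht (hφt.mul hw3)).deriv
  have dτx : ∀ y ∈ Ω, Dx (tauAlong X w) t y = 0 := fun y hy =>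
    (hasDerivAt_congr_opens (fun z hz => eτ t ht z hz) hy (hasDerivAt_const y (τ t))).deriv
  have dξx : ∀ y ∈ Ω, Dx (xiAlong X w) t y = ξ₁ y := fun y hy =>
    (hasDerivAt_congr_opens (fun z hz => eξ t ht z hz) hy (hξ₁ y hy)).deriv
  have dφx : ∀ y ∈ Ω, Dx (etaAlong X w) t y = φ₁ y * w t y + φ t y * Dx w t y := fun y hy =>
    (hasDerivAt_congr_opens (fun z hz => eφ t ht z hz) hy ((hφ₁ y hy).mul (hw1 y))).deriv
  have ePX : ∀ y ∈ Ω, prolX X w t y = φ₁ y * w t y + φ t y * Dx w t y - Dx w t y * ξ₁ y := by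
    intro y hy
    rw [prolX, dφx y hy, dτx y hy, dξx y hy]
    ring
  have dPX : Dx (prolX X w) t x = φ₂ * w t x + φ₁ x * Dx w t x
      + (φ₁ x * Dx w t x + φ t x * Dx (Dx w) t x)
      - (Dx (Dx w) t x * ξ₁ x + Dx w t x * ξ₂) :=
    (hasDerivAt_congr_opens ePX hx (((hφ₂.mul (hw1 x)).add ((hφ₁ x hx).mul hw2)).sub
      (hw2.mul hξ₂))).deriv
  rw [prolEqnAt, prolT, prolXX, dPX, ePX x hx, dτt, dξt, dφt, dτx x hx, dξx x hx, eξ t ht x hx,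
    eφ t ht x hx]
  ring

/-- Lie's determining equations for a field `τ(t) ∂_t + ξ ∂_x + φ u ∂_u`. -/
theorem isPointSymmetry_iff (hX : ∀ p ∈ dom S Ω, X p = field τ ξ φ p)
    {τ₁ : ℝ → ℝ} {ξt φt ξ₁ φ₁ ξ₂ φ₂ : ℝ → ℝ → ℝ}
    (hτ : ∀ t ∈ S, HasDerivAt τ (τ₁ t) t)
    (hξt : ∀ t ∈ S, ∀ x ∈ Ω, HasDerivAt (fun s => ξ s x) (ξt t x) t)
    (hφt : ∀ t ∈ S, ∀ x ∈ Ω, HasDerivAt (fun s => φ s x) (φt t x) t)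
    (hξ₁ : ∀ t ∈ S, ∀ x ∈ Ω, HasDerivAt (ξ t) (ξ₁ t x) x)
    (hφ₁ : ∀ t ∈ S, ∀ x ∈ Ω, HasDerivAt (φ t) (φ₁ t x) x)
    (hξ₂ : ∀ t ∈ S, ∀ x ∈ Ω, HasDerivAt (ξ₁ t) (ξ₂ t x) x)
    (hφ₂ : ∀ t ∈ S, ∀ x ∈ Ω, HasDerivAt (φ₁ t) (φ₂ t x) x) :
    IsPointSymmetry S Ω a b c X ↔ ∀ t ∈ S, ∀ x ∈ Ω,
      (-(a x * τ₁ t) + 2 * a x * ξ₁ t x - ξ t x * deriv a x = 0) ∧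
      (-(b x * τ₁ t) - ξt t x - 2 * a x * φ₁ t x + a x * ξ₂ t x + b x * ξ₁ t x
        - ξ t x * deriv b x = 0) ∧
      (φt t x - c x * τ₁ t - a x * φ₂ t x - b x * φ₁ t x - ξ t x * deriv c x = 0) := by
  constructor
  · intro h t ht x hx
    have key : ∀ w₀ w₁ w₂ : ℝ,
        (φt t x - c x * τ₁ t - a x * φ₂ t x - b x * φ₁ t x - ξ t x * deriv c x) * w₀
        + (-(b x * τ₁ t) - ξt t x - 2 * a x * φ₁ t x + a x * ξ₂ t x + b x * ξ₁ t x
          - ξ t x * deriv b x) * w₁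
        + (-(a x * τ₁ t) + 2 * a x * ξ₁ t x - ξ t x * deriv a x) * w₂ = 0 := by
      intro w₀ w₁ w₂
      -- `m` is the value of `u_t` that puts the jet on the equation. The values of `u`, `u_x`,
      -- `u_xx` remain free, so their three coefficients must vanish separately.
      let m := a x * w₂ + b x * w₁ + c x * w₀
      let w : ℝ → ℝ → ℝ := fun s y => w₀ + w₁ * (y - x) + w₂ / 2 * (y - x) ^ 2 + m * (s - t)
      have hw : ContDiff ℝ ∞ (fun q : ℝ × ℝ => w q.1 q.2) := by fun_prop
      have hw0 : w t x = w₀ := by simp [w]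
      have hwt : Dt w t x = m := by
        have : HasDerivAt (fun s => w s x) (m * 1) t := by
          simpa [w] using (((hasDerivAt_id t).sub_const t).const_mul m).const_add w₀
        exact this.deriv.trans (mul_one m)
      have hwx : ∀ y, Dx w t y = w₁ + w₂ * (y - x) := by
        intro y
        have h1 : HasDerivAt (fun y => y - x) 1 y := (hasDerivAt_id y).sub_const x
        have : HasDerivAt (w t) (w₁ * 1 + w₂ / 2 * (((2 : ℕ) : ℝ) * (y - x) ^ (2 - 1) * 1)) y :=
          (((h1.const_mul w₁).const_add w₀).add ((h1.pow 2).const_mul (w₂ / 2))).add_const _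
        refine this.deriv.trans ?_
        push_cast
        ring
      have hwxx : Dx (Dx w) t x = w₂ := by
        have : HasDerivAt (fun y => Dx w t y) (w₂ * 1) x := by
          simp only [hwx]
          exact (((hasDerivAt_id x).sub_const x).const_mul w₂).const_add w₁
        exact this.deriv.trans (mul_one w₂)
      have h0 := h w hw t ht x hx (by
        rw [eqnAt, hwt, hwxx, hwx, hw0]; simp only [m]; ring)
      rw [prolEqnAt_eq hX ht hx (hτ t ht) (hξt t ht x hx) (hφt t ht x hx) (hξ₁ t ht) (hφ₁ t ht)
        (hξ₂ t ht x hx) (hφ₂ t ht x hx) hw, hwt, hwxx, hwx, hw0] at h0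
      simp only [m] at h0
      linear_combination h0
    exact ⟨by simpa using key 0 0 1, by simpa using key 0 1 0, by simpa using key 1 0 0⟩
  · intro h w hw t ht x hx hE
    obtain ⟨h1, h2, h3⟩ := h t ht x hx
    rw [prolEqnAt_eq hX ht hx (hτ t ht) (hξt t ht x hx) (hφt t ht x hx) (hξ₁ t ht) (hφ₁ t ht)
        (hξ₂ t ht x hx) (hφ₂ t ht x hx) hw]
    rw [eqnAt] at hE
    -- `φ - τ'` is the coefficient of `u_t` in the prolonged expression, so subtracting this
    -- multiple of the equation removes `u_t`.
    linear_combination (φ t x - τ₁ t) * hE + Dx (Dx w) t x * h1 + Dx w t x * h2 + w t x * h3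

end Prolongation

/-! ### The coefficients in terms of `√a`, `J` and `K` -/

/-- The standing hypotheses on the coefficients, together with a choice of `I`. -/
structure Coeffs (Ω : Opens ℝ) (a b c I : ℝ → ℝ) : Prop where
  smooth_a : ContDiffOn ℝ ∞ a Ω
  smooth_b : ContDiffOn ℝ ∞ b Ω
  smooth_c : ContDiffOn ℝ ∞ c Ω
  pos : ∀ x ∈ Ω, 0 < a x
  isI : IsI Ω a I

/-- The function `√a`. -/
def sqrtFun (a : ℝ → ℝ) (x : ℝ) : ℝ := √(a x)

theorem zerothCoeff_eq (a b c : ℝ → ℝ) (x : ℝ) :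
    c x = K a b c x - 1 / 2 * sqrtFun a x * deriv (J a b) x + 1 / 4 * J a b x ^ 2 := by
  have : K a b c x = 1 / 2 * sqrtFun a x * deriv (J a b) x - 1 / 4 * J a b x ^ 2 + c x := rfl
  linarith

namespace Coeffs

variable {Ω : Opens ℝ} {a b c I : ℝ → ℝ}

theorem sqrt_pos (h : Coeffs Ω a b c I)
    {x : ℝ} (hx : x ∈ Ω) : 0 < sqrtFun a x := Real.sqrt_pos.2 (h.pos x hx)

theorem smooth_sqrt (h : Coeffs Ω a b c I) : ContDiffOn ℝ ∞ (sqrtFun a) Ω :=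
  h.smooth_a.sqrt fun x hx => (h.pos x hx).ne'

theorem smooth_J (h : Coeffs Ω a b c I) : ContDiffOn ℝ ∞ (J a b) Ω :=
  (((contDiffOn_deriv h.smooth_a).div_const 2).sub h.smooth_b).div h.smooth_sqrt
    fun _ hx => (h.sqrt_pos hx).ne'

theorem smooth_K (h : Coeffs Ω a b c I) : ContDiffOn ℝ ∞ (K a b c) Ω :=
  (((contDiffOn_const.mul h.smooth_sqrt).mul (contDiffOn_deriv h.smooth_J)).sub
    (contDiffOn_const.mul (h.smooth_J.pow 2))).add h.smooth_c

theorem hasDerivAt_I (h : Coeffs Ω a b c I)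
    {x : ℝ} (hx : x ∈ Ω) : HasDerivAt I (1 / sqrtFun a x) x := h.isI x hx

theorem smooth_I (h : Coeffs Ω a b c I) : ContDiffOn ℝ ∞ I Ω := by
  rw [contDiffOn_infty_iff_deriv_of_isOpen Ω.isOpen]
  refine ⟨fun x hx => (h.isI x hx).differentiableAt.differentiableWithinAt, ?_⟩
  refine (contDiffOn_const (c := (1 : ℝ)).div h.smooth_sqrt
    fun _ hx => (h.sqrt_pos hx).ne').congr fun x hx => ?_
  exact (h.hasDerivAt_I hx).deriv

theorem a_eq (h : Coeffs Ω a b c I) {x : ℝ} (hx : x ∈ Ω) : a x = sqrtFun a x ^ 2 :=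
  (Real.sq_sqrt (h.pos x hx).le).symm

theorem hasDerivAt_sqrt (h : Coeffs Ω a b c I) {x : ℝ} (hx : x ∈ Ω) :
    HasDerivAt (sqrtFun a) (deriv (sqrtFun a) x) x :=
  hasDerivAt_of_contDiffOn h.smooth_sqrt hx

theorem hasDerivAt_J (h : Coeffs Ω a b c I)
    {x : ℝ} (hx : x ∈ Ω) : HasDerivAt (J a b) (deriv (J a b) x) x :=
  hasDerivAt_of_contDiffOn h.smooth_J hx

theorem hasDerivAt_K (h : Coeffs Ω a b c I)
    {x : ℝ} (hx : x ∈ Ω) : HasDerivAt (K a b c) (deriv (K a b c) x) x :=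
  hasDerivAt_of_contDiffOn h.smooth_K hx

theorem deriv_a (h : Coeffs Ω a b c I) {x : ℝ} (hx : x ∈ Ω) :
    deriv a x = 2 * sqrtFun a x * deriv (sqrtFun a) x := by
  have := (hasDerivAt_congr_opens (fun y hy => h.a_eq hy) hx ((h.hasDerivAt_sqrt hx).pow 2)).deriv
  rw [this]
  push_cast
  ring

/-- With `s = √a`, the coefficients are `a = s²`, `b = s s' - s J` and `c = K - ½ s J' + ¼ J²`.
Rewriting them and their derivatives this way makes the determining equations identities in
independent symbols. -/
theorem b_eq (h : Coeffs Ω a b c I) {x : ℝ} (hx : x ∈ Ω) :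
    b x = sqrtFun a x * deriv (sqrtFun a) x - sqrtFun a x * J a b x := by
  have hs := (h.sqrt_pos hx).ne'
  have : J a b x = (deriv a x / 2 - b x) / sqrtFun a x := rfl
  rw [this, h.deriv_a hx]
  field_simp
  ring

theorem deriv_b (h : Coeffs Ω a b c I) {x : ℝ} (hx : x ∈ Ω) :
    deriv b x = deriv (sqrtFun a) x ^ 2 + sqrtFun a x * deriv (deriv (sqrtFun a)) x
      - deriv (sqrtFun a) x * J a b x - sqrtFun a x * deriv (J a b) x := by
  have hs := h.hasDerivAt_sqrt hx
  have hs' := hasDerivAt_of_contDiffOn (contDiffOn_deriv h.smooth_sqrt) hx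
  have := (hasDerivAt_congr_opens (fun y hy => h.b_eq hy) hx
    ((hs.mul hs').sub (hs.mul (h.hasDerivAt_J hx)))).deriv
  rw [this]
  ring

theorem deriv_c (h : Coeffs Ω a b c I) {x : ℝ} (hx : x ∈ Ω) :
    deriv c x = deriv (K a b c) x - 1 / 2 * deriv (sqrtFun a) x * deriv (J a b) x
      - 1 / 2 * sqrtFun a x * deriv (deriv (J a b)) x + 1 / 2 * J a b x * deriv (J a b) x := by
  have hJ' := hasDerivAt_of_contDiffOn (contDiffOn_deriv h.smooth_J) hx
  have := (hasDerivAt_congr_opens (fun y _ => zerothCoeff_eq a b c y) hx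
    (((h.hasDerivAt_K hx).sub (((h.hasDerivAt_sqrt hx).const_mul (1 / 2)).mul hJ')).add
      (((h.hasDerivAt_J hx).pow 2).const_mul (1 / 4)))).deriv
  rw [this]
  push_cast
  ring

end Coeffs

/-! ### Fields determined by three functions of time -/

/-- The coefficient of `∂_x`. -/
def symXi (a I τ ρ : ℝ → ℝ) (t x : ℝ) : ℝ := √(a x) * (1 / 2 * deriv τ t * I x + ρ t)

/-- The coefficient of `u ∂_u`. -/
def symPhi (a b I τ ρ χ : ℝ → ℝ) (t x : ℝ) : ℝ :=
  -(1 / 8 * deriv (deriv τ) t * I x ^ 2) - 1 / 2 * deriv ρ t * I x + χ t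
    + 1 / 2 * J a b x * (1 / 2 * deriv τ t * I x + ρ t)

/-- The left-hand side of the remaining determining equation. -/
def residual (a b c I τ ρ χ : ℝ → ℝ) (t x : ℝ) : ℝ :=
  -(1 / 8 * deriv (deriv (deriv τ)) t * I x ^ 2) - 1 / 2 * deriv (deriv ρ) t * I x + deriv χ t
    + 1 / 4 * deriv (deriv τ) t - K a b c x * deriv τ t
    - (1 / 2 * deriv τ t * I x + ρ t) * (√(a x) * deriv (K a b c) x)

/-- The field with parameters `τ`, `ρ`, `χ`. -/
def symField (a b I τ ρ χ : ℝ → ℝ) : TXU → TXU :=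
  field τ (symXi a I τ ρ) (symPhi a b I τ ρ χ)

/-- Three smooth functions on `S`. -/
structure SmoothTriple (S : Opens ℝ) (τ ρ χ : ℝ → ℝ) : Prop where
  tau : ContDiffOn ℝ ∞ τ S
  rho : ContDiffOn ℝ ∞ ρ S
  chi : ContDiffOn ℝ ∞ χ S

section Derivatives

variable {S Ω : Opens ℝ} {a b c I τ ρ χ : ℝ → ℝ}

theorem hasDerivAt_symXi_t (hs : SmoothTriple S τ ρ χ) {t : ℝ} (ht : t ∈ S) (x : ℝ) :
    HasDerivAt (fun s => symXi a I τ ρ s x)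
      (sqrtFun a x * (1 / 2 * deriv (deriv τ) t * I x + deriv ρ t)) t :=
  (((hasDerivAt_of_contDiffOn (contDiffOn_deriv hs.tau) ht).const_mul (1 / 2)).mul_const (I x)
    |>.add (hasDerivAt_of_contDiffOn hs.rho ht)).const_mul (sqrtFun a x)

theorem hasDerivAt_sigma (h : Coeffs Ω a b c I) (t : ℝ) {x : ℝ} (hx : x ∈ Ω) :
    HasDerivAt (fun x => 1 / 2 * deriv τ t * I x + ρ t)
      (1 / 2 * deriv τ t * (1 / sqrtFun a x)) x :=
  ((h.hasDerivAt_I hx).const_mul _).add_const _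

theorem hasDerivAt_symXi_x (h : Coeffs Ω a b c I) (t : ℝ) {x : ℝ} (hx : x ∈ Ω) :
    HasDerivAt (symXi a I τ ρ t)
      (deriv (sqrtFun a) x * (1 / 2 * deriv τ t * I x + ρ t) + 1 / 2 * deriv τ t) x := by
  refine ((h.hasDerivAt_sqrt hx).mul (hasDerivAt_sigma h t hx)).congr_deriv ?_
  have hs0 := (h.sqrt_pos hx).ne'
  field_simp

theorem hasDerivAt_symXi_xx (h : Coeffs Ω a b c I) (t : ℝ) {x : ℝ} (hx : x ∈ Ω) :
    HasDerivAt (fun x => deriv (sqrtFun a) x * (1 / 2 * deriv τ t * I x + ρ t) + 1 / 2 * deriv τ t)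
      (deriv (deriv (sqrtFun a)) x * (1 / 2 * deriv τ t * I x + ρ t)
        + deriv (sqrtFun a) x * (1 / 2 * deriv τ t * (1 / sqrtFun a x))) x :=
  ((hasDerivAt_of_contDiffOn (contDiffOn_deriv h.smooth_sqrt) hx).mul
    (hasDerivAt_sigma h t hx)).add_const _

theorem hasDerivAt_symPhi_x (h : Coeffs Ω a b c I) (t : ℝ) {x : ℝ} (hx : x ∈ Ω) :
    HasDerivAt (symPhi a b I τ ρ χ t)
      ((-(1 / 4 * deriv (deriv τ) t) * I x - 1 / 2 * deriv ρ t
        + 1 / 4 * deriv τ t * J a b x) / sqrtFun a x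
      + 1 / 2 * deriv (J a b) x * (1 / 2 * deriv τ t * I x + ρ t)) x := by
  have hs0 := (h.sqrt_pos hx).ne'
  refine (((((((h.hasDerivAt_I hx).pow 2).const_mul (1 / 8 * deriv (deriv τ) t)).neg.sub
    ((h.hasDerivAt_I hx).const_mul (1 / 2 * deriv ρ t))).add_const (χ t)).add
    (((h.hasDerivAt_J hx).const_mul (1 / 2)).mul (hasDerivAt_sigma h t hx)))).congr_deriv ?_
  push_cast
  field_simp
  ring

end Derivatives

/-- After rewriting in `√a`, `J`, `K`, the first two determining equations hold identically for a
field of this shape; all `J` terms cancel from the third, leaving `residual`. -/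
theorem isPointSymmetry_symField_iff {S Ω : Opens ℝ} {a b c I : ℝ → ℝ} (h : Coeffs Ω a b c I)
    {τ ρ χ : ℝ → ℝ} (hs : SmoothTriple S τ ρ χ) {X : TXU → TXU}
    (hX : ∀ p ∈ dom S Ω, X p = symField a b I τ ρ χ p) :
    IsPointSymmetry S Ω a b c X ↔ ∀ t ∈ S, ∀ x ∈ Ω, residual a b c I τ ρ χ t x = 0 := by
  have hτ1 := contDiffOn_deriv hs.tau
  have hτ2 := contDiffOn_deriv hτ1
  have hρ1 := contDiffOn_deriv hs.rho
  have dτ : ∀ t ∈ S, HasDerivAt τ (deriv τ t) t := fun t ht => hasDerivAt_of_contDiffOn hs.tau ht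
  have dτ1 : ∀ t ∈ S, HasDerivAt (deriv τ) (deriv (deriv τ) t) t :=
    fun t ht => hasDerivAt_of_contDiffOn hτ1 ht
  have dτ2 : ∀ t ∈ S, HasDerivAt (deriv (deriv τ)) (deriv (deriv (deriv τ)) t) t :=
    fun t ht => hasDerivAt_of_contDiffOn hτ2 ht
  have dρ : ∀ t ∈ S, HasDerivAt ρ (deriv ρ t) t := fun t ht => hasDerivAt_of_contDiffOn hs.rho ht
  have dρ1 : ∀ t ∈ S, HasDerivAt (deriv ρ) (deriv (deriv ρ) t) t :=
    fun t ht => hasDerivAt_of_contDiffOn hρ1 ht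
  have dχ : ∀ t ∈ S, HasDerivAt χ (deriv χ t) t := fun t ht => hasDerivAt_of_contDiffOn hs.chi ht
  rw [isPointSymmetry_iff hX (τ₁ := deriv τ)
    (ξt := fun t x => sqrtFun a x * (1 / 2 * deriv (deriv τ) t * I x + deriv ρ t))
    (φt := fun t x => -(1 / 8 * deriv (deriv (deriv τ)) t * I x ^ 2)
      - 1 / 2 * deriv (deriv ρ) t * I x + deriv χ t
      + 1 / 2 * J a b x * (1 / 2 * deriv (deriv τ) t * I x + deriv ρ t))
    (ξ₁ := fun t x => deriv (sqrtFun a) x * (1 / 2 * deriv τ t * I x + ρ t) + 1 / 2 * deriv τ t)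
    (ξ₂ := fun t x => deriv (deriv (sqrtFun a)) x * (1 / 2 * deriv τ t * I x + ρ t)
      + deriv (sqrtFun a) x * (1 / 2 * deriv τ t * (1 / sqrtFun a x)))
    (φ₁ := fun t x => (-(1 / 4 * deriv (deriv τ) t) * I x - 1 / 2 * deriv ρ t
        + 1 / 4 * deriv τ t * J a b x) / sqrtFun a x
      + 1 / 2 * deriv (J a b) x * (1 / 2 * deriv τ t * I x + ρ t))
    (φ₂ := fun t x => ((-(1 / 4 * deriv (deriv τ) t) * (1 / sqrtFun a x)
        + 1 / 4 * deriv τ t * deriv (J a b) x) * sqrtFun a x -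
        (-(1 / 4 * deriv (deriv τ) t) * I x - 1 / 2 * deriv ρ t
          + 1 / 4 * deriv τ t * J a b x) * deriv (sqrtFun a) x) / sqrtFun a x ^ 2
      + (1 / 2 * deriv (deriv (J a b)) x * (1 / 2 * deriv τ t * I x + ρ t)
        + 1 / 2 * deriv (J a b) x * (1 / 2 * deriv τ t * (1 / sqrtFun a x))))
    dτ]
  · refine forall₂_congr fun t _ => forall₂_congr fun x hx => ?_
    have hs0 := (h.sqrt_pos hx).ne'
    have e1 : symXi a I τ ρ t x = sqrtFun a x * (1 / 2 * deriv τ t * I x + ρ t) := rfl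
    have e2 : residual a b c I τ ρ χ t x =
      -(1 / 8 * deriv (deriv (deriv τ)) t * I x ^ 2) - 1 / 2 * deriv (deriv ρ) t * I x + deriv χ t
      + 1 / 4 * deriv (deriv τ) t - K a b c x * deriv τ t
      - (1 / 2 * deriv τ t * I x + ρ t) * (sqrtFun a x * deriv (K a b c) x) := rfl
    rw [h.deriv_a hx, h.deriv_b hx, h.deriv_c hx, zerothCoeff_eq a b c x, h.b_eq hx, h.a_eq hx, e1, e2]
    constructor
    · rintro ⟨-, -, h3⟩
      rw [← h3]
      field_simp
      ring
    · intro h3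
      refine ⟨?_, ?_, ?_⟩
      · ring
      · field_simp
        ring
      · rw [← h3]
        field_simp
        ring
  · exact fun t ht x _ => hasDerivAt_symXi_t hs ht x
  · intro t ht x hx
    exact (((((dτ2 t ht).const_mul (1 / 8)).mul_const (I x ^ 2)).neg.sub
      (((dρ1 t ht).const_mul (1 / 2)).mul_const (I x))).add (dχ t ht)).add
      ((((dτ1 t ht).const_mul (1 / 2)).mul_const (I x) |>.add (dρ t ht)).const_mul
        (1 / 2 * J a b x))
  · exact fun t _ x hx => hasDerivAt_symXi_x h t hx
  · exact fun t _ x hx => hasDerivAt_symPhi_x h t hx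
  · exact fun t _ x hx => hasDerivAt_symXi_xx h t hx
  · intro t ht x hx
    have dJ1 := hasDerivAt_of_contDiffOn (contDiffOn_deriv h.smooth_J) hx
    exact (((((h.hasDerivAt_I hx).const_mul (-(1 / 4 * deriv (deriv τ) t))).sub_const _).add
      ((h.hasDerivAt_J hx).const_mul (1 / 4 * deriv τ t))).div (h.hasDerivAt_sqrt hx)
        (h.sqrt_pos hx).ne').add ((dJ1.const_mul (1 / 2)).mul (hasDerivAt_sigma h t hx))

theorem contDiffOn_symField {S Ω : Opens ℝ} {a b c I : ℝ → ℝ} (h : Coeffs Ω a b c I)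
    {τ ρ χ : ℝ → ℝ} (hs : SmoothTriple S τ ρ χ) :
    ContDiffOn ℝ ∞ (symField a b I τ ρ χ) (dom S Ω : Set TXU) := by
  have pt : ContDiffOn ℝ ∞ (fun p : TXU => p.1) (dom S Ω : Set TXU) := contDiff_fst.contDiffOn
  have px : ContDiffOn ℝ ∞ (fun p : TXU => p.2.1) (dom S Ω : Set TXU) := by fun_prop
  have pu : ContDiffOn ℝ ∞ (fun p : TXU => p.2.2) (dom S Ω : Set TXU) := by fun_prop
  have mt : Set.MapsTo (fun p : TXU => p.1) (dom S Ω : Set TXU) (S : Set ℝ) :=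
    fun p hp => (mem_dom.1 hp).1
  have mx : Set.MapsTo (fun p : TXU => p.2.1) (dom S Ω : Set TXU) (Ω : Set ℝ) :=
    fun p hp => (mem_dom.1 hp).2
  have hτ := hs.tau.comp pt mt
  have hτ1 := (contDiffOn_deriv hs.tau).comp pt mt
  have hτ2 := (contDiffOn_deriv (contDiffOn_deriv hs.tau)).comp pt mt
  have hρ := hs.rho.comp pt mt
  have hρ1 := (contDiffOn_deriv hs.rho).comp pt mt
  have hχ := hs.chi.comp pt mt
  have hsq := h.smooth_sqrt.comp px mx
  have hJ := h.smooth_J.comp px mx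
  have hI := h.smooth_I.comp px mx
  have hσ := ((contDiffOn_const (c := (1 / 2 : ℝ))).mul hτ1 |>.mul hI).add hρ
  refine hτ.prodMk ((hsq.mul hσ).prodMk (ContDiffOn.mul ?_ pu))
  exact ((((contDiffOn_const (c := (1 / 8 : ℝ))).mul hτ2 |>.mul (hI.pow 2)).neg.sub
    ((contDiffOn_const (c := (1 / 2 : ℝ))).mul hρ1 |>.mul hI)).add hχ).add
    (((contDiffOn_const (c := (1 / 2 : ℝ))).mul hJ).mul hσ)

/-! ### Parametrization of the symmetries -/

/-- `X` is the symmetry with parameters `τ`, `ρ`, `χ`. -/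
structure Rep (S Ω : Opens ℝ) (a b c I : ℝ → ℝ) (X : TXU → TXU) (τ ρ χ : ℝ → ℝ) : Prop where
  smooth : SmoothTriple S τ ρ χ
  eq : ∀ p ∈ dom S Ω, X p = symField a b I τ ρ χ p
  res : ∀ t ∈ S, ∀ x ∈ Ω, residual a b c I τ ρ χ t x = 0

section

variable {S Ω : Opens ℝ} {a b c I : ℝ → ℝ}

theorem Rep.hasLinearForm {X : TXU → TXU} {τ ρ χ : ℝ → ℝ} (r : Rep S Ω a b c I X τ ρ χ) :
    HasLinearForm S Ω X := ⟨_, _, _, r.eq⟩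

theorem Rep.isPointSymmetry (h : Coeffs Ω a b c I) {X : TXU → TXU} {τ ρ χ : ℝ → ℝ}
    (r : Rep S Ω a b c I X τ ρ χ) : IsPointSymmetry S Ω a b c X :=
  (isPointSymmetry_symField_iff h r.smooth r.eq).2 r.res

/-- The first determining equation says that `ξ/√a - ½ τ' I` has zero `x`-derivative, and the second
says the same of `φ` minus the part of `symPhi` without `χ`. On the interval `Ω` these are functions
of `t` alone, namely `ρ` and `χ`. -/
theorem exists_rep (hΩ : (Ω : Set ℝ).OrdConnected) (hΩ' : (Ω : Set ℝ).Nonempty)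
    (h : Coeffs Ω a b c I) (X : SmoothVF (dom S Ω)) (hL : HasLinearForm S Ω X)
    (hP : IsPointSymmetry S Ω a b c X) : ∃ τ ρ χ, Rep S Ω a b c I X τ ρ χ := by
  obtain ⟨x₀, hx₀⟩ := hΩ'
  obtain ⟨τ, ξ, φ, hX⟩ := hL
  have hτ : ContDiffOn ℝ ∞ τ S := by
    have : ContDiffOn ℝ ∞ (fun t : ℝ => ((X : TXU → TXU) (t, x₀, 0)).1) S :=
      contDiff_fst.comp_contDiffOn (X.2.1.comp (t := (dom S Ω : Set TXU))
        (by fun_prop) fun t ht => mk_mem_dom 0 ht hx₀)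
    exact this.congr fun t ht => by rw [hX _ (mk_mem_dom 0 ht hx₀)]; rfl
  have hξS : ∀ x ∈ Ω, ContDiffOn ℝ ∞ (fun t => ξ t x) S := fun x hx => by
    have : ContDiffOn ℝ ∞ (fun t : ℝ => ((X : TXU → TXU) (t, x, 0)).2.1) S :=
      (contDiff_fst.comp contDiff_snd).comp_contDiffOn (X.2.1.comp (t := (dom S Ω : Set TXU))
        (by fun_prop) fun t ht => mk_mem_dom 0 ht hx)
    exact this.congr fun t ht => by rw [hX _ (mk_mem_dom 0 ht hx)]; rfl
  have hξΩ : ∀ t ∈ S, ContDiffOn ℝ ∞ (ξ t) Ω := fun t ht => by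
    have : ContDiffOn ℝ ∞ (fun x : ℝ => ((X : TXU → TXU) (t, x, 0)).2.1) Ω :=
      (contDiff_fst.comp contDiff_snd).comp_contDiffOn (X.2.1.comp (t := (dom S Ω : Set TXU))
        (by fun_prop) fun x hx => mk_mem_dom 0 ht hx)
    exact this.congr fun x hx => by rw [hX _ (mk_mem_dom 0 ht hx)]; rfl
  have hφS : ∀ x ∈ Ω, ContDiffOn ℝ ∞ (fun t => φ t x) S := fun x hx => by
    have : ContDiffOn ℝ ∞ (fun t : ℝ => ((X : TXU → TXU) (t, x, 1)).2.2) S :=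
      (contDiff_snd.comp contDiff_snd).comp_contDiffOn (X.2.1.comp (t := (dom S Ω : Set TXU))
        (by fun_prop) fun t ht => mk_mem_dom 1 ht hx)
    exact this.congr fun t ht => by rw [hX _ (mk_mem_dom 1 ht hx)]; simp [field]
  have hφΩ : ∀ t ∈ S, ContDiffOn ℝ ∞ (φ t) Ω := fun t ht => by
    have : ContDiffOn ℝ ∞ (fun x : ℝ => ((X : TXU → TXU) (t, x, 1)).2.2) Ω :=
      (contDiff_snd.comp contDiff_snd).comp_contDiffOn (X.2.1.comp (t := (dom S Ω : Set TXU))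
        (by fun_prop) fun x hx => mk_mem_dom 1 ht hx)
    exact this.congr fun x hx => by rw [hX _ (mk_mem_dom 1 ht hx)]; simp [field]
  have hdet := (isPointSymmetry_iff (a := a) (b := b) (c := c) hX
    (τ₁ := deriv τ) (ξt := fun t x => deriv (fun s => ξ s x) t)
    (φt := fun t x => deriv (fun s => φ s x) t)
    (ξ₁ := fun t => deriv (ξ t)) (φ₁ := fun t => deriv (φ t))
    (ξ₂ := fun t => deriv (deriv (ξ t))) (φ₂ := fun t => deriv (deriv (φ t)))
    (fun t ht => hasDerivAt_of_contDiffOn hτ ht)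
    (fun t ht x hx => hasDerivAt_of_contDiffOn (hξS x hx) ht)
    (fun t ht x hx => hasDerivAt_of_contDiffOn (hφS x hx) ht)
    (fun t ht x hx => hasDerivAt_of_contDiffOn (hξΩ t ht) hx)
    (fun t ht x hx => hasDerivAt_of_contDiffOn (hφΩ t ht) hx)
    (fun t ht x hx => hasDerivAt_of_contDiffOn (contDiffOn_deriv (hξΩ t ht)) hx)
    (fun t ht x hx => hasDerivAt_of_contDiffOn (contDiffOn_deriv (hφΩ t ht)) hx)).1 hP
  let ρ : ℝ → ℝ := fun t => ξ t x₀ / sqrtFun a x₀ - 1 / 2 * deriv τ t * I x₀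
  have hρ : ContDiffOn ℝ ∞ ρ S := ((hξS x₀ hx₀).div_const _).sub
    ((contDiffOn_const.mul (contDiffOn_deriv hτ)).mul contDiffOn_const)
  have hξ : ∀ t ∈ S, ∀ x ∈ Ω, ξ t x = symXi a I τ ρ t x := by
    intro t ht x hx
    have hc : ξ t x / sqrtFun a x - 1 / 2 * deriv τ t * I x = ρ t := by
      refine eq_of_hasDerivAt_zero (f := fun x => ξ t x / sqrtFun a x - 1 / 2 * deriv τ t * I x)
        hΩ (fun y hy => ?_) hx hx₀
      have hs0 := (h.sqrt_pos hy).ne'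
      refine (((hasDerivAt_of_contDiffOn (hξΩ t ht) hy).div (h.hasDerivAt_sqrt hy) hs0).sub
        ((h.hasDerivAt_I hy).const_mul _)).congr_deriv ?_
      have h1 := (hdet t ht y hy).1
      rw [h.deriv_a hy, h.a_eq hy] at h1
      field_simp
      have h2 : sqrtFun a y * (-(sqrtFun a y * deriv τ t) + 2 * sqrtFun a y * deriv (ξ t) y
        - 2 * ξ t y * deriv (sqrtFun a) y) = 0 := by linear_combination h1
      have h3 := (mul_eq_zero.1 h2).resolve_left hs0
      linear_combination h3
    have hs0 := (h.sqrt_pos hx).ne'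
    have : symXi a I τ ρ t x = sqrtFun a x * (1 / 2 * deriv τ t * I x + ρ t) := rfl
    rw [this, ← hc]
    field_simp
    ring
  have hsm0 : SmoothTriple S τ ρ (fun _ => 0) := ⟨hτ, hρ, contDiffOn_const⟩
  let χ : ℝ → ℝ := fun t => φ t x₀ - symPhi a b I τ ρ (fun _ => 0) t x₀
  have hχ : ContDiffOn ℝ ∞ χ S := by
    refine (hφS x₀ hx₀).sub ?_
    have hτ1 := contDiffOn_deriv hτ
    have hτ2 := contDiffOn_deriv hτ1
    have hρ1 := contDiffOn_deriv hρ
    exact ((((contDiffOn_const.mul hτ2).mul contDiffOn_const).neg.sub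
      ((contDiffOn_const.mul hρ1).mul contDiffOn_const)).add contDiffOn_const).add
      (contDiffOn_const.mul (((contDiffOn_const.mul hτ1).mul contDiffOn_const).add hρ))
  have hφ : ∀ t ∈ S, ∀ x ∈ Ω, φ t x = symPhi a b I τ ρ χ t x := by
    intro t ht x hx
    have hc : φ t x - symPhi a b I τ ρ (fun _ => 0) t x = χ t := by
      refine eq_of_hasDerivAt_zero
        (f := fun x => φ t x - symPhi a b I τ ρ (fun _ => 0) t x) hΩ (fun y hy => ?_) hx hx₀
      have hs0 := (h.sqrt_pos hy).ne'
      refine ((hasDerivAt_of_contDiffOn (hφΩ t ht) hy).sub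
        (hasDerivAt_symPhi_x h t hy)).congr_deriv ?_
      have hξ1 : ∀ z ∈ Ω, deriv (ξ t) z =
          deriv (sqrtFun a) z * (1 / 2 * deriv τ t * I z + ρ t) + 1 / 2 * deriv τ t :=
        fun z hz => (hasDerivAt_congr_opens (hξ t ht) hz (hasDerivAt_symXi_x h t hz)).deriv
      have hξ2 := (hasDerivAt_congr_opens hξ1 hy (hasDerivAt_symXi_xx h t hy)).deriv
      have hξt := (hasDerivAt_congr_opens (fun s hs => hξ s hs y hy) ht
        (hasDerivAt_symXi_t hsm0 ht y)).deriv
      have h2 := (hdet t ht y hy).2.1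
      have e1 : symXi a I τ ρ t y = sqrtFun a y * (1 / 2 * deriv τ t * I y + ρ t) := rfl
      rw [hξ2, hξt, hξ1 y hy, hξ t ht y hy, e1, h.deriv_b hy, h.b_eq hy, h.a_eq hy] at h2
      field_simp at h2 ⊢
      have h4 := sub_eq_zero.2 h2
      apply mul_left_cancel₀ hs0
      linear_combination (-4) * h4
    -- `symPhi` depends on its last parameter only through the summand `χ t`.
    rw [← sub_eq_zero, ← sub_eq_zero.2 hc]
    simp only [symPhi]
    ring
  have hXe : ∀ p ∈ dom S Ω, (X : TXU → TXU) p = symField a b I τ ρ χ p := by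
    intro p hp
    obtain ⟨h1, h2⟩ := mem_dom.1 hp
    rw [hX p hp, symField, field, field, hξ _ h1 _ h2, hφ _ h1 _ h2]
  have hsm : SmoothTriple S τ ρ χ := ⟨hτ, hρ, hχ⟩
  exact ⟨τ, ρ, χ, hsm, hXe, (isPointSymmetry_symField_iff h hsm hXe).1 hP⟩

end

/-! ### Sums and multiples of symmetries -/

section Linear

variable {S Ω : Opens ℝ} {a b c I : ℝ → ℝ}

theorem deriv_add_opens {f g : ℝ → ℝ} (hf : ContDiffOn ℝ ∞ f S) (hg : ContDiffOn ℝ ∞ g S) {t : ℝ}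
    (ht : t ∈ S) : deriv (f + g) t = (deriv f + deriv g) t :=
  ((hasDerivAt_of_contDiffOn hf ht).add (hasDerivAt_of_contDiffOn hg ht)).deriv

theorem deriv_deriv_add_opens {f g : ℝ → ℝ} (hf : ContDiffOn ℝ ∞ f S) (hg : ContDiffOn ℝ ∞ g S)
    {t : ℝ} (ht : t ∈ S) :
    deriv (deriv (f + g)) t = (deriv (deriv f) + deriv (deriv g)) t := by
  rw [deriv_eq_of_eqOn (fun s hs => deriv_add_opens hf hg hs) ht]
  exact deriv_add_opens (contDiffOn_deriv hf) (contDiffOn_deriv hg) ht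

theorem deriv_const_smul_fun (r : ℝ) (f : ℝ → ℝ) : deriv (r • f) = r • deriv f := by
  funext t
  exact deriv_const_smul_field r f

theorem Rep.add {X Y : TXU → TXU} {τ ρ χ τ' ρ' χ' : ℝ → ℝ} (hX : Rep S Ω a b c I X τ ρ χ)
    (hY : Rep S Ω a b c I Y τ' ρ' χ') : Rep S Ω a b c I (X + Y) (τ + τ') (ρ + ρ') (χ + χ') := by
  obtain ⟨⟨h1, h2, h3⟩, hXe, hXr⟩ := hX
  obtain ⟨⟨h1', h2', h3'⟩, hYe, hYr⟩ := hY
  refine ⟨⟨h1.add h1', h2.add h2', h3.add h3'⟩, fun p hp => ?_, fun t ht x hx => ?_⟩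
  · have ht := (mem_dom.1 hp).1
    rw [Pi.add_apply, hXe p hp, hYe p hp]
    simp only [symField, field, symXi, symPhi, deriv_add_opens h1 h1' ht, deriv_add_opens h2 h2' ht,
      deriv_deriv_add_opens h1 h1' ht, Pi.add_apply, Prod.mk_add_mk]
    refine Prod.ext rfl (Prod.ext ?_ ?_) <;> simp only <;> ring
  · have e3 : deriv (deriv (deriv (τ + τ'))) t
        = (deriv (deriv (deriv τ)) + deriv (deriv (deriv τ'))) t := by
      rw [deriv_eq_of_eqOn (fun s hs => deriv_deriv_add_opens h1 h1' hs) ht]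
      exact deriv_add_opens (contDiffOn_deriv (contDiffOn_deriv h1))
        (contDiffOn_deriv (contDiffOn_deriv h1')) ht
    have r1 := hXr t ht x hx
    have r2 := hYr t ht x hx
    simp only [residual, deriv_add_opens h1 h1' ht, deriv_add_opens h3 h3' ht, e3,
      deriv_deriv_add_opens h1 h1' ht, deriv_deriv_add_opens h2 h2' ht, Pi.add_apply] at r1 r2 ⊢
    linear_combination r1 + r2

theorem Rep.smul {X : TXU → TXU} {τ ρ χ : ℝ → ℝ} (r : ℝ) (hX : Rep S Ω a b c I X τ ρ χ) :
    Rep S Ω a b c I (r • X) (r • τ) (r • ρ) (r • χ) := by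
  obtain ⟨⟨h1, h2, h3⟩, hXe, hXr⟩ := hX
  refine ⟨⟨h1.const_smul r, h2.const_smul r, h3.const_smul r⟩, fun p hp => ?_, fun t ht x hx => ?_⟩
  · rw [Pi.smul_apply, hXe p hp]
    simp only [symField, field, symXi, symPhi, deriv_const_smul_fun, Pi.smul_apply, Prod.smul_mk,
      smul_eq_mul]
    refine Prod.ext rfl (Prod.ext ?_ ?_) <;> simp only <;> ring
  · have r1 := hXr t ht x hx
    simp only [residual, deriv_const_smul_fun, Pi.smul_apply, smul_eq_mul] at r1 ⊢
    linear_combination r * r1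

theorem Rep.zero : Rep S Ω a b c I 0 0 0 0 := by
  have e : deriv (0 : ℝ → ℝ) = 0 := by funext t; exact deriv_const t 0
  refine ⟨⟨contDiffOn_const, contDiffOn_const, contDiffOn_const⟩, fun p _ => ?_,
    fun t _ x _ => ?_⟩
  · simp only [symField, field, symXi, symPhi, e]
    simp [Prod.ext_iff]
  · simp [residual, e]

end Linear

/-! ### Brackets of symmetries -/

/-- The parameter `τ` of a bracket. -/
def lieTau (τ τ' : ℝ → ℝ) (t : ℝ) : ℝ := τ t * deriv τ' t - τ' t * deriv τ t

/-- The parameter `ρ` of a bracket. -/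
def lieRho (τ ρ τ' ρ' : ℝ → ℝ) (t : ℝ) : ℝ :=
  τ t * deriv ρ' t + 1 / 2 * ρ t * deriv τ' t - (τ' t * deriv ρ t + 1 / 2 * ρ' t * deriv τ t)

/-- The parameter `χ` of a bracket. -/
def lieChi (τ ρ χ τ' ρ' χ' : ℝ → ℝ) (t : ℝ) : ℝ :=
  τ t * deriv χ' t - 1 / 2 * ρ t * deriv ρ' t - (τ' t * deriv χ t - 1 / 2 * ρ' t * deriv ρ t)

section Bracket

variable {S Ω : Opens ℝ} {a b c I : ℝ → ℝ}

section Jets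

variable {τ ρ χ τ' ρ' χ' : ℝ → ℝ}

theorem smoothTriple_lie (hs : SmoothTriple S τ ρ χ) (hs' : SmoothTriple S τ' ρ' χ') :
    SmoothTriple S (lieTau τ τ') (lieRho τ ρ τ' ρ') (lieChi τ ρ χ τ' ρ' χ') := by
  obtain ⟨h1, h2, h3⟩ := hs
  obtain ⟨h1', h2', h3'⟩ := hs'
  have d1 := contDiffOn_deriv h1
  have d2 := contDiffOn_deriv h2
  have d3 := contDiffOn_deriv h3
  have d1' := contDiffOn_deriv h1'
  have d2' := contDiffOn_deriv h2'
  have d3' := contDiffOn_deriv h3'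
  exact ⟨(h1.mul d1').sub (h1'.mul d1),
    ((h1.mul d2').add ((contDiffOn_const.mul h2).mul d1')).sub
      ((h1'.mul d2).add ((contDiffOn_const.mul h2').mul d1)),
    ((h1.mul d3').sub ((contDiffOn_const.mul h2).mul d2')).sub
      ((h1'.mul d3).sub ((contDiffOn_const.mul h2').mul d2))⟩

theorem deriv_lieTau (hs : SmoothTriple S τ ρ χ) (hs' : SmoothTriple S τ' ρ' χ')
    {t : ℝ} (ht : t ∈ S) : deriv (lieTau τ τ') t =
    τ t * deriv (deriv τ') t - τ' t * deriv (deriv τ) t := by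
  have h := ((hasDerivAt_of_contDiffOn hs.tau ht).mul
    (hasDerivAt_of_contDiffOn (contDiffOn_deriv hs'.tau) ht)).sub
    ((hasDerivAt_of_contDiffOn hs'.tau ht).mul
      (hasDerivAt_of_contDiffOn (contDiffOn_deriv hs.tau) ht))
  exact h.deriv.trans (by ring)

theorem deriv2_lieTau (hs : SmoothTriple S τ ρ χ) (hs' : SmoothTriple S τ' ρ' χ')
    {t : ℝ} (ht : t ∈ S) : deriv (deriv (lieTau τ τ')) t =
    deriv τ t * deriv (deriv τ') t + τ t * deriv (deriv (deriv τ')) t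
      - (deriv τ' t * deriv (deriv τ) t + τ' t * deriv (deriv (deriv τ)) t) := by
  rw [deriv_eq_of_eqOn (fun s h => deriv_lieTau hs hs' h) ht]
  exact (((hasDerivAt_of_contDiffOn hs.tau ht).mul (hasDerivAt_of_contDiffOn
    (contDiffOn_deriv (contDiffOn_deriv hs'.tau)) ht)).sub
    ((hasDerivAt_of_contDiffOn hs'.tau ht).mul (hasDerivAt_of_contDiffOn
      (contDiffOn_deriv (contDiffOn_deriv hs.tau)) ht))).deriv

theorem deriv3_lieTau (hs : SmoothTriple S τ ρ χ) (hs' : SmoothTriple S τ' ρ' χ')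
    {t : ℝ} (ht : t ∈ S) : deriv (deriv (deriv (lieTau τ τ'))) t =
    2 * deriv τ t * deriv (deriv (deriv τ')) t + τ t * deriv (deriv (deriv (deriv τ'))) t
      - (2 * deriv τ' t * deriv (deriv (deriv τ)) t
        + τ' t * deriv (deriv (deriv (deriv τ))) t) := by
  rw [deriv_eq_of_eqOn (fun s h => deriv2_lieTau hs hs' h) ht]
  have d0 := hasDerivAt_of_contDiffOn hs.tau ht
  have d1 := hasDerivAt_of_contDiffOn (contDiffOn_deriv hs.tau) ht
  have d2 := hasDerivAt_of_contDiffOn (contDiffOn_deriv (contDiffOn_deriv hs.tau)) ht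
  have d3 := hasDerivAt_of_contDiffOn
    (contDiffOn_deriv (contDiffOn_deriv (contDiffOn_deriv hs.tau))) ht
  have d0' := hasDerivAt_of_contDiffOn hs'.tau ht
  have d1' := hasDerivAt_of_contDiffOn (contDiffOn_deriv hs'.tau) ht
  have d2' := hasDerivAt_of_contDiffOn (contDiffOn_deriv (contDiffOn_deriv hs'.tau)) ht
  have d3' := hasDerivAt_of_contDiffOn
    (contDiffOn_deriv (contDiffOn_deriv (contDiffOn_deriv hs'.tau))) ht
  exact (((d1.mul d2').add (d0.mul d3')).sub ((d1'.mul d2).add (d0'.mul d3))).deriv.trans (by ring)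

theorem deriv_lieRho (hs : SmoothTriple S τ ρ χ) (hs' : SmoothTriple S τ' ρ' χ')
    {t : ℝ} (ht : t ∈ S) : deriv (lieRho τ ρ τ' ρ') t =
    1 / 2 * deriv τ t * deriv ρ' t + τ t * deriv (deriv ρ') t + 1 / 2 * ρ t * deriv (deriv τ') t
      - (1 / 2 * deriv τ' t * deriv ρ t + τ' t * deriv (deriv ρ) t
        + 1 / 2 * ρ' t * deriv (deriv τ) t) := by
  have d0 := hasDerivAt_of_contDiffOn hs.tau ht
  have d1 := hasDerivAt_of_contDiffOn (contDiffOn_deriv hs.tau) ht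
  have d0' := hasDerivAt_of_contDiffOn hs'.tau ht
  have d1' := hasDerivAt_of_contDiffOn (contDiffOn_deriv hs'.tau) ht
  have r0 := hasDerivAt_of_contDiffOn hs.rho ht
  have r1 := hasDerivAt_of_contDiffOn (contDiffOn_deriv hs.rho) ht
  have r0' := hasDerivAt_of_contDiffOn hs'.rho ht
  have r1' := hasDerivAt_of_contDiffOn (contDiffOn_deriv hs'.rho) ht
  exact (((d0.mul r1').add ((r0.const_mul (1 / 2)).mul d1')).sub
    ((d0'.mul r1).add ((r0'.const_mul (1 / 2)).mul d1))).deriv.trans (by ring)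

theorem deriv2_lieRho (hs : SmoothTriple S τ ρ χ) (hs' : SmoothTriple S τ' ρ' χ')
    {t : ℝ} (ht : t ∈ S) : deriv (deriv (lieRho τ ρ τ' ρ')) t =
    1 / 2 * deriv (deriv τ) t * deriv ρ' t + 3 / 2 * deriv τ t * deriv (deriv ρ') t
      + τ t * deriv (deriv (deriv ρ')) t + 1 / 2 * deriv ρ t * deriv (deriv τ') t
      + 1 / 2 * ρ t * deriv (deriv (deriv τ')) t
      - (1 / 2 * deriv (deriv τ') t * deriv ρ t + 3 / 2 * deriv τ' t * deriv (deriv ρ) t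
      + τ' t * deriv (deriv (deriv ρ)) t + 1 / 2 * deriv ρ' t * deriv (deriv τ) t
      + 1 / 2 * ρ' t * deriv (deriv (deriv τ)) t) := by
  rw [deriv_eq_of_eqOn (fun s h => deriv_lieRho hs hs' h) ht]
  have d0 := hasDerivAt_of_contDiffOn hs.tau ht
  have d1 := hasDerivAt_of_contDiffOn (contDiffOn_deriv hs.tau) ht
  have d2 := hasDerivAt_of_contDiffOn (contDiffOn_deriv (contDiffOn_deriv hs.tau)) ht
  have d0' := hasDerivAt_of_contDiffOn hs'.tau ht
  have d1' := hasDerivAt_of_contDiffOn (contDiffOn_deriv hs'.tau) ht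
  have d2' := hasDerivAt_of_contDiffOn (contDiffOn_deriv (contDiffOn_deriv hs'.tau)) ht
  have r0 := hasDerivAt_of_contDiffOn hs.rho ht
  have r1 := hasDerivAt_of_contDiffOn (contDiffOn_deriv hs.rho) ht
  have r2 := hasDerivAt_of_contDiffOn (contDiffOn_deriv (contDiffOn_deriv hs.rho)) ht
  have r0' := hasDerivAt_of_contDiffOn hs'.rho ht
  have r1' := hasDerivAt_of_contDiffOn (contDiffOn_deriv hs'.rho) ht
  have r2' := hasDerivAt_of_contDiffOn (contDiffOn_deriv (contDiffOn_deriv hs'.rho)) ht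
  exact (((((d1.const_mul (1 / 2)).mul r1').add (d0.mul r2')).add
      ((r0.const_mul (1 / 2)).mul d2')).sub
    ((((d1'.const_mul (1 / 2)).mul r1).add (d0'.mul r2)).add
      ((r0'.const_mul (1 / 2)).mul d2))).deriv.trans (by ring)

theorem deriv_lieChi (hs : SmoothTriple S τ ρ χ) (hs' : SmoothTriple S τ' ρ' χ')
    {t : ℝ} (ht : t ∈ S) : deriv (lieChi τ ρ χ τ' ρ' χ') t =
    deriv τ t * deriv χ' t + τ t * deriv (deriv χ') t - 1 / 2 * ρ t * deriv (deriv ρ') t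
      - (deriv τ' t * deriv χ t + τ' t * deriv (deriv χ) t
        - 1 / 2 * ρ' t * deriv (deriv ρ) t) := by
  have d0 := hasDerivAt_of_contDiffOn hs.tau ht
  have d0' := hasDerivAt_of_contDiffOn hs'.tau ht
  have r0 := hasDerivAt_of_contDiffOn hs.rho ht
  have r1 := hasDerivAt_of_contDiffOn (contDiffOn_deriv hs.rho) ht
  have r0' := hasDerivAt_of_contDiffOn hs'.rho ht
  have r1' := hasDerivAt_of_contDiffOn (contDiffOn_deriv hs'.rho) ht
  have x1 := hasDerivAt_of_contDiffOn (contDiffOn_deriv hs.chi) ht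
  have x1' := hasDerivAt_of_contDiffOn (contDiffOn_deriv hs'.chi) ht
  exact (((d0.mul x1').sub ((r0.const_mul (1 / 2)).mul r1')).sub
    ((d0'.mul x1).sub ((r0'.const_mul (1 / 2)).mul r1))).deriv.trans (by ring)

end Jets

theorem residual_deriv_t {τ ρ χ : ℝ → ℝ} (hs : SmoothTriple S τ ρ χ) {x : ℝ}
    (hr : ∀ t ∈ S, residual a b c I τ ρ χ t x = 0) {t : ℝ} (ht : t ∈ S) :
    -(1 / 8 * deriv (deriv (deriv (deriv τ))) t * I x ^ 2) - 1 / 2 * deriv (deriv (deriv ρ)) t * I x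
    + deriv (deriv χ) t + 1 / 4 * deriv (deriv (deriv τ)) t - K a b c x * deriv (deriv τ) t
    - (1 / 2 * deriv (deriv τ) t * I x + deriv ρ t) * (√(a x) * deriv (K a b c) x) = 0 := by
  have d0 := hasDerivAt_of_contDiffOn (contDiffOn_deriv hs.tau) ht
  have d1 := hasDerivAt_of_contDiffOn (contDiffOn_deriv (contDiffOn_deriv hs.tau)) ht
  have d2 := hasDerivAt_of_contDiffOn
    (contDiffOn_deriv (contDiffOn_deriv (contDiffOn_deriv hs.tau))) ht
  have r0 := hasDerivAt_of_contDiffOn hs.rho ht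
  have r1 := hasDerivAt_of_contDiffOn (contDiffOn_deriv (contDiffOn_deriv hs.rho)) ht
  have x1 := hasDerivAt_of_contDiffOn (contDiffOn_deriv hs.chi) ht
  have key := (((((((d2.const_mul (1 / 8)).mul_const (I x ^ 2)).neg.sub
    ((r1.const_mul (1 / 2)).mul_const (I x))).add x1).add (d1.const_mul (1 / 4))).sub
    (d0.const_mul (K a b c x))).sub
    ((((d0.const_mul (1 / 2)).mul_const (I x)).add r0).mul_const (√(a x) * deriv (K a b c) x)))
  exact key.unique (hasDerivAt_congr_opens hr ht (hasDerivAt_const t 0))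

/-- This is the derivative along `√a ∂_x = d/dI`, which keeps the relation polynomial in `I` and
free of `1/√a`. -/
theorem residual_deriv_x (h : Coeffs Ω a b c I) {τ ρ χ : ℝ → ℝ} {t : ℝ}
    (hr : ∀ x ∈ Ω, residual a b c I τ ρ χ t x = 0) {x : ℝ} (hx : x ∈ Ω) :
    -(1 / 4 * deriv (deriv (deriv τ)) t * I x) - 1 / 2 * deriv (deriv ρ) t
    - 3 / 2 * (√(a x) * deriv (K a b c) x) * deriv τ t
    - (1 / 2 * deriv τ t * I x + ρ t) *
      (√(a x) * deriv (fun y => √(a y) * deriv (K a b c) y) x) = 0 := by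
  have dI := h.hasDerivAt_I hx
  have dK := h.hasDerivAt_K hx
  have dk : HasDerivAt (fun y => √(a y) * deriv (K a b c) y)
      (deriv (fun y => √(a y) * deriv (K a b c) y) x) x :=
    hasDerivAt_of_contDiffOn (h.smooth_sqrt.mul (contDiffOn_deriv h.smooth_K)) hx
  have key := ((((((dI.pow 2).const_mul (1 / 8 * deriv (deriv (deriv τ)) t)).neg.sub
    (dI.const_mul (1 / 2 * deriv (deriv ρ) t))).add_const (deriv χ t)).add_const
    (1 / 4 * deriv (deriv τ) t)).sub (dK.mul_const (deriv τ t))).sub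
    ((hasDerivAt_sigma (τ := τ) (ρ := ρ) h t hx).mul dk)
  have h0 := key.unique (hasDerivAt_congr_opens hr hx (hasDerivAt_const x 0))
  have hs : √(a x) ≠ 0 := (h.sqrt_pos hx).ne'
  simp only [sqrtFun] at h0
  have h1 := congrArg (√(a x) * ·) h0
  simp only [mul_zero] at h1
  rw [← h1]
  push_cast
  field_simp
  ring

/-- The residual of the bracket is the residual of the second symmetry transported along the first,
minus the same with the roles exchanged. It is therefore a combination of the two residuals and
their `t`- and `I`-derivatives, all of which vanish. -/
theorem residual_lie (h : Coeffs Ω a b c I) {X Y : TXU → TXU} {τ ρ χ τ' ρ' χ' : ℝ → ℝ}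
    (hX : Rep S Ω a b c I X τ ρ χ) (hY : Rep S Ω a b c I Y τ' ρ' χ') {t x : ℝ} (ht : t ∈ S)
    (hx : x ∈ Ω) :
    residual a b c I (lieTau τ τ') (lieRho τ ρ τ' ρ') (lieChi τ ρ χ τ' ρ' χ') t x = 0 := by
  have e := hX.res t ht x hx
  have et := residual_deriv_t hX.smooth (fun s hs => hX.res s hs x hx) ht
  have ex := residual_deriv_x h (hX.res t ht) hx
  have e' := hY.res t ht x hx
  have et' := residual_deriv_t hY.smooth (fun s hs => hY.res s hs x hx) ht
  have ex' := residual_deriv_x h (hY.res t ht) hx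
  simp only [residual] at e e' ⊢
  rw [deriv_lieTau hX.smooth hY.smooth ht, deriv2_lieTau hX.smooth hY.smooth ht,
    deriv3_lieTau hX.smooth hY.smooth ht, deriv2_lieRho hX.smooth hY.smooth ht,
    deriv_lieChi hX.smooth hY.smooth ht, lieRho]
  linear_combination τ t * et' + (1 / 2 * deriv τ t * I x + ρ t) * ex' + deriv τ t * e'
    - (τ' t * et + (1 / 2 * deriv τ' t * I x + ρ' t) * ex + deriv τ' t * e)

theorem fderiv_apply_of_partials {X : TXU → TXU} {t x u : ℝ} {Xt Xx Xu : TXU}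
    (hd : DifferentiableAt ℝ X (t, x, u)) (ht : HasDerivAt (fun s => X (s, x, u)) Xt t)
    (hx : HasDerivAt (fun y => X (t, y, u)) Xx x) (hu : HasDerivAt (fun v => X (t, x, v)) Xu u)
    (v : TXU) : fderiv ℝ X (t, x, u) v = v.1 • Xt + v.2.1 • Xx + v.2.2 • Xu := by
  have e1 : fderiv ℝ X (t, x, u) (1, 0, 0) = Xt :=
    (hd.hasFDerivAt.comp_hasDerivAt t ((hasDerivAt_id t).prodMk
      ((hasDerivAt_const t x).prodMk (hasDerivAt_const t u)))).unique ht
  have e2 : fderiv ℝ X (t, x, u) (0, 1, 0) = Xx :=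
    (hd.hasFDerivAt.comp_hasDerivAt x ((hasDerivAt_const x t).prodMk
      ((hasDerivAt_id x).prodMk (hasDerivAt_const x u)))).unique hx
  have e3 : fderiv ℝ X (t, x, u) (0, 0, 1) = Xu :=
    (hd.hasFDerivAt.comp_hasDerivAt u ((hasDerivAt_const u t).prodMk
      ((hasDerivAt_const u x).prodMk (hasDerivAt_id u)))).unique hu
  have ev : v = v.1 • ((1, 0, 0) : TXU) + v.2.1 • ((0, 1, 0) : TXU) + v.2.2 • ((0, 0, 1) : TXU) := by
    ext <;> simp
  conv_lhs => rw [ev]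
  rw [map_add, map_add, map_smul, map_smul, map_smul, e1, e2, e3]

theorem fderiv_symField (h : Coeffs Ω a b c I) {τ ρ χ : ℝ → ℝ} (hs : SmoothTriple S τ ρ χ)
    {t x : ℝ} (u : ℝ) (ht : t ∈ S) (hx : x ∈ Ω) (v : TXU) :
    fderiv ℝ (symField a b I τ ρ χ) (t, x, u) v =
      (v.1 * deriv τ t,
       v.1 * (√(a x) * (1 / 2 * deriv (deriv τ) t * I x + deriv ρ t))
        + v.2.1 * (deriv (sqrtFun a) x * (1 / 2 * deriv τ t * I x + ρ t) + 1 / 2 * deriv τ t),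
       v.1 * ((-(1 / 8 * deriv (deriv (deriv τ)) t * I x ^ 2) - 1 / 2 * deriv (deriv ρ) t * I x
          + deriv χ t + 1 / 2 * J a b x * (1 / 2 * deriv (deriv τ) t * I x + deriv ρ t)) * u)
        + v.2.1 * (((-(1 / 4 * deriv (deriv τ) t) * I x - 1 / 2 * deriv ρ t
          + 1 / 4 * deriv τ t * J a b x) / √(a x)
          + 1 / 2 * deriv (J a b) x * (1 / 2 * deriv τ t * I x + ρ t)) * u)
        + v.2.2 * symPhi a b I τ ρ χ t x) := by
  have dτ := hasDerivAt_of_contDiffOn hs.tau ht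
  have dτ1 := hasDerivAt_of_contDiffOn (contDiffOn_deriv hs.tau) ht
  have dτ2 := hasDerivAt_of_contDiffOn (contDiffOn_deriv (contDiffOn_deriv hs.tau)) ht
  have dρ := hasDerivAt_of_contDiffOn hs.rho ht
  have dρ1 := hasDerivAt_of_contDiffOn (contDiffOn_deriv hs.rho) ht
  have dχ := hasDerivAt_of_contDiffOn hs.chi ht
  have hφt := ((((dτ2.const_mul (1 / 8)).mul_const (I x ^ 2)).neg.sub
      ((dρ1.const_mul (1 / 2)).mul_const (I x))).add dχ).add
      (((dτ1.const_mul (1 / 2)).mul_const (I x) |>.add dρ).const_mul (1 / 2 * J a b x))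
  have hd : DifferentiableAt ℝ (symField a b I τ ρ χ) (t, x, u) :=
    ((contDiffOn_symField h hs).contDiffAt ((dom S Ω).isOpen.mem_nhds
      (mk_mem_dom u ht hx))).differentiableAt (by simp)
  rw [fderiv_apply_of_partials hd
    (dτ.prodMk ((hasDerivAt_symXi_t hs ht x).prodMk (hφt.mul_const u)))
    ((hasDerivAt_const x (τ t)).prodMk ((hasDerivAt_symXi_x h t hx).prodMk
      ((hasDerivAt_symPhi_x h t hx).mul_const u)))
    ((hasDerivAt_const u (τ t)).prodMk ((hasDerivAt_const u (symXi a I τ ρ t x)).prodMk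
      ((hasDerivAt_id u).const_mul (symPhi a b I τ ρ χ t x))))]
  simp only [Prod.smul_mk, smul_eq_mul, Prod.mk_add_mk, sqrtFun]
  refine Prod.ext ?_ (Prod.ext ?_ ?_) <;> simp only <;> ring

/-- Computing the Lie bracket componentwise gives again a field of the form `symField`. That its
parameters satisfy the remaining equation is `residual_lie`, so closure under the bracket needs no
general theory of prolongations. -/
theorem Rep.lie (h : Coeffs Ω a b c I) {X Y : TXU → TXU} {τ ρ χ τ' ρ' χ' : ℝ → ℝ}
    (hX : Rep S Ω a b c I X τ ρ χ) (hY : Rep S Ω a b c I Y τ' ρ' χ') :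
    Rep S Ω a b c I (VectorField.lieBracket ℝ X Y) (lieTau τ τ') (lieRho τ ρ τ' ρ')
      (lieChi τ ρ χ τ' ρ' χ') := by
  refine ⟨smoothTriple_lie hX.smooth hY.smooth, ?_, fun t ht x hx => residual_lie h hX hY ht hx⟩
  rintro ⟨t, x, u⟩ hp
  obtain ⟨ht, hx⟩ : t ∈ S ∧ x ∈ Ω := mem_dom.1 hp
  have nX : X =ᶠ[nhds (t, x, u)] symField a b I τ ρ χ := by
    filter_upwards [(dom S Ω).isOpen.mem_nhds hp] with q hq using hX.eq q hq
  have nY : Y =ᶠ[nhds (t, x, u)] symField a b I τ' ρ' χ' := by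
    filter_upwards [(dom S Ω).isOpen.mem_nhds hp] with q hq using hY.eq q hq
  have hs : √(a x) ≠ 0 := (h.sqrt_pos hx).ne'
  rw [VectorField.lieBracket, nX.fderiv_eq, nY.fderiv_eq, fderiv_symField h hX.smooth u ht hx,
    fderiv_symField h hY.smooth u ht hx, hX.eq _ hp, hY.eq _ hp]
  simp only [symField, field, symXi, symPhi, deriv_lieTau hX.smooth hY.smooth ht,
    deriv2_lieTau hX.smooth hY.smooth ht, deriv_lieRho hX.smooth hY.smooth ht, Prod.mk_sub_mk,
    lieTau, lieRho, lieChi]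
  refine Prod.ext ?_ (Prod.ext ?_ ?_)
  · simp only
  · simp only
    ring
  · simp only
    field_simp
    ring

end Bracket

/-! ### The symmetry algebra -/

theorem exists_isI {Ω : Opens ℝ} (hΩ : (Ω : Set ℝ).OrdConnected) (hΩ' : (Ω : Set ℝ).Nonempty)
    {a : ℝ → ℝ} (ha : ContDiffOn ℝ ∞ a Ω) (ha_pos : ∀ x ∈ Ω, 0 < a x) : ∃ I, IsI Ω a I := by
  obtain ⟨x₀, hx₀⟩ := hΩ'
  have hc : ContinuousOn (fun x => 1 / √(a x)) Ω :=
    continuousOn_const.div ha.continuousOn.sqrt fun x hx => (Real.sqrt_pos.2 (ha_pos x hx)).ne'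
  refine ⟨fun x => ∫ y in x₀..x, 1 / √(a y), fun x hx => ?_⟩
  refine intervalIntegral.integral_hasDerivAt_right ?_ ?_ (hc.continuousAt (Ω.isOpen.mem_nhds hx))
  · exact (hc.mono (hΩ.uIcc_subset hx₀ hx)).intervalIntegrable
  · exact hc.stronglyMeasurableAtFilter Ω.isOpen x hx

/-- Every closure property is checked on the parameters `(τ, ρ, χ)`, on which the remaining
determining equation is linear; `Rep.lie` handles the bracket. -/
theorem exists_symmetryAlgebra {S Ω : Opens ℝ} {a b c I : ℝ → ℝ} (hΩ : (Ω : Set ℝ).OrdConnected)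
    (hΩ' : (Ω : Set ℝ).Nonempty) (h : Coeffs Ω a b c I) :
    ∃ 𝔤 : LieSubalgebra ℝ (SmoothVF (dom S Ω)), IsSymmetryAlgebra S Ω a b c 𝔤 := by
  refine ⟨{ carrier := {X | HasLinearForm S Ω X ∧ IsPointSymmetry S Ω a b c X}
            add_mem' := ?_, zero_mem' := ?_, smul_mem' := ?_, lie_mem' := ?_ }, fun X => Iff.rfl⟩
  · rintro X Y ⟨h1, h2⟩ ⟨h1', h2'⟩
    obtain ⟨_, _, _, r⟩ := exists_rep hΩ hΩ' h X h1 h2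
    obtain ⟨_, _, _, r'⟩ := exists_rep hΩ hΩ' h Y h1' h2'
    exact ⟨(r.add r').hasLinearForm, (r.add r').isPointSymmetry h⟩
  · have r : Rep S Ω a b c I 0 0 0 0 := Rep.zero
    exact ⟨r.hasLinearForm, r.isPointSymmetry h⟩
  · rintro s X ⟨h1, h2⟩
    obtain ⟨_, _, _, r⟩ := exists_rep hΩ hΩ' h X h1 h2
    exact ⟨(r.smul s).hasLinearForm, (r.smul s).isPointSymmetry h⟩
  · rintro X Y ⟨h1, h2⟩ ⟨h1', h2'⟩
    obtain ⟨_, _, _, r⟩ := exists_rep hΩ hΩ' h X h1 h2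
    obtain ⟨_, _, _, r'⟩ := exists_rep hΩ hΩ' h Y h1' h2'
    exact ⟨(r.lie h r').hasLinearForm, (r.lie h r').isPointSymmetry h⟩

/-! ### Initial data as linear coordinates on the symmetry algebra -/

section Data

variable {S Ω : Opens ℝ} {a b c I : ℝ → ℝ}

/-- One point `x` with `u = 1` suffices: the components give `τ`, then `ρ` because `√a ≠ 0`, then
`χ`. -/
theorem Rep.unique (hΩ' : (Ω : Set ℝ).Nonempty) (h : Coeffs Ω a b c I) {X : TXU → TXU}
    {τ ρ χ τ' ρ' χ' : ℝ → ℝ} (hX : Rep S Ω a b c I X τ ρ χ) (hX' : Rep S Ω a b c I X τ' ρ' χ') :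
    (∀ t ∈ S, τ t = τ' t) ∧ (∀ t ∈ S, ρ t = ρ' t) ∧ (∀ t ∈ S, χ t = χ' t) := by
  obtain ⟨x, hx⟩ := hΩ'
  have e : ∀ t ∈ S, symField a b I τ ρ χ (t, x, 1) = symField a b I τ' ρ' χ' (t, x, 1) :=
    fun t ht => (hX.eq _ (mk_mem_dom 1 ht hx)).symm.trans (hX'.eq _ (mk_mem_dom 1 ht hx))
  have e1 : ∀ t ∈ S, τ t = τ' t := fun t ht => congrArg Prod.fst (e t ht)
  have e1' : ∀ t ∈ S, deriv τ t = deriv τ' t := fun t ht => deriv_eq_of_eqOn e1 ht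
  have e1'' : ∀ t ∈ S, deriv (deriv τ) t = deriv (deriv τ') t :=
    fun t ht => deriv_eq_of_eqOn e1' ht
  have e2 : ∀ t ∈ S, ρ t = ρ' t := by
    intro t ht
    have h2 : √(a x) * (1 / 2 * deriv τ t * I x + ρ t)
      = √(a x) * (1 / 2 * deriv τ' t * I x + ρ' t) := congrArg (fun p => p.2.1) (e t ht)
    have hs : √(a x) ≠ 0 := (h.sqrt_pos hx).ne'
    have h3 := mul_left_cancel₀ hs h2
    rw [e1' t ht] at h3
    linarith
  refine ⟨e1, e2, fun t ht => ?_⟩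
  have h3 : symPhi a b I τ ρ χ t x * 1 = symPhi a b I τ' ρ' χ' t x * 1 :=
    congrArg (fun p => p.2.2) (e t ht)
  simp only [symPhi, e1' t ht, e1'' t ht, e2 t ht, deriv_eq_of_eqOn e2 ht] at h3
  linarith

theorem exists_rep_of_mem (hΩ : (Ω : Set ℝ).OrdConnected) (hΩ' : (Ω : Set ℝ).Nonempty)
    (h : Coeffs Ω a b c I) {𝔤 : LieSubalgebra ℝ (SmoothVF (dom S Ω))}
    (h𝔤 : IsSymmetryAlgebra S Ω a b c 𝔤) (X : 𝔤) :
    ∃ τ ρ χ, Rep S Ω a b c I (X.1 : TXU → TXU) τ ρ χ :=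
  exists_rep hΩ hΩ' h X.1 ((h𝔤 X.1).1 X.2).1 ((h𝔤 X.1).1 X.2).2

/-- The initial data at `t₀` of the parameters of a symmetry. -/
def jetAt (t₀ : ℝ) (τ ρ χ : ℝ → ℝ) : Fin 6 → ℝ :=
  ![τ t₀, deriv τ t₀, deriv (deriv τ) t₀, ρ t₀, deriv ρ t₀, χ t₀]

/-- Parameters are chosen arbitrarily for each symmetry. By `Rep.unique` they are determined on the
open set `S`, hence so are their derivatives at `t₀`, and this makes the assignment linear. -/
theorem exists_dataMap (hΩ : (Ω : Set ℝ).OrdConnected) (hΩ' : (Ω : Set ℝ).Nonempty)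
    (h : Coeffs Ω a b c I) {𝔤 : LieSubalgebra ℝ (SmoothVF (dom S Ω))}
    (h𝔤 : IsSymmetryAlgebra S Ω a b c 𝔤) {t₀ : ℝ} (ht₀ : t₀ ∈ S) :
    ∃ D : 𝔤 →ₗ[ℝ] (Fin 6 → ℝ), ∀ (X : 𝔤) (τ ρ χ : ℝ → ℝ),
      Rep S Ω a b c I (X.1 : TXU → TXU) τ ρ χ → D X = jetAt t₀ τ ρ χ := by
  choose τ ρ χ hr using exists_rep_of_mem hΩ hΩ' h h𝔤
  have key : ∀ (X : 𝔤) (τ' ρ' χ' : ℝ → ℝ), Rep S Ω a b c I (X.1 : TXU → TXU) τ' ρ' χ' →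
      jetAt t₀ (τ X) (ρ X) (χ X) = jetAt t₀ τ' ρ' χ' := by
    intro X τ' ρ' χ' hr'
    obtain ⟨e1, e2, e3⟩ := (hr X).unique hΩ' h hr'
    simp only [jetAt, e1 t₀ ht₀, e2 t₀ ht₀, e3 t₀ ht₀, deriv_eq_of_eqOn e1 ht₀,
      deriv_eq_of_eqOn e2 ht₀, deriv_eq_of_eqOn (fun t ht => deriv_eq_of_eqOn e1 ht) ht₀]
  refine ⟨{ toFun := fun X => jetAt t₀ (τ X) (ρ X) (χ X), map_add' := ?_, map_smul' := ?_ }, key⟩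
  · intro X Y
    rw [key (X + Y) _ _ _ ((hr X).add (hr Y))]
    have s := (hr X).smooth
    have s' := (hr Y).smooth
    simp only [jetAt, deriv_add_opens s.tau s'.tau ht₀, deriv_add_opens s.rho s'.rho ht₀,
      deriv_deriv_add_opens s.tau s'.tau ht₀, Pi.add_apply]
    ext i
    fin_cases i <;> rfl
  · intro r X
    rw [key (r • X) _ _ _ ((hr X).smul r)]
    simp only [jetAt, deriv_const_smul_fun, Pi.smul_apply]
    ext i
    fin_cases i <;> rfl

theorem exists_mem_of_residual (h : Coeffs Ω a b c I) {𝔤 : LieSubalgebra ℝ (SmoothVF (dom S Ω))}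
    (h𝔤 : IsSymmetryAlgebra S Ω a b c 𝔤) {τ ρ χ : ℝ → ℝ} (hs : SmoothTriple S τ ρ χ)
    (hr : ∀ t ∈ S, ∀ x ∈ Ω, residual a b c I τ ρ χ t x = 0) :
    ∃ X : 𝔤, Rep S Ω a b c I (X.1 : TXU → TXU) τ ρ χ := by
  classical
  let F : TXU → TXU := (dom S Ω : Set TXU).indicator (symField a b I τ ρ χ)
  have hF : ∀ p ∈ dom S Ω, F p = symField a b I τ ρ χ p :=
    fun p hp => Set.indicator_of_mem (s := (dom S Ω : Set TXU)) hp _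
  let X : SmoothVF (dom S Ω) := ⟨F, (contDiffOn_symField h hs).congr hF,
    fun p hp => Set.indicator_of_notMem (s := (dom S Ω : Set TXU)) hp _⟩
  have r : Rep S Ω a b c I (X : TXU → TXU) τ ρ χ := ⟨hs, hF, hr⟩
  exact ⟨⟨X, (h𝔤 X).2 ⟨r.hasLinearForm, r.isPointSymmetry h⟩⟩, r⟩

end Data

/-! ### Polynomial identities in `I` -/

section Polynomials

variable {Ω : Opens ℝ} {a b c I : ℝ → ℝ}

theorem Coeffs.injOn_I (hΩ : (Ω : Set ℝ).OrdConnected) (h : Coeffs Ω a b c I) :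
    Set.InjOn I Ω := by
  refine (strictMonoOn_of_deriv_pos hΩ.convex h.smooth_I.continuousOn fun x hx => ?_).injOn
  rw [Ω.isOpen.interior_eq] at hx
  rw [(h.hasDerivAt_I hx).deriv]
  exact one_div_pos.2 (h.sqrt_pos hx)

/-- `I` is injective, so it takes infinitely many values on `Ω`. Degree five is what arises when the
residual, quadratic in `I` apart from negative powers, is multiplied by `I³`. -/
theorem Coeffs.quintic_eq_zero (hΩ : (Ω : Set ℝ).OrdConnected) (hΩ' : (Ω : Set ℝ).Nonempty)
    (h : Coeffs Ω a b c I) {p₀ p₁ p₂ p₃ p₄ p₅ : ℝ}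
    (hp : ∀ x ∈ Ω, p₀ + p₁ * I x + p₂ * I x ^ 2 + p₃ * I x ^ 3 + p₄ * I x ^ 4 + p₅ * I x ^ 5 = 0) :
    p₀ = 0 ∧ p₁ = 0 ∧ p₂ = 0 ∧ p₃ = 0 ∧ p₄ = 0 ∧ p₅ = 0 := by
  open Polynomial in
  let p : ℝ[X] := C p₀ + C p₁ * X + C p₂ * X ^ 2 + C p₃ * X ^ 3 + C p₄ * X ^ 4 + C p₅ * X ^ 5
  have hinf : (I '' (Ω : Set ℝ)).Infinite := by
    obtain ⟨x, hx⟩ := hΩ'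
    exact (infinite_of_mem_nhds x (Ω.isOpen.mem_nhds hx)).image (h.injOn_I hΩ)
  have h0 : p = 0 := by
    refine Polynomial.eq_zero_of_infinite_isRoot p (hinf.mono ?_)
    rintro _ ⟨x, hx, rfl⟩
    simpa [p, Polynomial.IsRoot] using hp x hx
  have hc : ∀ n, p.coeff n = 0 := fun n => by rw [h0, Polynomial.coeff_zero]
  refine ⟨?_, ?_, ?_, ?_, ?_, ?_⟩
  · simpa [p, Polynomial.coeff_X, Polynomial.coeff_C, Polynomial.coeff_X_pow] using hc 0
  · simpa [p, Polynomial.coeff_X, Polynomial.coeff_C, Polynomial.coeff_X_pow] using hc 1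
  · simpa [p, Polynomial.coeff_X, Polynomial.coeff_C, Polynomial.coeff_X_pow] using hc 2
  · simpa [p, Polynomial.coeff_X, Polynomial.coeff_C, Polynomial.coeff_X_pow] using hc 3
  · simpa [p, Polynomial.coeff_X, Polynomial.coeff_C, Polynomial.coeff_X_pow] using hc 4
  · simpa [p, Polynomial.coeff_X, Polynomial.coeff_C, Polynomial.coeff_X_pow] using hc 5

end Polynomials

/-! ### Reduction to ordinary differential equations -/

/-- The ordinary differential equations for the parameters when `K = c₂ I² + c₁ I + c₀`. -/
def IsODESol (S : Opens ℝ) (c₂ c₁ c₀ : ℝ) (τ ρ χ : ℝ → ℝ) : Prop :=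
  ∀ t ∈ S, deriv (deriv (deriv τ)) t = -(16 * c₂ * deriv τ t) ∧
    deriv (deriv ρ) t = -(3 * c₁ * deriv τ t) - 4 * c₂ * ρ t ∧
    deriv χ t = c₀ * deriv τ t - 1 / 4 * deriv (deriv τ) t + c₁ * ρ t

section ODE

variable {S Ω : Opens ℝ} {a b c I : ℝ → ℝ}

/-- Here `√a K' = 2 c₂ I + c₁`, so the residual is quadratic in `I`; its three coefficients are the
three differential equations. -/
theorem residual_eq_zero_iff_of_KForm6 (hΩ : (Ω : Set ℝ).OrdConnected) (hΩ' : (Ω : Set ℝ).Nonempty)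
    (h : Coeffs Ω a b c I) {c₂ c₁ c₀ : ℝ} (hK : KForm6 Ω a b c I c₂ c₁ c₀)
    (τ ρ χ : ℝ → ℝ) :
    (∀ t ∈ S, ∀ x ∈ Ω, residual a b c I τ ρ χ t x = 0) ↔ IsODESol S c₂ c₁ c₀ τ ρ χ := by
  have hK' : ∀ x ∈ Ω, √(a x) * deriv (K a b c) x = 2 * c₂ * I x + c₁ := by
    intro x hx
    have hs : √(a x) ≠ 0 := (h.sqrt_pos hx).ne'
    rw [(hasDerivAt_congr_opens hK hx (((((h.isI x hx).pow 2).const_mul c₂).add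
      ((h.isI x hx).const_mul c₁)).add_const c₀)).deriv]
    push_cast
    field_simp
  refine forall₂_congr fun t _ => ?_
  constructor
  · intro hr
    obtain ⟨h0, h1, h2, -⟩ := h.quintic_eq_zero hΩ hΩ'
      (p₀ := deriv χ t + 1 / 4 * deriv (deriv τ) t - c₀ * deriv τ t - c₁ * ρ t)
      (p₁ := -(1 / 2 * deriv (deriv ρ) t) - 3 / 2 * c₁ * deriv τ t - 2 * c₂ * ρ t)
      (p₂ := -(1 / 8 * deriv (deriv (deriv τ)) t) - 2 * c₂ * deriv τ t)
      (p₃ := 0) (p₄ := 0) (p₅ := 0) (fun x hx => by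
        have := hr x hx
        rw [residual, hK' x hx, hK x hx] at this
        linear_combination this)
    exact ⟨by linarith, by linarith, by linarith⟩
  · rintro ⟨h1, h2, h3⟩ x hx
    rw [residual, hK' x hx, hK x hx, h1, h2, h3]
    ring

/-- The `τ'` terms coming from `μ / I²` cancel, because the inverse square is homogeneous of degree
`-2`. The only trace of `μ` is `2 μ ρ / I³`, which forces `ρ = 0`. -/
theorem residual_eq_zero_iff_of_KForm4 (hΩ : (Ω : Set ℝ).OrdConnected) (hΩ' : (Ω : Set ℝ).Nonempty)
    (h : Coeffs Ω a b c I) {μ c₂ c₀ : ℝ} (hμ : μ ≠ 0)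
    (hK : KForm4 Ω a b c I μ c₂ c₀) (τ ρ χ : ℝ → ℝ) :
    (∀ t ∈ S, ∀ x ∈ Ω, residual a b c I τ ρ χ t x = 0) ↔
      IsODESol S c₂ 0 c₀ τ ρ χ ∧ ∀ t ∈ S, ρ t = 0 := by
  have hK' : ∀ x ∈ Ω, √(a x) * deriv (K a b c) x = -(2 * μ / I x ^ 3) + 2 * c₂ * I x := by
    intro x hx
    have hs : √(a x) ≠ 0 := (h.sqrt_pos hx).ne'
    have hI := (hK x hx).1
    rw [(hasDerivAt_congr_opens (fun y hy => (hK y hy).2) hx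
      ((((hasDerivAt_const x μ).div ((h.isI x hx).pow 2) (pow_ne_zero 2 hI)).add
      (((h.isI x hx).pow 2).const_mul c₂)).add_const c₀)).deriv]
    push_cast
    simp only [Pi.pow_apply]
    field_simp
    ring
  constructor
  · intro hr
    have hρ : ∀ t ∈ S, ρ t = 0 ∧ deriv (deriv (deriv τ)) t = -(16 * c₂ * deriv τ t) ∧
        deriv χ t = c₀ * deriv τ t - 1 / 4 * deriv (deriv τ) t := by
      intro t ht
      obtain ⟨h0, -, -, h3, -, h5⟩ := h.quintic_eq_zero hΩ hΩ'
        -- Coefficients of `I³` times the residual.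
        (p₀ := 2 * μ * ρ t) (p₁ := 0) (p₂ := 0)
        (p₃ := deriv χ t + 1 / 4 * deriv (deriv τ) t - c₀ * deriv τ t)
        (p₄ := -(1 / 2 * deriv (deriv ρ) t) - 2 * c₂ * ρ t)
        (p₅ := -(1 / 8 * deriv (deriv (deriv τ)) t) - 2 * c₂ * deriv τ t)
        (fun x hx => by
          have hI := (hK x hx).1
          have e := hr t ht x hx
          rw [residual, hK' x hx, (hK x hx).2] at e
          have e' := congrArg (I x ^ 3 * ·) e
          simp only [mul_zero] at e'
          refine Eq.trans ?_ e'
          field_simp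
          ring)
      exact ⟨by simpa [hμ] using h0, by linarith, by linarith⟩
    have hρ0 : ∀ t ∈ S, ρ t = (fun _ => (0 : ℝ)) t := fun t ht => (hρ t ht).1
    have hρ1 : ∀ t ∈ S, deriv ρ t = (fun _ => (0 : ℝ)) t := fun t ht => by
      rw [deriv_eq_of_eqOn hρ0 ht, deriv_const]
    refine ⟨fun t ht => ⟨(hρ t ht).2.1, ?_, ?_⟩, hρ0⟩
    · rw [deriv_eq_of_eqOn hρ1 ht, deriv_const, hρ0 t ht]
      ring
    · rw [(hρ t ht).2.2]
      ring
  · rintro ⟨hO, hρ⟩ t ht x hx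
    obtain ⟨h1, h2, h3⟩ := hO t ht
    have hI := (hK x hx).1
    rw [residual, hK' x hx, (hK x hx).2, h1, h2, h3, hρ t ht]
    field_simp
    ring

/-- The system is triangular: the equation for `τ'` is closed; once `τ' = 0`, so is the one for `ρ`;
`χ` is then a plain integral. -/
theorem IsODESol.eq_zero (hS : (S : Set ℝ).OrdConnected) {c₂ c₁ c₀ : ℝ} {τ ρ χ : ℝ → ℝ}
    (hs : SmoothTriple S τ ρ χ) (ho : IsODESol S c₂ c₁ c₀ τ ρ χ) {t₀ : ℝ} (ht₀ : t₀ ∈ S)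
    (hj : jetAt t₀ τ ρ χ = 0) : ∀ t ∈ S, τ t = 0 ∧ ρ t = 0 ∧ χ t = 0 := by
  have j0 : τ t₀ = 0 := congrFun hj 0
  have j1 : deriv τ t₀ = 0 := congrFun hj 1
  have j2 : deriv (deriv τ) t₀ = 0 := congrFun hj 2
  have j3 : ρ t₀ = 0 := congrFun hj 3
  have j4 : deriv ρ t₀ = 0 := congrFun hj 4
  have j5 : χ t₀ = 0 := congrFun hj 5
  have d1 := contDiffOn_deriv hs.tau
  have d2 := contDiffOn_deriv d1
  have hτ1 : ∀ t ∈ S, deriv τ t = 0 := fun t ht =>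
    eq_zero_of_second_order hS (k := -(16 * c₂)) (g := deriv (deriv τ))
      (fun s hs' => hasDerivAt_of_contDiffOn d1 hs')
      (fun s hs' => (hasDerivAt_of_contDiffOn d2 hs').congr_deriv
        ((ho s hs').1.trans (by ring))) ht₀ j1 j2 ht
  have hτ2 : ∀ t ∈ S, deriv (deriv τ) t = 0 := fun t ht =>
    (deriv_eq_of_eqOn (g := fun _ => 0) hτ1 ht).trans (deriv_const _ _)
  have hτ : ∀ t ∈ S, τ t = 0 := fun t ht =>
    (eq_of_hasDerivAt_zero hS (fun s hs' => (hasDerivAt_of_contDiffOn hs.tau hs').congr_deriv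
      (hτ1 s hs')) ht ht₀).trans j0
  have hρ : ∀ t ∈ S, ρ t = 0 := fun t ht =>
    eq_zero_of_second_order hS (k := -(4 * c₂)) (g := deriv ρ)
      (fun s hs' => hasDerivAt_of_contDiffOn hs.rho hs')
      (fun s hs' => (hasDerivAt_of_contDiffOn (contDiffOn_deriv hs.rho) hs').congr_deriv
        ((ho s hs').2.1.trans (by rw [hτ1 s hs']; ring))) ht₀ j3 j4 ht
  refine fun t ht => ⟨hτ t ht, hρ t ht, ?_⟩
  exact (eq_of_hasDerivAt_zero hS (fun s hs' => (hasDerivAt_of_contDiffOn hs.chi hs').congr_deriv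
    ((ho s hs').2.2.trans (by rw [hτ1 s hs', hτ2 s hs', hρ s hs']; ring))) ht ht₀).trans j5

theorem Rep.eq_zero {X : SmoothVF (dom S Ω)} {τ ρ χ : ℝ → ℝ}
    (r : Rep S Ω a b c I X τ ρ χ) (h0 : ∀ t ∈ S, τ t = 0 ∧ ρ t = 0 ∧ χ t = 0) : X = 0 := by
  have e1 : ∀ t ∈ S, deriv τ t = 0 := fun t ht =>
    (deriv_eq_of_eqOn (g := fun _ => 0) (fun s hs => (h0 s hs).1) ht).trans (deriv_const _ _)
  have e2 : ∀ t ∈ S, deriv (deriv τ) t = 0 := fun t ht =>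
    (deriv_eq_of_eqOn (g := fun _ => 0) e1 ht).trans (deriv_const _ _)
  have e3 : ∀ t ∈ S, deriv ρ t = 0 := fun t ht =>
    (deriv_eq_of_eqOn (g := fun _ => 0) (fun s hs => (h0 s hs).2.1) ht).trans (deriv_const _ _)
  refine SmoothVF.ext_on fun p hp => ?_
  have ht := (mem_dom.1 hp).1
  obtain ⟨q1, q2, q3⟩ := h0 _ ht
  rw [r.eq p hp]
  simp [symField, field, symXi, symPhi, q1, q2, q3, e1 _ ht, e2 _ ht, e3 _ ht]

end ODE

/-! ### Explicit solutions -/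

/-- Quartic polynomials. -/
def polyFun (p₀ p₁ p₂ p₃ p₄ t : ℝ) : ℝ := p₀ + p₁ * t + p₂ * t ^ 2 + p₃ * t ^ 3 + p₄ * t ^ 4

/-- Multiples of an exponential. -/
def expFun (r k t : ℝ) : ℝ := r * Real.exp (k * t)

/-- Combinations of a cosine and a sine. -/
def trigFun (p q k t : ℝ) : ℝ := p * Real.cos (k * t) + q * Real.sin (k * t)

theorem contDiff_polyFun (p₀ p₁ p₂ p₃ p₄ : ℝ) : ContDiff ℝ ∞ (polyFun p₀ p₁ p₂ p₃ p₄) := by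
  unfold polyFun; fun_prop

theorem contDiff_expFun (r k : ℝ) : ContDiff ℝ ∞ (expFun r k) := by
  unfold expFun; fun_prop

theorem contDiff_trigFun (p q k : ℝ) : ContDiff ℝ ∞ (trigFun p q k) := by
  unfold trigFun; fun_prop

theorem deriv_polyFun (p₀ p₁ p₂ p₃ p₄ : ℝ) :
    deriv (polyFun p₀ p₁ p₂ p₃ p₄) = polyFun p₁ (2 * p₂) (3 * p₃) (4 * p₄) 0 := by
  funext t
  have h := hasDerivAt_id t
  refine HasDerivAt.deriv (((((h.const_mul p₁).const_add p₀).add ((h.pow 2).const_mul p₂)).add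
    ((h.pow 3).const_mul p₃)).add ((h.pow 4).const_mul p₄) |>.congr_deriv ?_)
  simp only [polyFun, id]
  push_cast
  ring

theorem deriv_expFun (r k : ℝ) : deriv (expFun r k) = expFun (r * k) k := by
  funext t
  refine HasDerivAt.deriv ((((hasDerivAt_id t).const_mul k).exp.const_mul r).congr_deriv ?_)
  simp only [expFun, id]
  ring

theorem deriv_trigFun (p q k : ℝ) : deriv (trigFun p q k) = trigFun (q * k) (-(p * k)) k := by
  funext t
  have h := (hasDerivAt_id t).const_mul k
  refine HasDerivAt.deriv (((h.cos.const_mul p).add (h.sin.const_mul q)).congr_deriv ?_)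
  simp only [trigFun, id]
  ring

/-- The parameters `(τ, ρ, χ)` of a field. -/
abbrev Params : Type := (ℝ → ℝ) × (ℝ → ℝ) × (ℝ → ℝ)

/-- The zero function. -/
abbrev zeroFun : ℝ → ℝ := polyFun 0 0 0 0 0

/-- The parameters of the basis for `c₂ = 0`. -/
def paramsZero (c₁ c₀ : ℝ) : Fin 6 → Params :=
  ![(polyFun 1 0 0 0 0, zeroFun, zeroFun),
    (polyFun 0 1 0 0 0, polyFun 0 0 (-(3 / 2 * c₁)) 0 0,
      polyFun 0 c₀ 0 (-(1 / 2 * c₁ ^ 2)) 0),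
    (polyFun 0 0 1 0 0, polyFun 0 0 0 (-c₁) 0, polyFun 0 (-(1 / 2)) c₀ 0 (-(1 / 4 * c₁ ^ 2))),
    (zeroFun, polyFun 0 1 0 0 0, polyFun 0 0 (c₁ / 2) 0 0),
    (zeroFun, polyFun 1 0 0 0 0, polyFun 0 c₁ 0 0 0),
    (zeroFun, zeroFun, polyFun 1 0 0 0 0)]

/-- The parameters of the basis for `c₂ = -κ²`. -/
def paramsNeg (c₁ c₀ κ : ℝ) : Fin 6 → Params :=
  ![(polyFun 1 0 0 0 0, zeroFun, zeroFun),
    (expFun 1 (4 * κ), expFun (-(c₁ / κ)) (4 * κ),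
      expFun (c₀ - κ - c₁ ^ 2 / (4 * κ ^ 2)) (4 * κ)),
    (expFun 1 (-(4 * κ)), expFun (c₁ / κ) (-(4 * κ)),
      expFun (c₀ + κ - c₁ ^ 2 / (4 * κ ^ 2)) (-(4 * κ))),
    (zeroFun, expFun 1 (2 * κ), expFun (c₁ / (2 * κ)) (2 * κ)),
    (zeroFun, expFun 1 (-(2 * κ)), expFun (-(c₁ / (2 * κ))) (-(2 * κ))),
    (zeroFun, zeroFun, polyFun 1 0 0 0 0)]

/-- The parameters of the basis for `c₂ = κ²`. -/
def paramsPos (c₁ c₀ κ : ℝ) : Fin 6 → Params :=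
  ![(polyFun 1 0 0 0 0, zeroFun, zeroFun),
    (trigFun 1 0 (4 * κ), trigFun 0 (-(c₁ / κ)) (4 * κ),
      trigFun (c₀ + c₁ ^ 2 / (4 * κ ^ 2)) κ (4 * κ)),
    (trigFun 0 1 (4 * κ), trigFun (c₁ / κ) 0 (4 * κ),
      trigFun (-κ) (c₀ + c₁ ^ 2 / (4 * κ ^ 2)) (4 * κ)),
    (zeroFun, trigFun 1 0 (2 * κ), trigFun 0 (c₁ / (2 * κ)) (2 * κ)),
    (zeroFun, trigFun 0 1 (2 * κ), trigFun (-(c₁ / (2 * κ))) 0 (2 * κ)),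
    (zeroFun, zeroFun, polyFun 1 0 0 0 0)]

/-- A family of six parameter triples solving the differential equations. -/
structure IsSolFamily (S : Opens ℝ) (c₂ c₁ c₀ : ℝ) (P : Fin 6 → Params) : Prop where
  smooth : ∀ i, SmoothTriple S (P i).1 (P i).2.1 (P i).2.2
  ode : ∀ i, IsODESol S c₂ c₁ c₀ (P i).1 (P i).2.1 (P i).2.2
  indep : ∀ t₀, LinearIndependent ℝ fun i => jetAt t₀ (P i).1 (P i).2.1 (P i).2.2

/-- Independence is a triangular solve: `τ'', τ', τ` eliminate the first three coefficients, `ρ', ρ`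
the next two, and `χ` the last. -/
theorem isSolFamily_zero (S : Opens ℝ) (c₁ c₀ : ℝ) :
    IsSolFamily S 0 c₁ c₀ (paramsZero c₁ c₀) := by
  refine ⟨fun i => ?_, fun i t _ => ?_, fun t₀ => ?_⟩
  · fin_cases i <;> refine ⟨?_, ?_, ?_⟩ <;>
      exact (contDiff_polyFun ..).contDiffOn
  · fin_cases i <;>
      simp only [paramsZero, Fin.zero_eta, Fin.mk_one, Fin.reduceFinMk, Fin.isValue, Matrix.cons_val,
        deriv_polyFun] <;>
      refine ⟨?_, ?_, ?_⟩ <;> simp only [polyFun] <;> (try field_simp) <;> ring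
  · rw [Fintype.linearIndependent_iff]
    intro g hg
    have e0 := congrFun hg 0
    have e1 := congrFun hg 1
    have e2 := congrFun hg 2
    have e3 := congrFun hg 3
    have e4 := congrFun hg 4
    have e5 := congrFun hg 5
    simp only [Fin.sum_univ_six, Pi.add_apply, Pi.smul_apply, smul_eq_mul, jetAt, paramsZero, Fin.isValue,
      Matrix.cons_val, deriv_polyFun, Pi.zero_apply] at e0 e1 e2 e3 e4 e5
    simp only [polyFun] at e0 e1 e2 e3 e4 e5
    have h2 : g 2 = 0 := by linear_combination e2 / 2
    have h1 : g 1 = 0 := by linear_combination e1 - 2 * t₀ * h2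
    have h0 : g 0 = 0 := by linear_combination e0 - t₀ * h1 - t₀ ^ 2 * h2
    have h3 : g 3 = 0 := by linear_combination e4 + 3 * c₁ * t₀ * h1 + 3 * c₁ * t₀ ^ 2 * h2
    have h4 : g 4 = 0 := by
      linear_combination e3 + 3 / 2 * c₁ * t₀ ^ 2 * h1 + c₁ * t₀ ^ 3 * h2 - t₀ * h3
    have h5 : g 5 = 0 := by
      simp only [h1, h2, h3, h4] at e5
      linear_combination e5
    intro i
    fin_cases i <;> assumption

/-- The modes are `exp (± 4κt)` for `τ` and `exp (± 2κt)` for free `ρ`. With `τ = exp (± 4κt)`, the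
equation for `ρ` forces the amplitude `∓ c₁/κ`, and that for `χ` forces `c₀ ∓ κ - c₁²/(4κ²)`. -/
theorem isSolFamily_neg (S : Opens ℝ) (c₁ c₀ : ℝ) {κ : ℝ} (hκ : κ ≠ 0) :
    IsSolFamily S (-κ ^ 2) c₁ c₀ (paramsNeg c₁ c₀ κ) := by
  refine ⟨fun i => ?_, fun i t _ => ?_, fun t₀ => ?_⟩
  · fin_cases i <;> refine ⟨?_, ?_, ?_⟩ <;>
      first | exact (contDiff_polyFun ..).contDiffOn | exact (contDiff_expFun ..).contDiffOn
  · fin_cases i <;>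
      simp only [paramsNeg, Fin.zero_eta, Fin.mk_one, Fin.reduceFinMk, Fin.isValue, Matrix.cons_val,
        deriv_polyFun, deriv_expFun] <;>
      refine ⟨?_, ?_, ?_⟩ <;> simp only [polyFun, expFun] <;> (try field_simp) <;> ring
  · rw [Fintype.linearIndependent_iff]
    intro g hg
    have e0 := congrFun hg 0
    have e1 := congrFun hg 1
    have e2 := congrFun hg 2
    have e3 := congrFun hg 3
    have e4 := congrFun hg 4
    have e5 := congrFun hg 5
    simp only [Fin.sum_univ_six, Pi.add_apply, Pi.smul_apply, smul_eq_mul, jetAt, paramsNeg, Fin.isValue,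
      Matrix.cons_val, deriv_polyFun, deriv_expFun, Pi.zero_apply] at e0 e1 e2 e3 e4 e5
    simp only [polyFun, expFun] at e0 e1 e2 e3 e4 e5
    -- The combinations `4κ τ' ± τ''` isolate the growing and the decaying mode; `2κ ρ ± ρ'` do the
    -- same for `ρ` below.
    have h1 : g 1 = 0 := by
      have : g 1 * (32 * κ ^ 2 * Real.exp (4 * κ * t₀)) = 0 := by
        linear_combination 4 * κ * e1 + e2
      exact (mul_eq_zero.1 this).resolve_right (by positivity)
    have h2 : g 2 = 0 := by
      have : g 2 * (32 * κ ^ 2 * Real.exp (-(4 * κ) * t₀)) = 0 := by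
        linear_combination -(4 * κ * e1) + e2
      exact (mul_eq_zero.1 this).resolve_right (by positivity)
    simp only [h1, h2] at e0 e3 e4
    have h0 : g 0 = 0 := by linear_combination e0
    have h3 : g 3 = 0 := by
      have : g 3 * (4 * κ * Real.exp (2 * κ * t₀)) = 0 := by linear_combination 2 * κ * e3 + e4
      exact (mul_eq_zero.1 this).resolve_right (by positivity)
    have h4 : g 4 = 0 := by
      have : g 4 * (4 * κ * Real.exp (-(2 * κ) * t₀)) = 0 := by linear_combination 2 * κ * e3 - e4
      exact (mul_eq_zero.1 this).resolve_right (by positivity)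
    have h5 : g 5 = 0 := by
      simp only [h1, h2, h3, h4] at e5
      linear_combination e5
    intro i
    fin_cases i <;> assumption

/-- For each pair of modes the two data equations are, up to scaling, a rotation by `4κt₀` or
`2κt₀`; the sine and cosine multipliers below invert it. -/
theorem isSolFamily_pos (S : Opens ℝ) (c₁ c₀ : ℝ) {κ : ℝ} (hκ : κ ≠ 0) :
    IsSolFamily S (κ ^ 2) c₁ c₀ (paramsPos c₁ c₀ κ) := by
  refine ⟨fun i => ?_, fun i t _ => ?_, fun t₀ => ?_⟩
  · fin_cases i <;> refine ⟨?_, ?_, ?_⟩ <;>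
      first | exact (contDiff_polyFun ..).contDiffOn | exact (contDiff_trigFun ..).contDiffOn
  · fin_cases i <;>
      simp only [paramsPos, Fin.zero_eta, Fin.mk_one, Fin.reduceFinMk, Fin.isValue, Matrix.cons_val,
        deriv_polyFun, deriv_trigFun] <;>
      refine ⟨?_, ?_, ?_⟩ <;> simp only [polyFun, trigFun] <;> (try field_simp) <;> ring
  · rw [Fintype.linearIndependent_iff]
    intro g hg
    have e0 := congrFun hg 0
    have e1 := congrFun hg 1
    have e2 := congrFun hg 2
    have e3 := congrFun hg 3
    have e4 := congrFun hg 4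
    have e5 := congrFun hg 5
    simp only [Fin.sum_univ_six, Pi.add_apply, Pi.smul_apply, smul_eq_mul, jetAt, paramsPos, Fin.isValue,
      Matrix.cons_val, deriv_polyFun, deriv_trigFun, Pi.zero_apply] at e0 e1 e2 e3 e4 e5
    simp only [polyFun, trigFun] at e0 e1 e2 e3 e4 e5
    have q4 := Real.sin_sq_add_cos_sq (4 * κ * t₀)
    have q2 := Real.sin_sq_add_cos_sq (2 * κ * t₀)
    have h1 : g 1 = 0 := by
      have : g 1 * (16 * κ ^ 2) = 0 := by
        linear_combination -(4 * κ * Real.sin (4 * κ * t₀) * e1) - Real.cos (4 * κ * t₀) * e2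
          - 16 * κ ^ 2 * g 1 * q4
      exact (mul_eq_zero.1 this).resolve_right (by positivity)
    have h2 : g 2 = 0 := by
      have : g 2 * (16 * κ ^ 2) = 0 := by
        linear_combination 4 * κ * Real.cos (4 * κ * t₀) * e1 - Real.sin (4 * κ * t₀) * e2
          - 16 * κ ^ 2 * g 2 * q4
      exact (mul_eq_zero.1 this).resolve_right (by positivity)
    simp only [h1, h2] at e0 e3 e4
    have h0 : g 0 = 0 := by linear_combination e0
    have h3 : g 3 = 0 := by
      have : g 3 * (2 * κ) = 0 := by
        linear_combination 2 * κ * Real.cos (2 * κ * t₀) * e3 - Real.sin (2 * κ * t₀) * e4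
          - 2 * κ * g 3 * q2
      exact (mul_eq_zero.1 this).resolve_right (by positivity)
    have h4 : g 4 = 0 := by
      have : g 4 * (2 * κ) = 0 := by
        linear_combination 2 * κ * Real.sin (2 * κ * t₀) * e3 + Real.cos (2 * κ * t₀) * e4
          - 2 * κ * g 4 * q2
      exact (mul_eq_zero.1 this).resolve_right (by positivity)
    have h5 : g 5 = 0 := by
      simp only [h1, h2, h3, h4] at e5
      linear_combination e5
    intro i
    fin_cases i <;> assumption

/-- The field with given parameters. -/
def Params.toField (a b I : ℝ → ℝ) (P : Params) : TXU → TXU := symField a b I P.1 P.2.1 P.2.2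

theorem toField_paramsZero (a b I : ℝ → ℝ) (c₁ c₀ : ℝ) (i : Fin 6) :
    (paramsZero c₁ c₀ i).toField a b I = basis6Zero a b I c₁ c₀ i := by
  funext p
  fin_cases i <;>
    simp only [paramsZero, basis6Zero, Params.toField, symField, field, symXi, symPhi, vT, vM,
      Fin.zero_eta, Fin.mk_one, Fin.reduceFinMk, Fin.isValue, Matrix.cons_val, deriv_polyFun] <;>
    refine Prod.ext ?_ (Prod.ext ?_ ?_) <;> simp only [polyFun] <;> (try field_simp) <;> ring

theorem toField_paramsNeg (a b I : ℝ → ℝ) (c₁ c₀ : ℝ) {κ : ℝ} (hκ : κ ≠ 0) (i : Fin 6) :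
    (paramsNeg c₁ c₀ κ i).toField a b I = basis6Neg a b I c₁ c₀ κ i := by
  funext p
  fin_cases i <;>
    simp only [paramsNeg, basis6Neg, Params.toField, symField, field, symXi, symPhi, vT, vM,
      Fin.zero_eta, Fin.mk_one, Fin.reduceFinMk, Fin.isValue, Matrix.cons_val, deriv_polyFun,
      deriv_expFun] <;>
    refine Prod.ext ?_ (Prod.ext ?_ ?_) <;> simp only [polyFun, expFun, neg_mul] <;> (try field_simp) <;> ring

theorem toField_paramsPos (a b I : ℝ → ℝ) (c₁ c₀ : ℝ) {κ : ℝ} (hκ : κ ≠ 0) (i : Fin 6) :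
    (paramsPos c₁ c₀ κ i).toField a b I = basis6Pos a b I c₁ c₀ κ i := by
  funext p
  fin_cases i <;>
    simp only [paramsPos, basis6Pos, Params.toField, symField, field, symXi, symPhi, vT, vM,
      Fin.zero_eta, Fin.mk_one, Fin.reduceFinMk, Fin.isValue, Matrix.cons_val, deriv_polyFun,
      deriv_trigFun] <;>
    refine Prod.ext ?_ (Prod.ext ?_ ?_) <;> simp only [polyFun, trigFun] <;> (try field_simp) <;> ring

/-! ### Dimensions and bases -/

/-- Injectivity of `D` bounds the dimension by `n`, and the independent family attains the bound. -/
theorem hasBasis_of_injective {S Ω : Opens ℝ} {n : ℕ} {𝔤 : LieSubalgebra ℝ (SmoothVF (dom S Ω))}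
    (D : 𝔤 →ₗ[ℝ] (Fin n → ℝ)) (hD : Function.Injective D) {V : Fin n → TXU → TXU} (Y : Fin n → 𝔤)
    (hV : ∀ i, ∀ p ∈ dom S Ω, ((Y i).1 : TXU → TXU) p = V i p) (hY : LinearIndependent ℝ Y) :
    HasBasis 𝔤 V ∧ Module.finrank ℝ 𝔤 = n := by
  have : Module.Finite ℝ 𝔤 := Module.Finite.of_injective D hD
  have h1 : Module.finrank ℝ 𝔤 ≤ n := by
    simpa using LinearMap.finrank_le_finrank_of_injective hD
  have h2 : n ≤ Module.finrank ℝ 𝔤 := by simpa using hY.fintype_card_le_finrank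
  have h3 : Module.finrank ℝ 𝔤 = n := le_antisymm h1 h2
  refine ⟨?_, h3⟩
  -- The basis constructor used below needs a nonempty index type.
  rcases Nat.eq_zero_or_pos n with rfl | hn
  · exact ⟨Module.finBasisOfFinrankEq ℝ 𝔤 h3, fun i => i.elim0⟩
  · have : Nonempty (Fin n) := ⟨⟨0, hn⟩⟩
    refine ⟨basisOfLinearIndependentOfCardEqFinrank hY (by simpa using h3.symm), fun i p hp => ?_⟩
    rw [coe_basisOfLinearIndependentOfCardEqFinrank]
    exact hV i p hp

section Dimension

variable {S Ω : Opens ℝ} {a b c I : ℝ → ℝ}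
  {𝔤 : LieSubalgebra ℝ (SmoothVF (dom S Ω))}

/-- `D` computes the initial data at `t₀`. -/
def IsDataMap (a b c I : ℝ → ℝ) (t₀ : ℝ) (D : 𝔤 →ₗ[ℝ] (Fin 6 → ℝ)) : Prop :=
  ∀ (X : 𝔤) (τ ρ χ : ℝ → ℝ), Rep S Ω a b c I (X.1 : TXU → TXU) τ ρ χ → D X = jetAt t₀ τ ρ χ

theorem IsDataMap.injective_of_KForm6 (hS : (S : Set ℝ).OrdConnected)
    (hΩ : (Ω : Set ℝ).OrdConnected) (hΩ' : (Ω : Set ℝ).Nonempty) (h : Coeffs Ω a b c I)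
    (h𝔤 : IsSymmetryAlgebra S Ω a b c 𝔤) {c₂ c₁ c₀ : ℝ} (hK : KForm6 Ω a b c I c₂ c₁ c₀) {t₀ : ℝ}
    (ht₀ : t₀ ∈ S) {D : 𝔤 →ₗ[ℝ] (Fin 6 → ℝ)} (hD : IsDataMap a b c I t₀ D) :
    Function.Injective D := by
  rw [injective_iff_map_eq_zero]
  intro X hX
  obtain ⟨τ, ρ, χ, r⟩ := exists_rep_of_mem hΩ hΩ' h h𝔤 X
  rw [hD X _ _ _ r] at hX
  have ho := (residual_eq_zero_iff_of_KForm6 hΩ hΩ' h hK τ ρ χ).1 r.res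
  exact Subtype.ext (r.eq_zero (ho.eq_zero hS r.smooth ht₀ hX))

theorem hasBasis_of_KForm6 (hS : (S : Set ℝ).OrdConnected) (hΩ : (Ω : Set ℝ).OrdConnected)
    (hΩ' : (Ω : Set ℝ).Nonempty) (h : Coeffs Ω a b c I) (h𝔤 : IsSymmetryAlgebra S Ω a b c 𝔤)
    (hS' : (S : Set ℝ).Nonempty) {c₂ c₁ c₀ : ℝ}
    (hK : KForm6 Ω a b c I c₂ c₁ c₀) {P : Fin 6 → Params} (hP : IsSolFamily S c₂ c₁ c₀ P) :
    HasBasis 𝔤 (fun i => (P i).toField a b I) ∧ Module.finrank ℝ 𝔤 = 6 := by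
  obtain ⟨t₀, ht₀⟩ := hS'
  obtain ⟨D, hD⟩ := exists_dataMap hΩ hΩ' h h𝔤 ht₀
  choose Y hY using fun i => exists_mem_of_residual h h𝔤 (hP.smooth i)
    ((residual_eq_zero_iff_of_KForm6 hΩ hΩ' h hK _ _ _).2 (hP.ode i))
  refine hasBasis_of_injective D (IsDataMap.injective_of_KForm6 hS hΩ hΩ' h h𝔤 hK ht₀ hD) Y
    (fun i => (hY i).eq) (LinearIndependent.of_comp D ?_)
  have e : D ∘ Y = fun i => jetAt t₀ (P i).1 (P i).2.1 (P i).2.2 :=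
    funext fun i => hD _ _ _ _ (hY i)
  rw [e]
  exact hP.indep t₀

/-- The indices of the parameters with `ρ = 0` in case `c₁ = 0`. -/
def fourOfSix : Fin 4 → Fin 6 := ![0, 1, 2, 5]

theorem fourOfSix_injective : Function.Injective fourOfSix := by decide

/-- Since `ρ` vanishes on `S`, so do the data `ρ, ρ'`, and the remaining four entries already
determine the symmetry. -/
theorem IsDataMap.injective_of_KForm4 (hS : (S : Set ℝ).OrdConnected)
    (hΩ : (Ω : Set ℝ).OrdConnected) (hΩ' : (Ω : Set ℝ).Nonempty) (h : Coeffs Ω a b c I)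
    (h𝔤 : IsSymmetryAlgebra S Ω a b c 𝔤) {μ c₂ c₀ : ℝ} (hμ : μ ≠ 0)
    (hK : KForm4 Ω a b c I μ c₂ c₀) {t₀ : ℝ}
    (ht₀ : t₀ ∈ S) {D : 𝔤 →ₗ[ℝ] (Fin 6 → ℝ)} (hD : IsDataMap a b c I t₀ D) :
    Function.Injective ((LinearMap.funLeft ℝ ℝ fourOfSix).comp D) := by
  rw [injective_iff_map_eq_zero]
  intro X hX
  obtain ⟨τ, ρ, χ, r⟩ := exists_rep_of_mem hΩ hΩ' h h𝔤 X
  obtain ⟨ho, hρ⟩ := (residual_eq_zero_iff_of_KForm4 hΩ hΩ' h hμ hK τ ρ χ).1 r.res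
  have hρ' : deriv ρ t₀ = 0 :=
    (deriv_eq_of_eqOn (g := fun _ => 0) hρ ht₀).trans (deriv_const _ _)
  have hj : jetAt t₀ τ ρ χ = 0 := by
    rw [LinearMap.comp_apply, hD X _ _ _ r] at hX
    have e0 : τ t₀ = 0 := congrFun hX 0
    have e1 : deriv τ t₀ = 0 := congrFun hX 1
    have e2 : deriv (deriv τ) t₀ = 0 := congrFun hX 2
    have e3 : χ t₀ = 0 := congrFun hX 3
    ext i
    fin_cases i <;> simp [jetAt, e0, e1, e2, e3, hρ t₀ ht₀, hρ']
  exact Subtype.ext (r.eq_zero (ho.eq_zero hS r.smooth ht₀ hj))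

theorem hasBasis_of_KForm4 (hS : (S : Set ℝ).OrdConnected) (hΩ : (Ω : Set ℝ).OrdConnected)
    (hΩ' : (Ω : Set ℝ).Nonempty) (h : Coeffs Ω a b c I) (h𝔤 : IsSymmetryAlgebra S Ω a b c 𝔤)
    (hS' : (S : Set ℝ).Nonempty) {μ c₂ c₀ : ℝ} (hμ : μ ≠ 0)
    (hK : KForm4 Ω a b c I μ c₂ c₀) {P : Fin 6 → Params} (hP : IsSolFamily S c₂ 0 c₀ P)
    (hρ : ∀ i t, (P (fourOfSix i)).2.1 t = 0) :
    HasBasis 𝔤 (fun i => (P (fourOfSix i)).toField a b I) ∧ Module.finrank ℝ 𝔤 = 4 := by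
  obtain ⟨t₀, ht₀⟩ := hS'
  obtain ⟨D, hD⟩ := exists_dataMap hΩ hΩ' h h𝔤 ht₀
  choose Y hY using fun i => exists_mem_of_residual h h𝔤 (hP.smooth (fourOfSix i))
    ((residual_eq_zero_iff_of_KForm4 hΩ hΩ' h hμ hK _ _ _).2
      ⟨hP.ode (fourOfSix i), fun t _ => hρ i t⟩)
  refine hasBasis_of_injective _ (IsDataMap.injective_of_KForm4 hS hΩ hΩ' h h𝔤 hμ hK ht₀ hD) Y
    (fun i => (hY i).eq) (LinearIndependent.of_comp D ?_)
  have e : D ∘ Y = (fun i => jetAt t₀ (P i).1 (P i).2.1 (P i).2.2) ∘ fourOfSix :=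
    funext fun i => hD _ _ _ _ (hY i)
  rw [e]
  exact (hP.indep t₀).comp _ fourOfSix_injective

end Dimension

/-! ### Solution families by the sign of `c₂`, and their specialization to `c₁ = 0` -/

theorem paramsZero_rho (c₀ : ℝ) (i : Fin 4) (t : ℝ) :
    (paramsZero 0 c₀ (fourOfSix i)).2.1 t = 0 := by
  fin_cases i <;> simp [fourOfSix, paramsZero, polyFun]

theorem paramsNeg_rho (c₀ κ : ℝ) (i : Fin 4) (t : ℝ) :
    (paramsNeg 0 c₀ κ (fourOfSix i)).2.1 t = 0 := by
  fin_cases i <;> simp [fourOfSix, paramsNeg, polyFun, expFun]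

theorem paramsPos_rho (c₀ κ : ℝ) (i : Fin 4) (t : ℝ) :
    (paramsPos 0 c₀ κ (fourOfSix i)).2.1 t = 0 := by
  fin_cases i <;> simp [fourOfSix, paramsPos, polyFun, trigFun]

theorem exists_isSolFamily (S : Opens ℝ) (c₂ c₁ c₀ : ℝ) :
    ∃ P, IsSolFamily S c₂ c₁ c₀ P ∧ (c₁ = 0 → ∀ i t, (P (fourOfSix i)).2.1 t = 0) := by
  rcases lt_trichotomy c₂ 0 with hc | rfl | hc
  · have hκ : √(-c₂) ≠ 0 := (Real.sqrt_pos.2 (neg_pos.2 hc)).ne'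
    have e : -√(-c₂) ^ 2 = c₂ := by rw [Real.sq_sqrt (neg_pos.2 hc).le, neg_neg]
    refine ⟨paramsNeg c₁ c₀ √(-c₂), ?_, ?_⟩
    · simpa only [e] using isSolFamily_neg S c₁ c₀ hκ
    · rintro rfl
      exact paramsNeg_rho c₀ _
  · refine ⟨paramsZero c₁ c₀, isSolFamily_zero S c₁ c₀, ?_⟩
    rintro rfl
    exact paramsZero_rho c₀
  · have hκ : √c₂ ≠ 0 := (Real.sqrt_pos.2 hc).ne'
    refine ⟨paramsPos c₁ c₀ √c₂, ?_, ?_⟩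
    · simpa only [Real.sq_sqrt hc.le] using isSolFamily_pos S c₁ c₀ hκ
    · rintro rfl
      exact paramsPos_rho c₀ _

theorem basis4Zero_eq (a b I : ℝ → ℝ) (c₀ : ℝ) (i : Fin 4) :
    basis6Zero a b I 0 c₀ (fourOfSix i) = basis4Zero a b I c₀ i := by
  funext p
  fin_cases i <;>
    simp only [fourOfSix, basis6Zero, basis4Zero, field, vT, vM, Fin.zero_eta, Fin.mk_one,
      Fin.reduceFinMk, Fin.isValue, Matrix.cons_val] <;>
    refine Prod.ext ?_ (Prod.ext ?_ ?_) <;> simp only <;> ring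

theorem basis4Neg_eq (a b I : ℝ → ℝ) (c₀ : ℝ) {κ : ℝ} (hκ : κ ≠ 0) (i : Fin 4) :
    basis6Neg a b I 0 c₀ κ (fourOfSix i) = basis4Neg a b I c₀ κ i := by
  funext p
  fin_cases i <;>
    simp only [fourOfSix, basis6Neg, basis4Neg, field, vT, vM, Fin.zero_eta, Fin.mk_one,
      Fin.reduceFinMk, Fin.isValue, Matrix.cons_val] <;>
    refine Prod.ext ?_ (Prod.ext ?_ ?_) <;> simp only <;> (try field_simp) <;> ring

theorem basis4Pos_eq (a b I : ℝ → ℝ) (c₀ : ℝ) {κ : ℝ} (hκ : κ ≠ 0) (i : Fin 4) :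
    basis6Pos a b I 0 c₀ κ (fourOfSix i) = basis4Pos a b I c₀ κ i := by
  funext p
  fin_cases i <;>
    simp only [fourOfSix, basis6Pos, basis4Pos, field, vT, vM, Fin.zero_eta, Fin.mk_one,
      Fin.reduceFinMk, Fin.isValue, Matrix.cons_val] <;>
    refine Prod.ext ?_ (Prod.ext ?_ ?_) <;> simp only <;> (try field_simp) <;> ring

/-! ### Nontrivial symmetries determine the form of `K` -/

section Classification

variable {S Ω : Opens ℝ} {a b c I : ℝ → ℝ}

/-- With `τ' = 0` and `ρ = 0` the residual reduces to `χ'`, so `τ` and `χ` are constants. -/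
theorem Rep.isTrivialField (hS : (S : Set ℝ).OrdConnected) (hS' : (S : Set ℝ).Nonempty)
    {X : TXU → TXU} {τ ρ χ : ℝ → ℝ} (r : Rep S Ω a b c I X τ ρ χ)
    (hτ : ∀ t ∈ S, deriv τ t = 0) (hρ : ∀ t ∈ S, ρ t = 0) (hx : (Ω : Set ℝ).Nonempty) :
    IsTrivialField S Ω X := by
  obtain ⟨t₀, ht₀⟩ := hS'
  obtain ⟨x, hx⟩ := hx
  have hτ2 : ∀ t ∈ S, deriv (deriv τ) t = 0 := fun t ht =>
    (deriv_eq_of_eqOn (g := fun _ => 0) hτ ht).trans (deriv_const _ _)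
  have hτ3 : ∀ t ∈ S, deriv (deriv (deriv τ)) t = 0 := fun t ht =>
    (deriv_eq_of_eqOn (g := fun _ => 0) hτ2 ht).trans (deriv_const _ _)
  have hρ1 : ∀ t ∈ S, deriv ρ t = 0 := fun t ht =>
    (deriv_eq_of_eqOn (g := fun _ => 0) hρ ht).trans (deriv_const _ _)
  have hρ2 : ∀ t ∈ S, deriv (deriv ρ) t = 0 := fun t ht =>
    (deriv_eq_of_eqOn (g := fun _ => 0) hρ1 ht).trans (deriv_const _ _)
  have hχ : ∀ t ∈ S, deriv χ t = 0 := fun t ht => by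
    have e := r.res t ht x hx
    rw [residual, hτ3 t ht, hτ2 t ht, hρ2 t ht, hτ t ht, hρ t ht] at e
    linear_combination e
  refine ⟨τ t₀, χ t₀, fun p hp => ?_⟩
  have ht := (mem_dom.1 hp).1
  have e1 : τ p.1 = τ t₀ := eq_of_hasDerivAt_zero (s := S) hS
    (fun t ht => (hasDerivAt_of_contDiffOn r.smooth.tau ht).congr_deriv (hτ t ht)) ht ht₀
  have e2 : χ p.1 = χ t₀ := eq_of_hasDerivAt_zero (s := S) hS
    (fun t ht => (hasDerivAt_of_contDiffOn r.smooth.chi ht).congr_deriv (hχ t ht)) ht ht₀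
  rw [r.eq p hp]
  simp [symField, field, symXi, symPhi, e1, e2, hτ _ ht, hτ2 _ ht, hρ _ ht, hρ1 _ ht]

/-- Integration with respect to `I`; the constant `c₀` is fixed at `x₀`. -/
theorem exists_KForm6_of_deriv_eq (hΩ : (Ω : Set ℝ).OrdConnected) (hΩ' : (Ω : Set ℝ).Nonempty)
    (h : Coeffs Ω a b c I) {p q : ℝ}
    (hK : ∀ x ∈ Ω, √(a x) * deriv (K a b c) x = p + q * I x) :
    ∃ c₂ c₁ c₀ : ℝ, KForm6 Ω a b c I c₂ c₁ c₀ := by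
  obtain ⟨x₀, hx₀⟩ := hΩ'
  refine ⟨q / 2, p, K a b c x₀ - q / 2 * I x₀ ^ 2 - p * I x₀, fun x hx => ?_⟩
  have := eq_of_hasDerivAt_zero (f := fun x => K a b c x - q / 2 * I x ^ 2 - p * I x) hΩ
    (fun y hy => by
      have hs : √(a y) ≠ 0 := (h.sqrt_pos hy).ne'
      refine (((h.hasDerivAt_K hy).sub (((h.isI y hy).pow 2).const_mul (q / 2))).sub
        ((h.isI y hy).const_mul p)).congr_deriv ?_
      have e := hK y hy
      push_cast
      field_simp
      linear_combination e) hx hx₀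
  linarith

/-- If `½ z √a K' + K` is a quadratic polynomial in `z`, where `z = I`, then `z² K` is a quartic
polynomial without linear term. -/
theorem exists_quartic (hΩ : (Ω : Set ℝ).OrdConnected) (hΩ' : (Ω : Set ℝ).Nonempty)
    (h : Coeffs Ω a b c I) {A B C : ℝ}
    (hK : ∀ x ∈ Ω, K a b c x + 1 / 2 * I x * (√(a x) * deriv (K a b c) x)
      = A * I x ^ 2 + B * I x + C) :
    ∃ μ : ℝ, ∀ x ∈ Ω, I x ^ 2 * K a b c x
      = μ + I x ^ 2 * (A / 2 * I x ^ 2 + 2 / 3 * B * I x + C) := by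
  obtain ⟨x₀, hx₀⟩ := hΩ'
  refine ⟨I x₀ ^ 2 * K a b c x₀ - (A / 2 * I x₀ ^ 4 + 2 / 3 * B * I x₀ ^ 3 + C * I x₀ ^ 2),
    fun x hx => ?_⟩
  have := eq_of_hasDerivAt_zero (f := fun x => I x ^ 2 * K a b c x
      - (A / 2 * I x ^ 4 + 2 / 3 * B * I x ^ 3 + C * I x ^ 2)) hΩ
    (fun y hy => by
      have hs : √(a y) ≠ 0 := (h.sqrt_pos hy).ne'
      have dI := h.isI y hy
      refine (((dI.pow 2).mul (h.hasDerivAt_K hy)).sub ((((dI.pow 4).const_mul (A / 2)).add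
        ((dI.pow 3).const_mul (2 / 3 * B))).add ((dI.pow 2).const_mul C))).congr_deriv ?_
      have e := hK y hy
      simp only [Pi.pow_apply]
      push_cast
      field_simp
      linear_combination 4 * I y * e) hx hx₀
  linear_combination this

/-- Division by `I²` is legitimate except where `I = 0`. By injectivity this is at most one point,
and there continuity of both sides gives the equality. -/
theorem KForm6_of_sq_mul (hΩ : (Ω : Set ℝ).OrdConnected) (h : Coeffs Ω a b c I) {c₂ c₁ c₀ : ℝ}
    (hK : ∀ x ∈ Ω, I x ^ 2 * K a b c x = I x ^ 2 * (c₂ * I x ^ 2 + c₁ * I x + c₀)) :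
    KForm6 Ω a b c I c₂ c₁ c₀ := by
  intro x hx
  by_cases hI : I x = 0
  · let G : ℝ → ℝ := fun y => K a b c y - (c₂ * I y ^ 2 + c₁ * I y + c₀)
    have hG : ContinuousAt G x := by
      have dI := (h.isI x hx).continuousAt
      exact (h.hasDerivAt_K hx).continuousAt.sub
        (((continuousAt_const.mul (dI.pow 2)).add (continuousAt_const.mul dI)).add
          continuousAt_const)
    have h0 : ∀ᶠ y in nhdsWithin x {x}ᶜ, G y = 0 := by
      filter_upwards [self_mem_nhdsWithin, mem_nhdsWithin_of_mem_nhds (Ω.isOpen.mem_nhds hx)]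
        with y hyx hy
      have hIy : I y ≠ 0 := fun h0 => hyx (h.injOn_I hΩ hy hx (h0.trans hI.symm))
      have := mul_left_cancel₀ (pow_ne_zero 2 hIy) (hK y hy)
      simp only [G, this, sub_self]
    have h1 : Filter.Tendsto G (nhdsWithin x {x}ᶜ) (nhds 0) :=
      tendsto_const_nhds.congr' (h0.mono fun y hy => hy.symm)
    have h2 := tendsto_nhds_unique (hG.tendsto.mono_left nhdsWithin_le_nhds) h1
    exact sub_eq_zero.1 h2
  · exact mul_left_cancel₀ (pow_ne_zero 2 hI) (hK x hx)

/-- In `I³` times the residual, the constant term `2 μ ρ` forces `ρ = 0` at every time, hence `ρ'' =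
0`. The coefficient of `I⁴` then reduces to `-(3/2) c₁ τ'`. -/
theorem linear_coeff_eq_zero (hΩ : (Ω : Set ℝ).OrdConnected) (hΩ' : (Ω : Set ℝ).Nonempty)
    (h : Coeffs Ω a b c I) {μ c₂ c₁ c₀ : ℝ} (hμ : μ ≠ 0)
    (hK : ∀ x ∈ Ω, I x ≠ 0 ∧ K a b c x = μ / I x ^ 2 + c₂ * I x ^ 2 + c₁ * I x + c₀)
    {τ ρ χ : ℝ → ℝ} (hr : ∀ t ∈ S, ∀ x ∈ Ω, residual a b c I τ ρ χ t x = 0) {t : ℝ} (ht : t ∈ S)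
    (hτ : deriv τ t ≠ 0) : c₁ = 0 := by
  have hK' : ∀ x ∈ Ω, √(a x) * deriv (K a b c) x = -(2 * μ / I x ^ 3) + 2 * c₂ * I x + c₁ := by
    intro x hx
    have hs : √(a x) ≠ 0 := (h.sqrt_pos hx).ne'
    have hI := (hK x hx).1
    rw [(hasDerivAt_congr_opens (fun y hy => (hK y hy).2) hx
      (((((hasDerivAt_const x μ).div ((h.isI x hx).pow 2) (pow_ne_zero 2 hI)).add
      (((h.isI x hx).pow 2).const_mul c₂)).add ((h.isI x hx).const_mul c₁)).add_const c₀)).deriv]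
    push_cast
    simp only [Pi.pow_apply]
    field_simp
    ring
  have key : ∀ t ∈ S, ρ t = 0 ∧
      -(1 / 2 * deriv (deriv ρ) t) - 3 / 2 * c₁ * deriv τ t - 2 * c₂ * ρ t = 0 := by
    intro t ht
    obtain ⟨h0, -, -, -, h4, -⟩ := h.quintic_eq_zero hΩ hΩ'
      (p₀ := 2 * μ * ρ t) (p₁ := 0) (p₂ := 0)
      (p₃ := deriv χ t + 1 / 4 * deriv (deriv τ) t - c₀ * deriv τ t - c₁ * ρ t)
      (p₄ := -(1 / 2 * deriv (deriv ρ) t) - 3 / 2 * c₁ * deriv τ t - 2 * c₂ * ρ t)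
      (p₅ := -(1 / 8 * deriv (deriv (deriv τ)) t) - 2 * c₂ * deriv τ t)
      (fun x hx => by
        have hI := (hK x hx).1
        have e := hr t ht x hx
        rw [residual, hK' x hx, (hK x hx).2] at e
        have e' := congrArg (I x ^ 3 * ·) e
        simp only [mul_zero] at e'
        refine Eq.trans ?_ e'
        field_simp
        ring)
    exact ⟨by simpa [hμ] using h0, h4⟩
  have hρ1 : ∀ t ∈ S, deriv ρ t = 0 := fun t ht =>
    (deriv_eq_of_eqOn (g := fun _ => 0) (fun s hs => (key s hs).1) ht).trans (deriv_const _ _)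
  have hρ2 : deriv (deriv ρ) t = 0 :=
    (deriv_eq_of_eqOn (g := fun _ => 0) hρ1 ht).trans (deriv_const _ _)
  obtain ⟨k1, k2⟩ := key t ht
  rw [hρ2, k1] at k2
  have : c₁ * deriv τ t = 0 := by linear_combination (-2 / 3) * k2
  exact (mul_eq_zero.1 this).resolve_right hτ

/-- A single nontrivial symmetry suffices. The residual at one time with `τ' ≠ 0`, or with `ρ ≠ 0`
if `τ' = 0` throughout, is a linear first-order equation for `K` in the variable `I`, and its
solutions have the stated forms. -/
theorem exists_KForm_of_nontrivial (hΩ : (Ω : Set ℝ).OrdConnected) (hΩ' : (Ω : Set ℝ).Nonempty)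
    (h : Coeffs Ω a b c I) (hS : (S : Set ℝ).OrdConnected) (hS' : (S : Set ℝ).Nonempty)
    (X : SmoothVF (dom S Ω)) (hL : HasLinearForm S Ω X) (hP : IsPointSymmetry S Ω a b c X)
    (hX : ¬ IsTrivialField S Ω X) :
    (∃ c₂ c₁ c₀ : ℝ, KForm6 Ω a b c I c₂ c₁ c₀) ∨
      ∃ I', IsI Ω a I' ∧ ∃ μ c₂ c₀ : ℝ, μ ≠ 0 ∧ KForm4 Ω a b c I' μ c₂ c₀ := by
  obtain ⟨τ, ρ, χ, r⟩ := exists_rep hΩ hΩ' h X hL hP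
  by_cases hτ : ∀ t ∈ S, deriv τ t = 0
  · left
    obtain ⟨t, ht, hρ⟩ : ∃ t ∈ S, ρ t ≠ 0 := by
      by_contra! hρ
      exact hX (r.isTrivialField hS hS' hτ hρ hΩ')
    have hτ2 : ∀ t ∈ S, deriv (deriv τ) t = 0 := fun t ht =>
      (deriv_eq_of_eqOn (g := fun _ => 0) hτ ht).trans (deriv_const _ _)
    have hτ3 : deriv (deriv (deriv τ)) t = 0 :=
      (deriv_eq_of_eqOn (g := fun _ => 0) hτ2 ht).trans (deriv_const _ _)
    refine exists_KForm6_of_deriv_eq hΩ hΩ' h (p := deriv χ t / ρ t)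
      (q := -(1 / 2 * deriv (deriv ρ) t / ρ t)) fun x hx => ?_
    have e := r.res t ht x hx
    rw [residual, hτ3, hτ2 t ht, hτ t ht] at e
    field_simp
    linear_combination (-2) * e
  · push Not at hτ
    obtain ⟨t, ht, hτ⟩ := hτ
    -- The shift making `½ τ' I + ρ = ½ τ' z`.
    let d := 2 * ρ t / deriv τ t
    let z : ℝ → ℝ := fun x => I x + d
    have hz : Coeffs Ω a b c z :=
      ⟨h.smooth_a, h.smooth_b, h.smooth_c, h.pos, fun x hx => (h.isI x hx).add_const d⟩
    -- Dividing the residual by `τ'` gives `K + ½ z dK/dz = α I² + β I + γ`; the arguments `A`, `B`,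
    -- `C` below re-expand the right side in `z = I + d`.
    let α := -(1 / 8 * deriv (deriv (deriv τ)) t / deriv τ t)
    let β := -(1 / 2 * deriv (deriv ρ) t / deriv τ t)
    let γ := (deriv χ t + 1 / 4 * deriv (deriv τ) t) / deriv τ t
    obtain ⟨μ, hμ⟩ := exists_quartic hΩ hΩ' hz (A := α) (B := β - 2 * α * d)
      (C := α * d ^ 2 - β * d + γ) fun x hx => by
        have e := r.res t ht x hx
        simp only [residual] at e
        simp only [z, α, β, γ, d]
        field_simp
        linear_combination (-64 * deriv τ t ^ 2) * e
    by_cases hμ0 : μ = 0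
    · left
      have h6 := KForm6_of_sq_mul hΩ hz fun x hx => (hμ x hx).trans (by rw [hμ0, zero_add])
      refine ⟨α / 2, α * d + 2 / 3 * (β - 2 * α * d), α / 2 * d ^ 2
        + 2 / 3 * (β - 2 * α * d) * d + (α * d ^ 2 - β * d + γ), fun x hx => (h6 x hx).trans ?_⟩
      simp only [z]
      ring
    · right
      have hK : ∀ x ∈ Ω, z x ≠ 0 ∧ K a b c x = μ / z x ^ 2 + α / 2 * z x ^ 2
          + 2 / 3 * (β - 2 * α * d) * z x + (α * d ^ 2 - β * d + γ) := by
        intro x hx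
        have e := hμ x hx
        -- At a zero of `z` the identity `z² K = μ + z² (...)` would read `0 = μ`.
        have hz0 : z x ≠ 0 := fun h0 => hμ0 (by rw [h0] at e; linear_combination -e)
        refine ⟨hz0, mul_left_cancel₀ (pow_ne_zero 2 hz0) (e.trans ?_)⟩
        field_simp
        ring
      -- The same symmetry is parametrized with respect to the antiderivative `z`. This may change
      -- `ρ` and `χ`, but `τ` is the `∂_t` component and stays the same, so `τ' ≠ 0` persists.
      obtain ⟨τ', ρ', χ', r'⟩ := exists_rep hΩ hΩ' hz X hL hP
      have hττ' : ∀ s ∈ S, τ s = τ' s := by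
        obtain ⟨x, hx⟩ := hΩ'
        intro s hs
        have := (r.eq _ (mk_mem_dom 0 hs hx)).symm.trans (r'.eq _ (mk_mem_dom 0 hs hx))
        exact congrArg Prod.fst this
      have hlin := linear_coeff_eq_zero hΩ hΩ' hz hμ0 hK r'.res ht
        (by rwa [← deriv_eq_of_eqOn hττ' ht])
      refine ⟨z, hz.isI, μ, α / 2, α * d ^ 2 - β * d + γ, hμ0, fun x hx => ⟨(hK x hx).1, ?_⟩⟩
      rw [(hK x hx).2, hlin, zero_mul, add_zero]

end Classification

/-! ### The isomorphism types -/

/-- The bracket in terms of initial data. -/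
def lieJet (c₂ c₁ c₀ : ℝ) (d e : Fin 6 → ℝ) : Fin 6 → ℝ :=
  ![d 0 * e 1 - e 0 * d 1,
    d 0 * e 2 - e 0 * d 2,
    d 1 * e 2 - e 1 * d 2 - 16 * c₂ * (d 0 * e 1 - e 0 * d 1),
    d 0 * e 4 + 1 / 2 * d 3 * e 1 - (e 0 * d 4 + 1 / 2 * e 3 * d 1),
    1 / 2 * d 1 * e 4 + d 0 * (-(3 * c₁ * e 1) - 4 * c₂ * e 3) + 1 / 2 * d 3 * e 2
      - (1 / 2 * e 1 * d 4 + e 0 * (-(3 * c₁ * d 1) - 4 * c₂ * d 3) + 1 / 2 * e 3 * d 2),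
    d 0 * (c₀ * e 1 - 1 / 4 * e 2 + c₁ * e 3) - 1 / 2 * d 3 * e 4
      - (e 0 * (c₀ * d 1 - 1 / 4 * d 2 + c₁ * d 3) - 1 / 2 * e 3 * d 4)]

/-- The differential equations eliminate `τ'''`, `ρ''` and `χ'`, so the data of a bracket depend
only on the data of its factors. -/
theorem jetAt_lie {S : Opens ℝ} {c₂ c₁ c₀ : ℝ} {τ ρ χ τ' ρ' χ' : ℝ → ℝ}
    (hs : SmoothTriple S τ ρ χ) (hs' : SmoothTriple S τ' ρ' χ') (ho : IsODESol S c₂ c₁ c₀ τ ρ χ)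
    (ho' : IsODESol S c₂ c₁ c₀ τ' ρ' χ') {t₀ : ℝ} (ht₀ : t₀ ∈ S) :
    jetAt t₀ (lieTau τ τ') (lieRho τ ρ τ' ρ') (lieChi τ ρ χ τ' ρ' χ') =
      lieJet c₂ c₁ c₀ (jetAt t₀ τ ρ χ) (jetAt t₀ τ' ρ' χ') := by
  obtain ⟨o1, o2, o3⟩ := ho t₀ ht₀
  obtain ⟨o1', o2', o3'⟩ := ho' t₀ ht₀
  rw [jetAt, deriv_lieTau hs hs' ht₀, deriv2_lieTau hs hs' ht₀, deriv_lieRho hs hs' ht₀, lieTau,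
    lieRho, lieChi, o1, o2, o3, o1', o2', o3']
  ext i
  fin_cases i <;>
    simp only [lieJet, jetAt, Fin.zero_eta, Fin.mk_one, Fin.reduceFinMk, Fin.isValue,
      Matrix.cons_val] <;> ring

/-- The component of the initial data in `sl(2, ℝ)`. -/
def toSL2 (c₂ : ℝ) (d : Fin 6 → ℝ) : SL2 :=
  ⟨!![-(1 / 2 * d 1), d 0; -(4 * c₂ * d 0) - 1 / 2 * d 2, 1 / 2 * d 1], by
    have h : Matrix.trace !![-(1 / 2 * d 1), d 0; -(4 * c₂ * d 0) - 1 / 2 * d 2, 1 / 2 * d 1]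
      = 0 := by simp [Matrix.trace_fin_two]
    exact h⟩

/-- The component of the initial data along `u ∂_u`. -/
def toCenter (c₀ : ℝ) (d : Fin 6 → ℝ) : ℝ := d 5 - c₀ * d 0 + 1 / 4 * d 1

/-- The matrix is the adjoint action on the data `(ρ, ρ')` of fields with `τ = 0`: such a field goes
to `τ ρ' - ½ τ' ρ`, whose derivative is evaluated with `ρ'' = -4 c₂ ρ`. -/
theorem toSL2_lie (c₂ c₁ c₀ : ℝ) (d e : Fin 6 → ℝ) :
    toSL2 c₂ (lieJet c₂ c₁ c₀ d e) = ⁅toSL2 c₂ d, toSL2 c₂ e⁆ := by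
  apply Subtype.ext
  change _ = (toSL2 c₂ d).1 * (toSL2 c₂ e).1 - (toSL2 c₂ e).1 * (toSL2 c₂ d).1
  ext i j
  fin_cases i <;> fin_cases j <;>
    simp [toSL2, lieJet] <;> ring

theorem toSL2_add (c₂ : ℝ) (d e : Fin 6 → ℝ) : toSL2 c₂ (d + e) = toSL2 c₂ d + toSL2 c₂ e := by
  apply Subtype.ext
  ext i j
  fin_cases i <;> fin_cases j <;> simp [toSL2] <;> ring

theorem toSL2_smul (c₂ r : ℝ) (d : Fin 6 → ℝ) : toSL2 c₂ (r • d) = r • toSL2 c₂ d := by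
  apply Subtype.ext
  ext i j
  fin_cases i <;> fin_cases j <;> simp [toSL2] <;> ring

theorem toSL2_eq (c₂ : ℝ) (A : SL2) (d : Fin 6 → ℝ) (h0 : d 0 = A.1 0 1)
    (h1 : d 1 = -(2 * A.1 0 0)) (h2 : d 2 = -(2 * A.1 1 0) - 8 * c₂ * A.1 0 1) :
    toSL2 c₂ d = A := by
  have hA : A.1 1 1 = -A.1 0 0 := by
    have h : Matrix.trace A.1 = 0 := A.2
    rw [Matrix.trace_fin_two] at h
    linarith
  apply Subtype.ext
  ext i j
  fin_cases i <;> fin_cases j <;> simp [toSL2, h0, h1, h2, hA] <;> ring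

/-- The identification of initial data with elements of the heat algebra. -/
def toHeat (c₂ c₁ c₀ : ℝ) : (Fin 6 → ℝ) →ₗ[ℝ] HeatAlgebra where
  toFun d := ⟨⟨d 3, d 4 + 2 * c₁ * d 0, -(2 * toCenter c₀ d)⟩, toSL2 c₂ d⟩
  map_add' d e := by
    refine LieAlgebra.SemiDirectSum.ext ?_ (toSL2_add c₂ d e)
    simp only [LieAlgebra.SemiDirectSum.add_eq_mk, Nil3.add_def, toCenter, Pi.add_apply]
    ext <;> simp only <;> ring
  map_smul' r d := by
    refine LieAlgebra.SemiDirectSum.ext ?_ (toSL2_smul c₂ r d)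
    simp only [LieAlgebra.SemiDirectSum.smul_eq_mk, Nil3.smul_def, toCenter, Pi.smul_apply,
      smul_eq_mul, RingHom.id_apply]
    ext <;> simp only <;> ring

theorem toHeat_apply (c₂ c₁ c₀ : ℝ) (d : Fin 6 → ℝ) : toHeat c₂ c₁ c₀ d =
    ⟨⟨d 3, d 4 + 2 * c₁ * d 0, -(2 * toCenter c₀ d)⟩, toSL2 c₂ d⟩ := rfl

/-- Two fields with `τ = 0` bracket to `χ = -½ (ρ₁ ρ₂' - ρ₂ ρ₁')`, which explains the factor `-2` on
the central coordinate. The shift of `ρ'` by `2 c₁ τ` produces, through the Heisenberg bracket, the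
term `c₁ ρ` in `χ'`; subtracting `c₀ τ - ¼ τ'` from `χ` absorbs the other two terms. -/
theorem toHeat_lie (c₂ c₁ c₀ : ℝ) (d e : Fin 6 → ℝ) :
    toHeat c₂ c₁ c₀ (lieJet c₂ c₁ c₀ d e) = ⁅toHeat c₂ c₁ c₀ d, toHeat c₂ c₁ c₀ e⁆ := by
  refine LieAlgebra.SemiDirectSum.ext ?_ (toSL2_lie c₂ c₁ c₀ d e)
  rw [LieAlgebra.SemiDirectSum.lie_eq_mk]
  have hψ : ∀ (A : SL2) (v : Nil3), Nil3.actHom A v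
    = ⟨A.1 0 0 * v.p + A.1 0 1 * v.q, A.1 1 0 * v.p + A.1 1 1 * v.q, 0⟩ := fun _ _ => rfl
  simp only [toHeat_apply, hψ, Nil3.lie_def, Nil3.add_def, Nil3.sub_def]
  ext <;> simp [toCenter, toSL2, lieJet] <;> ring

theorem toHeat_surjective (c₂ c₁ c₀ : ℝ) : Function.Surjective (toHeat c₂ c₁ c₀) := by
  rintro ⟨⟨p, q, z⟩, A⟩
  refine ⟨![A.1 0 1, -(2 * A.1 0 0), -(2 * A.1 1 0) - 8 * c₂ * A.1 0 1, p, q - 2 * c₁ * A.1 0 1,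
    -(z / 2) + c₀ * A.1 0 1 + 1 / 2 * A.1 0 0], ?_⟩
  refine LieAlgebra.SemiDirectSum.ext ?_ (toSL2_eq c₂ A _ rfl rfl rfl)
  rw [toHeat_apply]
  ext <;> simp [toCenter]
  ring

theorem toHeat_injective (c₂ c₁ c₀ : ℝ) : Function.Injective (toHeat c₂ c₁ c₀) := by
  rw [injective_iff_map_eq_zero]
  intro d hd
  have hl := congrArg (fun v : HeatAlgebra => v.left) hd
  have hr := congrArg (fun v : HeatAlgebra => v.right.1) hd
  have e3 : d 3 = 0 := congrArg Nil3.p hl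
  have e4 : d 4 + 2 * c₁ * d 0 = 0 := congrArg Nil3.q hl
  have e5 : -(2 * toCenter c₀ d) = 0 := congrArg Nil3.z hl
  have e0 : d 0 = 0 := congrFun (congrFun hr 0) 1
  have e1 : 1 / 2 * d 1 = 0 := congrFun (congrFun hr 1) 1
  have e2 : -(4 * c₂ * d 0) - 1 / 2 * d 2 = 0 := congrFun (congrFun hr 1) 0
  rw [toCenter] at e5
  simp only [e0, mul_zero, add_zero, sub_zero, neg_zero] at e4 e5 e2
  ext i
  fin_cases i
  · exact e0
  · simp only [Fin.mk_one, Pi.zero_apply]; linarith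
  · simp only [Fin.reduceFinMk, Pi.zero_apply]; linarith
  · exact e3
  · exact e4
  · simp only [Fin.reduceFinMk, Pi.zero_apply]; linarith

section Isomorphisms

variable {S Ω : Opens ℝ} {a b c I : ℝ → ℝ}
  {𝔤 : LieSubalgebra ℝ (SmoothVF (dom S Ω))}

theorem nonempty_equiv_heatAlgebra (hS : (S : Set ℝ).OrdConnected) (hS' : (S : Set ℝ).Nonempty)
    (hΩ : (Ω : Set ℝ).OrdConnected) (hΩ' : (Ω : Set ℝ).Nonempty) (h : Coeffs Ω a b c I)
    (h𝔤 : IsSymmetryAlgebra S Ω a b c 𝔤) {c₂ c₁ c₀ : ℝ} (hK : KForm6 Ω a b c I c₂ c₁ c₀) :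
    Nonempty (𝔤 ≃ₗ⁅ℝ⁆ HeatAlgebra) := by
  obtain ⟨P, hP, -⟩ := exists_isSolFamily S c₂ c₁ c₀
  have hdim := (hasBasis_of_KForm6 hS hΩ hΩ' h h𝔤 hS' hK hP).2
  obtain ⟨t₀, ht₀⟩ := hS'
  obtain ⟨D, hD⟩ := exists_dataMap hΩ hΩ' h h𝔤 ht₀
  have hinj := IsDataMap.injective_of_KForm6 hS hΩ hΩ' h h𝔤 hK ht₀ hD
  have : Module.Finite ℝ 𝔤 := Module.Finite.of_injective D hinj
  have hsurj : Function.Surjective D :=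
    (LinearMap.injective_iff_surjective_of_finrank_eq_finrank (by simpa using hdim)).1 hinj
  have hlie : ∀ X Y : 𝔤, D ⁅X, Y⁆ = lieJet c₂ c₁ c₀ (D X) (D Y) := by
    intro X Y
    obtain ⟨τ, ρ, χ, r⟩ := exists_rep_of_mem hΩ hΩ' h h𝔤 X
    obtain ⟨τ', ρ', χ', r'⟩ := exists_rep_of_mem hΩ hΩ' h h𝔤 Y
    rw [hD ⁅X, Y⁆ _ _ _ (r.lie h r'), hD X _ _ _ r, hD Y _ _ _ r']
    exact jetAt_lie r.smooth r'.smooth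
      ((residual_eq_zero_iff_of_KForm6 hΩ hΩ' h hK _ _ _).1 r.res)
      ((residual_eq_zero_iff_of_KForm6 hΩ hΩ' h hK _ _ _).1 r'.res) ht₀
  let F : 𝔤 →ₗ⁅ℝ⁆ HeatAlgebra :=
    { (toHeat c₂ c₁ c₀).comp D with
      map_lie' := fun {X Y} => by
        change toHeat c₂ c₁ c₀ (D ⁅X, Y⁆) = ⁅toHeat c₂ c₁ c₀ (D X), toHeat c₂ c₁ c₀ (D Y)⁆
        rw [hlie, toHeat_lie] }
  exact ⟨LieEquiv.ofBijective F ⟨(toHeat_injective c₂ c₁ c₀).comp hinj,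
    (toHeat_surjective c₂ c₁ c₀).comp hsurj⟩⟩

/-- With `ρ = 0` and `c₁ = 0`, the quantity `χ - c₀ τ + ¼ τ'` is constant in time. It splits off as
the coefficient of `M` and vanishes on brackets. -/
theorem exists_equiv_sl2_prod (hS : (S : Set ℝ).OrdConnected) (hS' : (S : Set ℝ).Nonempty)
    (hΩ : (Ω : Set ℝ).OrdConnected) (hΩ' : (Ω : Set ℝ).Nonempty) (h : Coeffs Ω a b c I)
    (h𝔤 : IsSymmetryAlgebra S Ω a b c 𝔤)
    {μ c₂ c₀ : ℝ} (hμ : μ ≠ 0) (hK : KForm4 Ω a b c I μ c₂ c₀) :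
    ∃ e : 𝔤 ≃ₗ⁅ℝ⁆ (SL2 × ℝ), ∀ m : 𝔤,
      (∀ p ∈ dom S Ω, ((m : SmoothVF (dom S Ω)) : TXU → TXU) p = vM p) → e m = (0, 1) := by
  obtain ⟨P, hP, hρ⟩ := exists_isSolFamily S c₂ 0 c₀
  have hdim := (hasBasis_of_KForm4 hS hΩ hΩ' h h𝔤 hS' hμ hK hP (hρ rfl)).2
  obtain ⟨t₀, ht₀⟩ := hS'
  obtain ⟨D, hD⟩ := exists_dataMap hΩ hΩ' h h𝔤 ht₀
  have hinj := IsDataMap.injective_of_KForm4 hS hΩ hΩ' h h𝔤 hμ hK ht₀ hD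
  have : Module.Finite ℝ 𝔤 := Module.Finite.of_injective _ hinj
  have hsurj : Function.Surjective ((LinearMap.funLeft ℝ ℝ fourOfSix).comp D) :=
    (LinearMap.injective_iff_surjective_of_finrank_eq_finrank (by simpa using hdim)).1 hinj
  have hD3 : ∀ X : 𝔤, D X 3 = 0 ∧ D X 4 = 0 := by
    intro X
    obtain ⟨τ, ρ, χ, r⟩ := exists_rep_of_mem hΩ hΩ' h h𝔤 X
    have hρ := ((residual_eq_zero_iff_of_KForm4 hΩ hΩ' h hμ hK _ _ _).1 r.res).2
    rw [hD X _ _ _ r]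
    exact ⟨hρ t₀ ht₀, (deriv_eq_of_eqOn (g := fun _ => 0) hρ ht₀).trans (deriv_const _ _)⟩
  have hlie : ∀ X Y : 𝔤, D ⁅X, Y⁆ = lieJet c₂ 0 c₀ (D X) (D Y) := by
    intro X Y
    obtain ⟨τ, ρ, χ, r⟩ := exists_rep_of_mem hΩ hΩ' h h𝔤 X
    obtain ⟨τ', ρ', χ', r'⟩ := exists_rep_of_mem hΩ hΩ' h h𝔤 Y
    rw [hD ⁅X, Y⁆ _ _ _ (r.lie h r'), hD X _ _ _ r, hD Y _ _ _ r']
    exact jetAt_lie r.smooth r'.smooth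
      ((residual_eq_zero_iff_of_KForm4 hΩ hΩ' h hμ hK _ _ _).1 r.res).1
      ((residual_eq_zero_iff_of_KForm4 hΩ hΩ' h hμ hK _ _ _).1 r'.res).1 ht₀
  let F : 𝔤 →ₗ⁅ℝ⁆ SL2 × ℝ :=
    { toFun := fun X => (toSL2 c₂ (D X), toCenter c₀ (D X))
      map_add' := fun X Y => by
        rw [map_add, toSL2_add]
        refine Prod.ext rfl ?_
        simp only [toCenter, Pi.add_apply, Prod.mk_add_mk]
        ring
      map_smul' := fun s X => by
        rw [map_smul, toSL2_smul]
        refine Prod.ext rfl ?_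
        simp only [toCenter, Pi.smul_apply, smul_eq_mul, RingHom.id_apply, Prod.smul_mk]
        ring
      map_lie' := fun {X Y} => by
        rw [hlie, toSL2_lie]
        refine Prod.ext rfl ?_
        -- The bracket on `ℝ` unfolds to the commutator of the product, which is zero.
        change toCenter c₀ _ = toCenter c₀ (D X) * toCenter c₀ (D Y)
          - toCenter c₀ (D Y) * toCenter c₀ (D X)
        simp [toCenter, lieJet, hD3 X, hD3 Y]
        ring }
  have hF : ∀ X, F X = (toSL2 c₂ (D X), toCenter c₀ (D X)) := fun _ => rfl
  refine ⟨LieEquiv.ofBijective F ⟨?_, ?_⟩, fun m hm => ?_⟩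
  · rw [injective_iff_map_eq_zero]
    intro X hX
    rw [hF] at hX
    have hr := congrArg (fun v : SL2 × ℝ => v.1.1) hX
    have e5 : toCenter c₀ (D X) = 0 := congrArg Prod.snd hX
    have e0 : D X 0 = 0 := congrFun (congrFun hr 0) 1
    have e1 : 1 / 2 * D X 1 = 0 := congrFun (congrFun hr 1) 1
    have e2 : -(4 * c₂ * D X 0) - 1 / 2 * D X 2 = 0 := congrFun (congrFun hr 1) 0
    rw [toCenter] at e5
    simp only [e0, mul_zero, sub_zero, neg_zero] at e5 e2
    refine (injective_iff_map_eq_zero _).1 hinj X (funext fun i => ?_)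
    fin_cases i
    · exact e0
    · change D X 1 = 0; linarith
    · change D X 2 = 0; linarith
    · change D X 5 = 0; linarith
  · rintro ⟨A, z⟩
    obtain ⟨X, hX⟩ := hsurj ![A.1 0 1, -(2 * A.1 0 0), -(2 * A.1 1 0) - 8 * c₂ * A.1 0 1,
      z + c₀ * A.1 0 1 + 1 / 2 * A.1 0 0]
    have e0 : D X 0 = A.1 0 1 := congrFun hX 0
    have e1 : D X 1 = -(2 * A.1 0 0) := congrFun hX 1
    have e2 : D X 2 = -(2 * A.1 1 0) - 8 * c₂ * A.1 0 1 := congrFun hX 2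
    have e5 : D X 5 = z + c₀ * A.1 0 1 + 1 / 2 * A.1 0 0 := congrFun hX 3
    refine ⟨X, ?_⟩
    rw [hF, toSL2_eq c₂ A _ e0 e1 e2, toCenter, e0, e1, e5]
    refine Prod.ext rfl ?_
    simp only
    ring
  -- `M` has parameters `(0, 0, 1)` whatever the constants are, so the zero-constant family can be
  -- used to identify it.
  · have r : Rep S Ω a b c I (m.1 : TXU → TXU) zeroFun zeroFun (polyFun 1 0 0 0 0) := by
      refine ⟨⟨(contDiff_polyFun ..).contDiffOn, (contDiff_polyFun ..).contDiffOn,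
        (contDiff_polyFun ..).contDiffOn⟩, fun p hp => (hm p hp).trans ?_, fun t _ x _ => ?_⟩
      · exact (congrFun (toField_paramsZero a b I 0 0 5) p).symm
      · simp [residual, deriv_polyFun, polyFun]
    change F m = (0, 1)
    have hDm : D m = ![0, 0, 0, 0, 0, 1] := by
      rw [hD m _ _ _ r]
      simp [jetAt, deriv_polyFun, polyFun]
    rw [hF, hDm, toSL2_eq c₂ 0 _ (by simp) (by simp) (by simp)]
    simp [toCenter]

/-- For trivial fields the entries `τ(t₀)` and `χ(t₀)` of the data are the two constants themselves,
so these two entries already separate the fields. -/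
theorem finrank_le_two_of_trivial (hS' : (S : Set ℝ).Nonempty) (hΩ : (Ω : Set ℝ).OrdConnected)
    (hΩ' : (Ω : Set ℝ).Nonempty) (h : Coeffs Ω a b c I) (h𝔤 : IsSymmetryAlgebra S Ω a b c 𝔤)
    (ht : ∀ X ∈ 𝔤, IsTrivialField S Ω X) :
    Module.finrank ℝ 𝔤 ≤ 2 := by
  obtain ⟨t₀, ht₀⟩ := hS'
  obtain ⟨D, hD⟩ := exists_dataMap hΩ hΩ' h h𝔤 ht₀
  have hinj : Function.Injective ((LinearMap.funLeft ℝ ℝ (![0, 5] : Fin 2 → Fin 6)).comp D) := by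
    rw [injective_iff_map_eq_zero]
    intro X hX
    obtain ⟨α, β, hαβ⟩ := ht X.1 X.2
    have r : Rep S Ω a b c I (X.1 : TXU → TXU) (polyFun α 0 0 0 0) zeroFun (polyFun β 0 0 0 0) := by
      refine ⟨⟨(contDiff_polyFun ..).contDiffOn, (contDiff_polyFun ..).contDiffOn,
        (contDiff_polyFun ..).contDiffOn⟩, fun p hp => (hαβ p hp).trans ?_, fun t _ x _ => ?_⟩
      · simp [symField, field, symXi, symPhi, deriv_polyFun, polyFun]
      · simp [residual, deriv_polyFun, polyFun]
    rw [LinearMap.comp_apply, hD X _ _ _ r] at hX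
    have e0 : polyFun α 0 0 0 0 t₀ = 0 := congrFun hX 0
    have e5 : polyFun β 0 0 0 0 t₀ = 0 := congrFun hX 1
    have hα : α = 0 := by simpa [polyFun] using e0
    have hβ : β = 0 := by simpa [polyFun] using e5
    refine Subtype.ext (r.eq_zero fun t _ => ?_)
    simp [polyFun, hα, hβ]
  simpa using LinearMap.finrank_le_finrank_of_injective hinj

end Isomorphisms

end ParabolicSymmetry

end

/-! ### The classification theorem -/

open ParabolicSymmetry in
theorem mainTheorem1
    (S Ω : TopologicalSpace.Opens ℝ)
    (hS : (S : Set ℝ).OrdConnected) (hS' : (S : Set ℝ).Nonempty)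
    (hΩ : (Ω : Set ℝ).OrdConnected) (hΩ' : (Ω : Set ℝ).Nonempty)
    (a b c : ℝ → ℝ)
    (ha : ContDiffOn ℝ ∞ a Ω) (hb : ContDiffOn ℝ ∞ b Ω) (hc : ContDiffOn ℝ ∞ c Ω)
    (ha_pos : ∀ x ∈ Ω, 0 < a x) :
    ∃ 𝔤 : LieSubalgebra ℝ (SmoothVF (dom S Ω)), IsSymmetryAlgebra S Ω a b c 𝔤 ∧
      -- a nontrivial symmetry algebra has dimension four or six
      ((∃ X ∈ 𝔤, ¬ IsTrivialField S Ω X) →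
        Module.finrank ℝ 𝔤 = 4 ∨ Module.finrank ℝ 𝔤 = 6) ∧
      -- the four-dimensional case
      (Module.finrank ℝ 𝔤 = 4 ↔
        ∃ I, IsI Ω a I ∧ ∃ μ c₂ c₀ : ℝ, μ ≠ 0 ∧ KForm4 Ω a b c I μ c₂ c₀) ∧
      (Module.finrank ℝ 𝔤 = 4 →
        ∃ e : 𝔤 ≃ₗ⁅ℝ⁆ (SL2 × ℝ), ∀ m : 𝔤,
          (∀ p ∈ dom S Ω, ((m : SmoothVF (dom S Ω)) : TXU → TXU) p = vM p) → e m = (0, 1)) ∧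
      (∀ I, IsI Ω a I → ∀ μ c₂ c₀ : ℝ, μ ≠ 0 → KForm4 Ω a b c I μ c₂ c₀ →
        (c₂ = 0 → HasBasis 𝔤 (basis4Zero a b I c₀)) ∧
        (∀ κ : ℝ, 0 < κ → c₂ = -κ ^ 2 → HasBasis 𝔤 (basis4Neg a b I c₀ κ)) ∧
        (∀ κ : ℝ, 0 < κ → c₂ = κ ^ 2 → HasBasis 𝔤 (basis4Pos a b I c₀ κ))) ∧
      -- the six-dimensional case
      (∀ I, IsI Ω a I →
        (Module.finrank ℝ 𝔤 = 6 ↔ ∃ c₂ c₁ c₀ : ℝ, KForm6 Ω a b c I c₂ c₁ c₀)) ∧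
      (Module.finrank ℝ 𝔤 = 6 → Nonempty (𝔤 ≃ₗ⁅ℝ⁆ HeatAlgebra)) ∧
      (∀ I, IsI Ω a I → ∀ c₂ c₁ c₀ : ℝ, KForm6 Ω a b c I c₂ c₁ c₀ →
        (c₂ = 0 → HasBasis 𝔤 (basis6Zero a b I c₁ c₀)) ∧
        (∀ κ : ℝ, 0 < κ → c₂ = -κ ^ 2 → HasBasis 𝔤 (basis6Neg a b I c₁ c₀ κ)) ∧
        (∀ κ : ℝ, 0 < κ → c₂ = κ ^ 2 → HasBasis 𝔤 (basis6Pos a b I c₁ c₀ κ))) := by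
  have coeffs : ∀ I, IsI Ω a I → Coeffs Ω a b c I := fun I hI => ⟨ha, hb, hc, ha_pos, hI⟩
  obtain ⟨I₀, hI₀⟩ := exists_isI hΩ hΩ' ha ha_pos
  obtain ⟨𝔤, h𝔤⟩ := exists_symmetryAlgebra (S := S) hΩ hΩ' (coeffs I₀ hI₀)
  have dim4 : (∃ I, IsI Ω a I ∧ ∃ μ c₂ c₀ : ℝ, μ ≠ 0 ∧ KForm4 Ω a b c I μ c₂ c₀) →
      Module.finrank ℝ 𝔤 = 4 := by
    rintro ⟨I, hI, μ, c₂, c₀, hμ, hK⟩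
    obtain ⟨P, hP, hρ⟩ := exists_isSolFamily S c₂ 0 c₀
    exact (hasBasis_of_KForm4 hS hΩ hΩ' (coeffs I hI) h𝔤 hS' hμ hK hP (hρ rfl)).2
  have dim6 : ∀ I, IsI Ω a I → (∃ c₂ c₁ c₀ : ℝ, KForm6 Ω a b c I c₂ c₁ c₀) →
      Module.finrank ℝ 𝔤 = 6 := by
    rintro I hI ⟨c₂, c₁, c₀, hK⟩
    obtain ⟨P, hP, -⟩ := exists_isSolFamily S c₂ c₁ c₀
    exact (hasBasis_of_KForm6 hS hΩ hΩ' (coeffs I hI) h𝔤 hS' hK hP).2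
  have forms : ∀ I, IsI Ω a I → (∃ X ∈ 𝔤, ¬ IsTrivialField S Ω X) →
      (∃ c₂ c₁ c₀ : ℝ, KForm6 Ω a b c I c₂ c₁ c₀) ∨
        ∃ I', IsI Ω a I' ∧ ∃ μ c₂ c₀ : ℝ, μ ≠ 0 ∧ KForm4 Ω a b c I' μ c₂ c₀ := by
    rintro I hI ⟨X, hX, hnt⟩
    exact exists_KForm_of_nontrivial hΩ hΩ' (coeffs I hI) hS hS' X ((h𝔤 X).1 hX).1
      ((h𝔤 X).1 hX).2 hnt
  have nontriv : 2 < Module.finrank ℝ 𝔤 → ∃ X ∈ 𝔤, ¬ IsTrivialField S Ω X := by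
    intro hlt
    by_contra! hall
    exact absurd (finrank_le_two_of_trivial hS' hΩ hΩ' (coeffs I₀ hI₀) h𝔤 hall) (by omega)
  have form4 : Module.finrank ℝ 𝔤 = 4 →
      ∃ I, IsI Ω a I ∧ ∃ μ c₂ c₀ : ℝ, μ ≠ 0 ∧ KForm4 Ω a b c I μ c₂ c₀ := by
    intro hd
    -- Dimension above two forces a nontrivial symmetry and hence one of the two forms of `K`; the
    -- quadratic form is excluded because it would give dimension six.
    rcases forms I₀ hI₀ (nontriv (by omega)) with h6 | h4
    · have := dim6 I₀ hI₀ h6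
      omega
    · exact h4
  have form6 : ∀ I, IsI Ω a I → Module.finrank ℝ 𝔤 = 6 →
      ∃ c₂ c₁ c₀ : ℝ, KForm6 Ω a b c I c₂ c₁ c₀ := by
    intro I hI hd
    rcases forms I hI (nontriv (by omega)) with h6 | h4
    · exact h6
    · have := dim4 h4
      omega
  refine ⟨𝔤, h𝔤, fun hnt => ?_, ⟨form4, dim4⟩, fun hd => ?_, fun I hI μ c₂ c₀ hμ hK => ?_,
    fun I hI => ⟨form6 I hI, dim6 I hI⟩, fun hd => ?_, fun I hI c₂ c₁ c₀ hK => ?_⟩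
  · rcases forms I₀ hI₀ hnt with h6 | h4
    · exact Or.inr (dim6 I₀ hI₀ h6)
    · exact Or.inl (dim4 h4)
  · obtain ⟨I, hI, μ, c₂, c₀, hμ, hK⟩ := form4 hd
    exact exists_equiv_sl2_prod hS hS' hΩ hΩ' (coeffs I hI) h𝔤 hμ hK
  · have basis := fun P hP hρ =>
      (hasBasis_of_KForm4 (P := P) hS hΩ hΩ' (coeffs I hI) h𝔤 hS' hμ hK hP hρ).1
    refine ⟨?_, fun κ hκ => ?_, fun κ hκ => ?_⟩
    · rintro rfl
      simpa only [toField_paramsZero, basis4Zero_eq] using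
        basis _ (isSolFamily_zero S 0 c₀) (paramsZero_rho c₀)
    · rintro rfl
      simpa only [toField_paramsNeg _ _ _ _ _ hκ.ne', basis4Neg_eq _ _ _ _ hκ.ne'] using
        basis _ (isSolFamily_neg S 0 c₀ hκ.ne') (paramsNeg_rho c₀ κ)
    · rintro rfl
      simpa only [toField_paramsPos _ _ _ _ _ hκ.ne', basis4Pos_eq _ _ _ _ hκ.ne'] using
        basis _ (isSolFamily_pos S 0 c₀ hκ.ne') (paramsPos_rho c₀ κ)
  · obtain ⟨c₂, c₁, c₀, hK⟩ := form6 I₀ hI₀ hd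
    exact nonempty_equiv_heatAlgebra hS hS' hΩ hΩ' (coeffs I₀ hI₀) h𝔤 hK
  · have basis := fun P hP =>
      (hasBasis_of_KForm6 (P := P) hS hΩ hΩ' (coeffs I hI) h𝔤 hS' hK hP).1
    refine ⟨?_, fun κ hκ => ?_, fun κ hκ => ?_⟩
    · rintro rfl
      simpa only [toField_paramsZero] using basis _ (isSolFamily_zero S c₁ c₀)
    · rintro rfl
      simpa only [toField_paramsNeg _ _ _ _ _ hκ.ne'] using basis _ (isSolFamily_neg S c₁ c₀ hκ.ne')
    · rintro rfl
      simpa only [toField_paramsPos _ _ _ _ _ hκ.ne'] using basis _ (isSolFamily_pos S c₁ c₀ hκ.ne')
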